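/- A crystallographic group is a subgroup $G$ of $\operatorname{Isom}(\mathbb R^3)$ that contains the translations by a full-rank discrete lattice as a subgroup of finite index; it is cubic if its point group contains rotations of order three about the four diagonals of a cube. Its odd subgroup is the subgroup generated by all rotations of order three in $G$. Let $R_1$ (of type $F23$) be the group generated by the rotations of order three about all lines with directions $(\pm1,\pm1,\pm1)$ through points of $\mathbb Z^3$. A full cubic group is a cubic crystallographic group whose odd subgroup is conjugate to $R_1$ by a similarity of $\mathbb R^3$. A Dirichlet stereohedron for $G$ is a Voronoi cell $\operatorname{Vor}_{Gp}(p)=\{x : |x-p|\le |x-q| \text{ for all } q\in Gp\}$ with $p\in\mathbb R^3$; its facets are its two-dimensional faces. **Theorem.** 1. Every Dirichlet stereohedron for a full cubic group has at most $25$ facets. 2. The full cubic groups that contain no reflections are, up to conjugation by similarities, exactly the groups with the following fourteen International symbols. If $G$ is such a group and only the identity of $G$ fixes $p$, then $\operatorname{Vor}_{Gp}(p)$ has at most the following number of facets: $$\begin{array}{c|c|c|c|c|c|c} F23 & F432 & F\overline43c & F\frac2d\overline3 & P23 & F4_132 & P432\\ \hline 10 & 14 & 14 & 14 & 15 & 17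 & 11 \end{array}$$ $$\begin{array}{c|c|c|c|c|c|c} I23 & P\frac2n\overline3 & F\frac{4_1}{d}\overline3\frac2n & P\overline43n & P4_232 & P\frac4n\overline3\frac2n & I432\\ \hline 21 & 23 & 25 & 23 & 25 & 23 & 22 \end{array}$$ (Here $F\frac{4_1}{d}\overline3\frac2n$ is the group No. 228 of the International Tables, also written $F\frac{4_1}{d}\overline3\frac2c$.) The largest of these bounds is $25$, and it occurs exactly for $F\frac{4_1}{d}\overline3\frac2n$ and $P4_232$. -/

import Mathlib

noncomputable section

/-- Euclidean three-space. -/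
abbrev E3 : Type := EuclideanSpace ℝ (Fin 3)

/-- The group of isometries of Euclidean three-space. -/
abbrev Isom3 : Type := E3 ≃ᵃⁱ[ℝ] E3

/-! ### Voronoi cells, Dirichlet stereohedra, facets -/

/-- The orbit of the point `p` under the group `G`. -/
def orbitOf (G : Subgroup Isom3) (p : E3) : Set E3 := {q | ∃ g ∈ G, g p = q}

/-- The Voronoi cell of `p` with respect to the set of sites `S`. -/
def voronoiCell (S : Set E3) (p : E3) : Set E3 := {x | ∀ q ∈ S, dist x p ≤ dist x q}

/-- The Dirichlet stereohedra for `G` are the Voronoi cells of the orbits of `G`. -/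
def IsDirichletStereohedron (G : Subgroup Isom3) (P : Set E3) : Prop :=
  ∃ p : E3, P = voronoiCell (orbitOf G p) p

/-- The facets of a (three-dimensional convex) set: its exposed faces of dimension two. -/
def facets (P : Set E3) : Set (Set E3) :=
  {F | IsExposed ℝ P F ∧ Module.finrank ℝ (vectorSpan ℝ F) = 2}

/-- Only the identity of `G` fixes `p`. -/
def HasTrivialStabilizer (G : Subgroup Isom3) (p : E3) : Prop :=
  ∀ g ∈ G, g p = p → g = 1

/-! ### Crystallographic, cubic and full cubic groups -/

/-- The group of translations by the vectors of a lattice `L`. -/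
def translationsBy (L : Submodule ℤ E3) : Subgroup Isom3 where
  carrier := {g | ∃ v ∈ L, ∀ x, g x = x + v}
  one_mem' := ⟨0, L.zero_mem, fun x => by simp⟩
  mul_mem' := by
    rintro a b ⟨v, hv, ha⟩ ⟨w, hw, hb⟩
    refine ⟨w + v, L.add_mem hw hv, fun x => ?_⟩
    rw [AffineIsometryEquiv.coe_mul, Function.comp_apply, ha, hb, add_assoc]
  inv_mem' := by
    rintro a ⟨v, hv, ha⟩
    refine ⟨-v, L.neg_mem hv, fun x => a.injective ?_⟩
    rw [ha (x + -v), neg_add_cancel_right]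
    exact a.apply_symm_apply x

/-- `G` contains (the translations of) a full-dimensional discrete lattice as a subgroup of finite
index. -/
def IsCrystallographic (G : Subgroup Isom3) : Prop :=
  ∃ (L : Submodule ℤ E3) (_ : DiscreteTopology L) (_ : IsZLattice ℝ L),
    translationsBy L ≤ G ∧ (translationsBy L).relIndex G ≠ 0

/-- A crystallographic group is cubic if its point group (the group of linear parts of its elements)
contains rotations of order three about the four diagonals of a cube. (A linear isometry of order
three that fixes a nonzero vector is a rotation about the line spanned by that vector.) -/
def IsCubic (G : Subgroup Isom3) : Prop :=
  IsCrystallographic G ∧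
    ∃ e : OrthonormalBasis (Fin 3) ℝ E3, ∀ ε : Fin 3 → ℤˣ,
      ∃ g ∈ G, orderOf g.linearIsometryEquiv = 3 ∧
        g.linearIsometryEquiv (∑ i, ((ε i : ℤ) : ℝ) • e i) = ∑ i, ((ε i : ℤ) : ℝ) • e i

/-- For `d ≠ 0`: the isometry `g` is a rotation of order three about the line through `x` with
direction `d`. (An isometry of order three that fixes every point of a line is a rotation about it.) -/
def IsThreefoldRotationAbout (g : Isom3) (x d : E3) : Prop :=
  orderOf g = 3 ∧ ∀ s : ℝ, g (x + s • d) = x + s • d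

/-- The odd subgroup of `G`: the subgroup generated by all its rotations of order three. -/
def oddSubgroup (G : Subgroup Isom3) : Subgroup Isom3 :=
  Subgroup.closure {g | g ∈ G ∧ ∃ x d : E3, d ≠ 0 ∧ IsThreefoldRotationAbout g x d}

/-- The group generated by the rotations of order three about all the lines with
directions `(±1, ±1, ±1)` that pass through integer points. -/
def R1 : Subgroup Isom3 :=
  Subgroup.closure {g | ∃ (z : Fin 3 → ℤ) (ε : Fin 3 → ℤˣ),
    IsThreefoldRotationAbout g (WithLp.toLp 2 fun i => (z i : ℝ))
      (WithLp.toLp 2 fun i => ((ε i : ℤ) : ℝ))}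

/-- `H` is conjugate to `G` by a similarity `φ` of space, that is, `H = φ G φ⁻¹`. -/
def AreSimilar (G H : Subgroup Isom3) : Prop :=
  ∃ φ : E3 ≃ᵈ E3, ∀ g : Isom3, g ∈ H ↔ ∃ h ∈ G, ∀ x, g (φ x) = φ (h x)

/-- A full cubic group: a cubic crystallographic group whose odd subgroup is `R1`, up to the choice
of the coordinate system (origin, orthogonal axes and unit of length). -/
def IsFullCubic (G : Subgroup Isom3) : Prop :=
  IsCubic G ∧ AreSimilar R1 (oddSubgroup G)

/-- `g` is the reflection in a plane: its set of fixed points is a plane. -/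
def IsPlaneReflection (g : Isom3) : Prop :=
  ∃ H : AffineSubspace ℝ E3, Module.finrank ℝ H.direction = 2 ∧ ∀ x, g x = x ↔ x ∈ H

/-- `G` contains no reflections. -/
def IsReflectionFree (G : Subgroup Isom3) : Prop := ∀ g ∈ G, ¬ IsPlaneReflection g

/-! ### The fourteen groups of the table, by the generators of the International Tables -/

/-- A coordinate triplet: a formula for the image of the point `(x, y, z)`. -/
abbrev Triplet : Type := ℝ → ℝ → ℝ → Fin 3 → ℝ

/-- The group generated by the isometries that are given by a list of coordinate triplets. -/
def generatedBy (l : List Triplet) : Subgroup Isom3 :=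
  Subgroup.closure {g | ∃ f ∈ l, ∀ p : E3, g p = WithLp.toLp 2 (f (p 0) (p 1) (p 2))}

/-- Generators of the primitive cubic lattice. -/
def latticeP : List Triplet :=
  [fun x y z => ![x + 1, y, z], fun x y z => ![x, y + 1, z], fun x y z => ![x, y, z + 1]]

/-- Generators of the body centered cubic lattice. -/
def latticeI : List Triplet :=
  latticeP ++ [fun x y z => ![x + 1 / 2, y + 1 / 2, z + 1 / 2]]

/-- Generators of the face centered cubic lattice. -/
def latticeF : List Triplet :=
  latticeP ++ [fun x y z => ![x, y + 1 / 2, z + 1 / 2], fun x y z => ![x + 1 / 2, y, z + 1 / 2]]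

/-- Generators of the point group `23`. -/
def gens23 : List Triplet :=
  [fun x y z => ![-x, -y, z], fun x y z => ![-x, y, -z], fun x y z => ![z, x, y]]

/-- Representatives modulo the lattice of generators of `F4_132`. -/
def gensF4132 : List Triplet :=
  [fun x y z => ![-x, -y + 1 / 2, z + 1 / 2], fun x y z => ![-x + 1 / 2, y + 1 / 2, -z],
    fun x y z => ![z, x, y], fun x y z => ![y + 3 / 4, x + 1 / 4, -z + 3 / 4]]

/-- The International symbols of the fourteen full cubic groups without reflections. -/
inductive TableGroup : Type
  /-- `F23` (No. 196) -/
  | F23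
  /-- `F432` (No. 209) -/
  | F432
  /-- `F -4 3 c` (No. 219) -/
  | Fm43c
  /-- `F 2/d -3` (No. 203) -/
  | F2dm3
  /-- `P23` (No. 195) -/
  | P23
  /-- `F 4_1 3 2` (No. 210) -/
  | F4132
  /-- `P432` (No. 207) -/
  | P432
  /-- `I23` (No. 197) -/
  | I23
  /-- `P 2/n -3` (No. 201) -/
  | P2nm3
  /-- `F 4_1/d -3 2/n`, also written `F 4_1/d -3 2/c` (No. 228) -/
  | F41dm32n
  /-- `P -4 3 n` (No. 218) -/
  | Pm43n
  /-- `P 4_2 3 2` (No. 208) -/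
  | P4232
  /-- `P 4/n -3 2/n` (No. 222) -/
  | P4nm32n
  /-- `I432` (No. 211) -/
  | I432

/-- The group with the given International symbol, in a standard coordinate system. -/
def TableGroup.group : TableGroup → Subgroup Isom3
  | F23 => generatedBy (latticeF ++ gens23)
  | F432 => generatedBy (latticeF ++ gens23 ++ [fun x y z => ![y, x, -z]])
  | Fm43c => generatedBy (latticeF ++ gens23 ++ [fun x y z => ![y + 1 / 2, x + 1 / 2, z + 1 / 2]])
  | F2dm3 =>
    generatedBy (latticeF ++ gens23 ++ [fun x y z => ![-x + 1 / 4, -y + 1 / 4, -z + 1 / 4]])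
  | P23 => generatedBy (latticeP ++ gens23)
  | F4132 => generatedBy (latticeF ++ gensF4132)
  | P432 => generatedBy (latticeP ++ gens23 ++ [fun x y z => ![y, x, -z]])
  | I23 => generatedBy (latticeI ++ gens23)
  | P2nm3 =>
    generatedBy (latticeP ++ [fun x y z => ![-x + 1 / 2, -y + 1 / 2, z],
      fun x y z => ![-x + 1 / 2, y, -z + 1 / 2], fun x y z => ![z, x, y],
      fun x y z => ![-x, -y, -z]])
  | F41dm32n =>
    generatedBy (latticeF ++ gensF4132 ++ [fun x y z => ![-x + 3 / 4, -y + 3 / 4, -z + 3 / 4]])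
  | Pm43n => generatedBy (latticeP ++ gens23 ++ [fun x y z => ![y + 1 / 2, x + 1 / 2, z + 1 / 2]])
  | P4232 => generatedBy (latticeP ++ gens23 ++ [fun x y z => ![y + 1 / 2, x + 1 / 2, -z + 1 / 2]])
  | P4nm32n =>
    generatedBy (latticeP ++ gens23 ++
      [fun x y z => ![y, x, -z], fun x y z => ![-x + 1 / 2, -y + 1 / 2, -z + 1 / 2]])
  | I432 => generatedBy (latticeI ++ gens23 ++ [fun x y z => ![y, x, -z]])

/-- The bound on the number of facets in the table. -/
def TableGroup.bound : TableGroup → ℕ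
  | F23 => 10
  | F432 => 14
  | Fm43c => 14
  | F2dm3 => 14
  | P23 => 15
  | F4132 => 17
  | P432 => 11
  | I23 => 21
  | P2nm3 => 23
  | F41dm32n => 25
  | Pm43n => 23
  | P4232 => 25
  | P4nm32n => 23
  | I432 => 22

end

/-! The odd subgroup of `G` is generated by a set that `G` permutes by conjugation, so `G`
normalizes it. In coordinates that turn it into `R1`, stretched by a factor two, the odd subgroup
consists of the cyclic permutations of the axes with an even number of sign changes, followed by a
translation by even integers whose sum is divisible by 4. An isometry that normalizes this group is
a signed permutation followed by an integral translation whose three components have equal parity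
(`Normalizes.exists_op`). The quotient of the group of these operations by the odd subgroup has
sixteen elements, and `Op.cls` computes it: the sum of the translations modulo 4, the product of the
signs, and the parity of the permutation. It is a dihedral group of order 8 times a group of order
2.

Full cubic groups are therefore the same as subgroups of a group with sixteen elements, written as
bit masks (`HasMask`). Conversely every mask gives a full cubic group, because in a 2-group the
class of an element of order three is trivial (`HasMask.oddSubgroup`). Reflections are exactly
visible in the mask: they occur in the classes 4, 6 and 8 only, and each of these contains one. The
classification then is a finite check on masks and on the generators of the fourteen groups.

For the facets, every facet of the cell of `p` comes from a neighbour `q`: a site that shares with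
`p` a point `x` to which all other sites are strictly farther (`exists_neighbour_of_facet`). Pushing
`x` slightly towards `q = k p` makes `q` strictly closest and `p` strictly second. The whole
normalizer acts, so `p` can be assumed to lie in a fundamental simplex, and an operation `u` carries
`x` into this simplex as well. Then `v = u k` is closest and `u` second closest to `u x` among the
operations of the coset of `u`, applied to `p`, and `k` is the quotient of `u` and `v`. It remains
to list the pairs `(u, v)` that can occur.

The difference of the squared distances from `x` to `g p` and to `u p` is affine in `x` for fixed
`p` and affine in `p` for fixed `x`. An inequality between such distances for all `x` and `p` in two
simplices thus has to be checked for the vertices only, which leaves sixteen integer comparisons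
(`sq_dist_pair_le`). Domination by two other operations, or of a pair by another pair, discards
almost everything; the quotients that survive are the `candidates` (`mem_candidates`), and their
number bounds the number of facets for base points with trivial stabilizer. The simplex is halved to
sharpen the estimate, and cut into five pieces for `F4_132`.

A base point with a nontrivial stabilizer is a limit of generic base points `p'` of the same half,
and each of its neighbours has the form `s k p` with `s` in the stabilizer of `p` and `k p'` a
neighbour of `p'` (`NB.perturb`). The stabilizer in the full group of operations is constant on the
relative interior of each face of a half simplex, so for every face the images of the face under the
products `s k` are counted, and there are never more than 25. -/

namespace Cubic

/-! ### Signed permutations with integral translations -/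

/-- A row `x ↦ ± x_j + t` of a signed permutation with translation. -/
structure Row where
  j : Fin 3
  neg : Bool
  t : ℤ
deriving DecidableEq

/-- A signed permutation of the coordinates followed by an integral translation. -/
structure Op where
  r0 : Row
  r1 : Row
  r2 : Row
deriving DecidableEq

def Op.row (o : Op) (i : Fin 3) : Row :=
  bif Nat.beq i.1 0 then o.r0 else bif Nat.beq i.1 1 then o.r1 else o.r2

@[simp] theorem Op.row_zero (o : Op) : o.row 0 = o.r0 := rfl
@[simp] theorem Op.row_one (o : Op) : o.row 1 = o.r1 := rfl
@[simp] theorem Op.row_two (o : Op) : o.row 2 = o.r2 := rfl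

def Row.signed (r : Row) (x : ℤ) : ℤ := bif r.neg then -x else x

/-- The value of a row at the point `x`. -/
def Row.eval (r : Row) (x : E3) : ℝ := (bif r.neg then -x r.j else x r.j) + r.t

/-- The action of an operation on space. -/
def Op.act (o : Op) (x : E3) : E3 := WithLp.toLp 2 fun i => (o.row i).eval x

@[simp] theorem Op.act_apply (o : Op) (x : E3) (i : Fin 3) : o.act x i = (o.row i).eval x := rfl

def Op.one : Op := ⟨⟨0, false, 0⟩, ⟨1, false, 0⟩, ⟨2, false, 0⟩⟩

def Op.mul (o o' : Op) : Op :=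
  let f := fun r : Row =>
    let r' := o'.row r.j
    (⟨r'.j, xor r.neg r'.neg, r.signed r'.t + r.t⟩ : Row)
  ⟨f o.r0, f o.r1, f o.r2⟩

/-- Row `i` of the inverse comes from the row `a` of `o` that reads coordinate `i`. The last `else`
is correct only if the linear part is a permutation. -/
def Op.inv (o : Op) : Op :=
  let f := fun i : Fin 3 =>
    let a : Fin 3 := if o.r0.j = i then 0 else if o.r1.j = i then 1 else 2
    (⟨a, (o.row a).neg, -((o.row a).signed (o.row a).t)⟩ : Row)
  ⟨f 0, f 1, f 2⟩

/-- The linear part is a signed permutation. -/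
def Op.IsPerm (o : Op) : Prop := o.r0.j ≠ o.r1.j ∧ o.r0.j ≠ o.r2.j ∧ o.r1.j ≠ o.r2.j

/-- The operations that normalize `R1` (in doubled coordinates). -/
def Op.Valid (o : Op) : Prop :=
  o.IsPerm ∧ o.r0.t % 2 = o.r1.t % 2 ∧ o.r0.t % 2 = o.r2.t % 2

instance (o : Op) : Decidable o.IsPerm := by unfold Op.IsPerm; infer_instance
instance (o : Op) : Decidable o.Valid := by unfold Op.Valid; infer_instance

/-- The class modulo `R1`: the translation part modulo 4, the sign of the product of the entries,
and the parity of the permutation. -/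
def Op.cls (o : Op) : ℕ :=
  Nat.add ((o.r0.t + o.r1.t + o.r2.t) % 4).toNat
    (Nat.add (bif xor o.r0.neg (xor o.r1.neg o.r2.neg) then 4 else 0)
      (bif Nat.beq o.r1.j.1 (Nat.mod (Nat.succ o.r0.j.1) 3) then 0 else 8))

/-- The product of classes. -/
def mulC (i j : ℕ) : ℕ :=
  Nat.add (Nat.mod (bif Nat.testBit i 2 then Nat.sub (Nat.add i 4) (Nat.mod j 4) else Nat.add i j) 4)
    (Nat.mul 4 (Nat.xor (Nat.div i 4) (Nat.div j 4)))

/-- The inverse of a class. -/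
def invC (i : ℕ) : ℕ :=
  bif Nat.testBit i 2 then i
  else Nat.add (Nat.mul 4 (Nat.div i 4)) (Nat.mod (Nat.sub 4 (Nat.mod i 4)) 4)

theorem Row.eval_mul (r r' : Row) (x : E3) :
    (bif r.neg then -(r'.eval x) else r'.eval x) + r.t =
      (⟨r'.j, xor r.neg r'.neg, r.signed r'.t + r.t⟩ : Row).eval x := by
  rcases r with ⟨j, n, t⟩
  rcases r' with ⟨j', n', t'⟩
  cases n <;> cases n' <;> simp [Row.eval, Row.signed] <;> ring

theorem Op.mul_act (o o' : Op) (x : E3) : (o.mul o').act x = o.act (o'.act x) := by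
  ext i
  have h := Row.eval_mul (o.row i) (o'.row (o.row i).j) x
  rw [Op.act_apply, Op.act_apply]
  refine Eq.trans ?_ h.symm
  fin_cases i <;> rfl

theorem Op.one_act (x : E3) : Op.one.act x = x := by
  ext i
  fin_cases i <;> simp [Op.one, Row.eval]

theorem Op.IsPerm.cases {o : Op} (h : o.IsPerm) :
    (o.r0.j, o.r1.j, o.r2.j) ∈
      [((0 : Fin 3), (1 : Fin 3), (2 : Fin 3)), (0, 2, 1), (1, 0, 2), (1, 2, 0), (2, 0, 1), (2, 1, 0)] := by
  obtain ⟨⟨a, p, s⟩, ⟨b, q, t⟩, ⟨c, r, u⟩⟩ := o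
  simp only [Op.IsPerm] at h ⊢
  revert h
  clear p s q t r u
  revert a b c
  decide

/-- Reduce a statement about an operation with a signed permutation as linear part to the six
permutations. -/
theorem Op.IsPerm.elim {o : Op} (h : o.IsPerm) {P : Op → Prop}
    (H : ∀ j ∈ [((0 : Fin 3), (1 : Fin 3), (2 : Fin 3)), (0, 2, 1), (1, 0, 2), (1, 2, 0), (2, 0, 1),
      (2, 1, 0)], ∀ (p q r : Bool) (s t u : ℤ), o = ⟨⟨j.1, p, s⟩, ⟨j.2.1, q, t⟩, ⟨j.2.2, r, u⟩⟩ →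
      P ⟨⟨j.1, p, s⟩, ⟨j.2.1, q, t⟩, ⟨j.2.2, r, u⟩⟩) : P o :=
  H _ h.cases o.r0.neg o.r1.neg o.r2.neg o.r0.t o.r1.t o.r2.t rfl

theorem Op.IsPerm.inv_act {o : Op} (h : o.IsPerm) (x : E3) : o.inv.act (o.act x) = x := by
  refine h.elim (P := fun o => o.inv.act (o.act x) = x) ?_
  intro j hj p q r s t u _
  ext i
  simp only [List.mem_cons, List.not_mem_nil, or_false] at hj
  rcases hj with rfl | rfl | rfl | rfl | rfl | rfl <;> fin_cases i <;> cases p <;> cases q <;>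
    cases r <;> simp [Op.inv, Row.eval, Row.signed]

theorem Op.IsPerm.act_inv {o : Op} (h : o.IsPerm) (x : E3) : o.act (o.inv.act x) = x := by
  refine h.elim (P := fun o => o.act (o.inv.act x) = x) ?_
  intro j hj p q r s t u _
  ext i
  simp only [List.mem_cons, List.not_mem_nil, or_false] at hj
  rcases hj with rfl | rfl | rfl | rfl | rfl | rfl <;> fin_cases i <;> cases p <;> cases q <;>
    cases r <;> simp [Op.inv, Row.eval, Row.signed]

theorem Op.Valid.inv {o : Op} (h : o.Valid) : o.inv.Valid := by
  refine h.1.elim (P := fun o => o.inv.Valid) ?_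
  rintro j hj p q r s t u rfl
  obtain ⟨-, h1, h2⟩ := h
  simp only [List.mem_cons, List.not_mem_nil, or_false] at hj
  rcases hj with rfl | rfl | rfl | rfl | rfl | rfl <;> cases p <;> cases q <;> cases r <;>
    simp [Op.inv, Row.signed, Op.Valid, Op.IsPerm] at * <;> omega

theorem Op.Valid.mul {o o' : Op} (h : o.Valid) (h' : o'.Valid) : (o.mul o').Valid := by
  obtain ⟨⟨k1, k2, k3⟩, h3, h4⟩ := h'
  refine h.1.elim (P := fun o => (o.mul o').Valid) ?_
  rintro j hj p q r s t u rfl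
  obtain ⟨-, h1, h2⟩ := h
  simp only [List.mem_cons, List.not_mem_nil, or_false] at hj
  rcases hj with rfl | rfl | rfl | rfl | rfl | rfl <;>
    refine ⟨?_, ?_⟩ <;> simp only [Op.mul, Op.IsPerm, Row.signed, Op.row_zero, Op.row_one,
      Op.row_two] at * <;> cases p <;> cases q <;> cases r <;>
    simp_all [eq_comm] <;> omega

theorem Op.one_valid : Op.one.Valid := by decide

theorem Op.dist_act {o : Op} (h : o.IsPerm) (x y : E3) : dist (o.act x) (o.act y) = dist x y := by
  rw [EuclideanSpace.dist_eq, EuclideanSpace.dist_eq]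
  congr 1
  refine h.elim (P := fun o => ∑ i, dist (o.act x i) (o.act y i) ^ 2 = ∑ i, dist (x i) (y i) ^ 2) ?_
  intro j hj p q r s t u _
  simp only [List.mem_cons, List.not_mem_nil, or_false] at hj
  have key : ∀ (k : Fin 3) (b : Bool) (t : ℤ),
      dist ((⟨k, b, t⟩ : Row).eval x) ((⟨k, b, t⟩ : Row).eval y) = dist (x k) (y k) := by
    intro k b t
    cases b <;> simp [Row.eval]
  rcases hj with rfl | rfl | rfl | rfl | rfl | rfl <;>
    simp only [Fin.sum_univ_three, Op.act_apply, Op.row_zero, Op.row_one, Op.row_two, key] <;> ring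

theorem Op.cls_lt (o : Op) : o.cls < 16 := by
  have : ((o.r0.t + o.r1.t + o.r2.t) % 4).toNat < 4 := by omega
  unfold Op.cls
  generalize ((o.r0.t + o.r1.t + o.r2.t) % 4).toNat = n at this
  generalize xor o.r0.neg (xor o.r1.neg o.r2.neg) = b
  generalize Nat.beq o.r1.j.1 (Nat.mod (Nat.succ o.r0.j.1) 3) = c
  revert n b c
  decide

end Cubic

namespace Cubic

/-! ### The class is a homomorphism onto a group with sixteen elements -/

def Op.tsum (o : Op) : ℤ := o.r0.t + o.r1.t + o.r2.t

def Op.sgn (o : Op) : Bool := xor o.r0.neg (xor o.r1.neg o.r2.neg)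

def Op.even (o : Op) : Bool := Nat.beq o.r1.j.1 (Nat.mod (Nat.succ o.r0.j.1) 3)

/-- The components of the inner translation have equal parity, so changing the signs of two of them
changes their sum by a multiple of 4. Hence only the product of the signs of `o` matters. This is
where validity, and not only a permutation as linear part, is needed. -/
theorem Op.tsum_mul {o o' : Op} (h : o.IsPerm) (h' : o'.Valid) :
    (o.mul o').tsum % 4 = (o.tsum + (bif o.sgn then -o'.tsum else o'.tsum)) % 4 := by
  obtain ⟨-, h3, h4⟩ := h'
  refine h.elim
    (P := fun o => (o.mul o').tsum % 4 = (o.tsum + (bif o.sgn then -o'.tsum else o'.tsum)) % 4) ?_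
  rintro j hj p q r s t u -
  simp only [List.mem_cons, List.not_mem_nil, or_false] at hj
  obtain ⟨⟨a, p', s'⟩, ⟨b, q', t'⟩, ⟨c, r', u'⟩⟩ := o'
  simp only at h3 h4
  rcases hj with rfl | rfl | rfl | rfl | rfl | rfl <;> cases p <;> cases q <;> cases r <;>
    simp only [Op.mul, Op.tsum, Op.sgn, Row.signed, Op.row_zero, Op.row_one, Op.row_two, cond_true,
      cond_false, Bool.xor_false, Bool.xor_true, Bool.not_true, Bool.not_false, Bool.false_xor] <;>
    omega

theorem Op.sgn_mul {o : Op} (h : o.IsPerm) (o' : Op) : (o.mul o').sgn = xor o.sgn o'.sgn := by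
  refine h.elim (P := fun o => (o.mul o').sgn = xor o.sgn o'.sgn) ?_
  rintro j hj p q r s t u -
  simp only [List.mem_cons, List.not_mem_nil, or_false] at hj
  obtain ⟨⟨a, p', s'⟩, ⟨b, q', t'⟩, ⟨c, r', u'⟩⟩ := o'
  rcases hj with rfl | rfl | rfl | rfl | rfl | rfl <;>
    simp only [Op.mul, Op.sgn, Op.row_zero, Op.row_one, Op.row_two] <;>
    revert p q r p' q' r' <;> decide

theorem Op.even_eq (o : Op) : o.even = decide (o.r1.j = o.r0.j + 1) := by
  unfold Op.even
  generalize o.r1.j = a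
  generalize o.r0.j = b
  revert a b
  decide

/-- The parity of permutations is multiplicative; the negation appears because `even` is true for
the trivial value. -/
theorem Op.even_mul {o o' : Op} (h : o.IsPerm) (h' : o'.IsPerm) :
    (o.mul o').even = !(xor o.even o'.even) := by
  refine h.elim (P := fun o => (o.mul o').even = !(xor o.even o'.even)) ?_
  rintro j hj p q r s t u -
  refine h'.elim (P := fun o' => (Op.mul _ o').even = !(xor _ o'.even)) ?_
  rintro j' hj' p' q' r' s' t' u' -
  simp only [List.mem_cons, List.not_mem_nil, or_false] at hj hj'
  rcases hj with rfl | rfl | rfl | rfl | rfl | rfl <;>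
    rcases hj' with rfl | rfl | rfl | rfl | rfl | rfl <;>
    simp [Op.even_eq, Op.mul]

theorem Op.cls_eq (o : Op) : o.cls = (o.tsum % 4).toNat + ((bif o.sgn then 4 else 0) +
    (bif o.even then 0 else 8)) := rfl

theorem mulC_aux : ∀ c < 4, ∀ c' < 4, ∀ b b' a a' : Bool,
    mulC (c + ((bif b then 4 else 0) + (bif a then 0 else 8)))
      (c' + ((bif b' then 4 else 0) + (bif a' then 0 else 8))) =
    (bif b then c + 4 - c' else c + c') % 4 + ((bif xor b b' then 4 else 0) +
      (bif !(xor a a') then 0 else 8)) := by decide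

/-- The three invariants multiply independently, except that a negative product of signs inverts the
translation part. Thus `cls` is a homomorphism, and all questions about groups between class zero
and all valid operations become questions about numbers below 16. -/
theorem Op.cls_mul {o o' : Op} (h : o.Valid) (h' : o'.Valid) :
    (o.mul o').cls = mulC o.cls o'.cls := by
  rw [Op.cls_eq, Op.cls_eq o, Op.cls_eq o', mulC_aux _ (by omega) _ (by omega),
    Op.sgn_mul h.1, Op.even_mul h.1 h'.1, Op.tsum_mul h.1 h']
  congr 1
  cases o.sgn <;> simp only [cond_true, cond_false] <;> omega

theorem Op.cls_one : Op.one.cls = 0 := by decide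

/-- The value at the origin determines the translations, and the values at the unit vectors
determine the permutation and the signs. Identities between operations can therefore be proved as
identities between maps. -/
theorem Op.ext_act {o o' : Op} (h : ∀ x, o.act x = o'.act x) : o = o' := by
  have key : ∀ r r' : Row, (∀ x : E3, r.eval x = r'.eval x) → r = r' := by
    rintro ⟨j, n, t⟩ ⟨j', n', t'⟩ h
    have h0 := h 0
    have ht : t = t' := by
      have : (t : ℝ) = t' := by
        cases n <;> cases n' <;> simpa [Row.eval] using h0
      exact_mod_cast this
    subst ht
    have h1 := h (EuclideanSpace.single j 1)
    have hj : j' = j := by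
      by_contra hne
      cases n <;> cases n' <;> simp [Row.eval, hne] at h1
    subst hj
    have hn : n = n' := by
      cases n <;> cases n' <;> simp [Row.eval] at h1 ⊢ <;> norm_num at h1
    rw [hn]
  have hr : ∀ i, o.row i = o'.row i := fun i => key _ _ fun x => by
    have := congrArg (fun y : E3 => y i) (h x)
    simpa using this
  rcases o with ⟨a, b, c⟩
  rcases o' with ⟨a', b', c'⟩
  have h0 := hr 0
  have h1 := hr 1
  have h2 := hr 2
  simp only [Op.row_zero, Op.row_one, Op.row_two] at h0 h1 h2
  rw [h0, h1, h2]

theorem Op.mul_assoc (a b c : Op) : (a.mul b).mul c = a.mul (b.mul c) :=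
  Op.ext_act fun x => by simp only [Op.mul_act]

theorem Op.one_mul (a : Op) : Op.one.mul a = a :=
  Op.ext_act fun x => by simp only [Op.mul_act, Op.one_act]

theorem Op.mul_one (a : Op) : a.mul Op.one = a :=
  Op.ext_act fun x => by simp only [Op.mul_act, Op.one_act]

theorem Op.IsPerm.inv_mul {a : Op} (h : a.IsPerm) : a.inv.mul a = Op.one :=
  Op.ext_act fun x => by simp only [Op.mul_act, Op.one_act, h.inv_act]

theorem Op.IsPerm.mul_inv {a : Op} (h : a.IsPerm) : a.mul a.inv = Op.one :=
  Op.ext_act fun x => by simp only [Op.mul_act, Op.one_act, h.act_inv]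

theorem mulC_eq_zero : ∀ i < 16, ∀ j < 16, mulC i j = 0 → j = invC i := by decide

theorem Op.cls_inv {o : Op} (h : o.Valid) : o.inv.cls = invC o.cls := by
  refine mulC_eq_zero _ o.cls_lt _ o.inv.cls_lt ?_
  rw [← Op.cls_mul h h.inv, h.1.mul_inv, Op.cls_one]

theorem mulC_assoc : ∀ i < 16, ∀ j < 16, ∀ k < 16, mulC (mulC i j) k = mulC i (mulC j k) := by
  decide +kernel

theorem mulC_zero : ∀ i < 16, mulC i 0 = i := by decide

theorem zero_mulC : ∀ i < 16, mulC 0 i = i := by decide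

theorem invC_mulC : ∀ i < 16, mulC (invC i) i = 0 := by decide

theorem invC_lt : ∀ i < 16, invC i < 16 := by decide

theorem Op.act_inj {o : Op} (h : o.IsPerm) {x y : E3} (hxy : o.act x = o.act y) : x = y := by
  rw [← h.inv_act x, hxy, h.inv_act]

theorem Op.dist_inv_act {o : Op} (h : o.IsPerm) (x y : E3) :
    dist (o.inv.act x) y = dist x (o.act y) := by
  rw [← Op.dist_act h, h.act_inv]

end Cubic

namespace Cubic

/-! ### Certificates: definitions -/

/-- A point with coordinates in `(1/12) ℕ`. -/
structure Pt where
  x : ℕ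
  y : ℕ
  z : ℕ
deriving DecidableEq

structure Simplex where
  a : Pt
  b : Pt
  c : Pt
  d : Pt

def Pt.get (p : Pt) (j : Fin 3) : ℕ :=
  bif Nat.beq j.1 0 then p.x else bif Nat.beq j.1 1 then p.y else p.z

/-- `k n`, where `n` is evaluated first by the kernel. -/
def forceNat {α : Type} (n : ℕ) (k : ℕ → α) : α :=
  match n with
  | 0 => k 0
  | m + 1 => k (Nat.succ m)

/-- A row is the digit `j + 3 neg + 6 (t + 4)` in base 48, where `neg` counts as 0 or 1; 2304 is the
square of 48. -/
def Row.ofCode (n : ℕ) : Row :=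
  ⟨Fin.ofNat 3 n, Nat.beq (Nat.mod (Nat.div n 3) 2) 1, Int.subNatNat (Nat.div n 6) 4⟩

def Op.ofCode (n : ℕ) : Op :=
  ⟨Row.ofCode (Nat.mod n 48), Row.ofCode (Nat.mod (Nat.div n 48) 48), Row.ofCode (Nat.div n 2304)⟩

def pack4 (w a b c d : ℕ) : ℕ :=
  Nat.add a (Nat.mul w (Nat.add b (Nat.mul w (Nat.add c (Nat.mul w d)))))

/-- These are 2 to the powers 20 and 80. Since `baseD` is the fourth power of `baseX`, the product
of four digits in base `baseD` with four digits in base `baseX` displays all sixteen products as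
digits in base `baseX`. -/
def baseX : ℕ := 1048576

def baseD : ℕ := 1208925819614629174706176

/-- The digit 2 to the power 19, sixteen times in base `baseX`: the top bit of every digit. -/
def half : ℕ := 1067994536479414543813004449165984444661395463955677722099033975139494967541740431242818822340608

def onesX : ℕ := pack4 baseX 1 1 1 1

def onesD : ℕ := pack4 baseD 1 1 1 1

def sqn (n : ℕ) : ℕ := Nat.mul n n

def off (n : ℕ) : ℕ := Nat.add n 48

def Simplex.coordsD (S : Simplex) (j : Fin 3) : ℕ :=
  pack4 baseD (S.a.get j) (S.b.get j) (S.c.get j) (S.d.get j)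

def Simplex.sqD (S : Simplex) (j : Fin 3) : ℕ :=
  pack4 baseD (sqn (S.a.get j)) (sqn (S.b.get j)) (sqn (S.c.get j)) (sqn (S.d.get j))

def Simplex.coordsX (S : Simplex) (j : Fin 3) : ℕ :=
  pack4 baseX (off (S.a.get j)) (off (S.b.get j)) (off (S.c.get j)) (off (S.d.get j))

def Simplex.sqX (S : Simplex) (j : Fin 3) : ℕ :=
  pack4 baseX (sqn (off (S.a.get j))) (sqn (off (S.b.get j))) (sqn (off (S.c.get j)))
    (sqn (off (S.d.get j)))

def Row.base (r : Row) : ℕ := (12 * r.t + 48).toNat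

/-- With `t` standing for twelve times the translation plus 48 and the vertex coordinate `x` shifted
by 48 too, the square of `(x + 48) - (± d + t)` is expanded. `rowPos` collects the terms with
positive sign and `rowNeg` those with negative sign, for all sixteen pairs of vertices at once, so
that one subtraction of natural numbers yields the squares. -/
def rowPos (X D : Simplex) (i j : Fin 3) (neg : Bool) (t : ℕ) : ℕ :=
  Nat.add (Nat.add (Nat.mul onesX (Nat.add (Nat.mul (Nat.mul t t) onesD) (D.sqD j)))
    (Nat.mul onesD (X.sqX i)))
    (bif neg then Nat.mul 2 (Nat.mul (D.coordsD j) (X.coordsX i))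
      else Nat.mul (Nat.mul 2 t) (Nat.mul (D.coordsD j) onesX))

def rowNeg (X D : Simplex) (i j : Fin 3) (neg : Bool) (t : ℕ) : ℕ :=
  Nat.add (Nat.mul (Nat.mul 2 t) (Nat.mul onesD (X.coordsX i)))
    (bif neg then Nat.mul (Nat.mul 2 t) (Nat.mul (D.coordsD j) onesX)
      else Nat.mul 2 (Nat.mul (D.coordsD j) (X.coordsX i)))

def rowVec (X D : Simplex) (i j : Fin 3) (neg : Bool) (t : ℕ) : ℕ :=
  Nat.sub (rowPos X D i j neg t) (rowNeg X D i j neg t)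

/-- The sixteen squared distances between the vertices of `X` and the images of the vertices of `D`,
packed into one number. -/
def Op.vec (X D : Simplex) (o : Op) : ℕ :=
  forceNat o.r0.base fun b0 => forceNat o.r1.base fun b1 => forceNat o.r2.base fun b2 =>
  Nat.add (rowVec X D 0 o.r0.j o.r0.neg b0)
    (Nat.add (rowVec X D 1 o.r1.j o.r1.neg b1) (rowVec X D 2 o.r2.j o.r2.neg b2))

/-- Comparison of packed vectors in all coordinates. -/
def ple (a b : ℕ) : Bool := Nat.beq (Nat.land (Nat.sub (Nat.add b half) a) half) half

structure Entry where
  code : ℕ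
  op : Op
  cls : ℕ
  vec : ℕ

def entries (X D : Simplex) : List ℕ → List Entry
  | [] => []
  | n :: l => forceNat ((Op.ofCode n).vec X D) fun v => forceNat (Op.ofCode n).cls fun c =>
      ⟨n, Op.ofCode n, c, v⟩ :: entries X D l

/-- A fundamental simplex of the group of all valid operations. -/
def full : Simplex := ⟨⟨0, 0, 0⟩, ⟨12, 0, 0⟩, ⟨12, 12, 0⟩, ⟨6, 6, 6⟩⟩

/-- The two halves of the fundamental simplex. -/
def half1 : Simplex := ⟨⟨0, 0, 0⟩, ⟨12, 0, 0⟩, ⟨6, 6, 6⟩, ⟨12, 6, 0⟩⟩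

def half2 : Simplex := ⟨⟨0, 0, 0⟩, ⟨12, 12, 0⟩, ⟨6, 6, 6⟩, ⟨12, 6, 0⟩⟩

/-- The operations that can be closest or second closest. -/
def closeOps : List ℕ :=
  [61128, 68040, 58872, 61081, 67993, 77699, 77746, 79955, 59016, 65784, 56569, 58778, 43139,
    77696, 43186, 79952, 65928, 61272, 56713, 65690, 61143, 43136, 80049, 82258, 68184, 45395,
    68055, 77602, 63481, 58781, 58887, 43042, 45392, 79235, 77743, 45489, 59031, 65799, 79905,
    47698, 75346, 43183, 79232, 65943, 61096, 61801, 61287, 81538, 76979, 68008, 68713, 82255,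
    77555, 68199, 77599, 44675, 45345, 56584, 59498, 42995, 76976, 42419, 77552, 43039, 44672,
    56728, 66410, 80034, 42992, 80046, 42416, 61848, 74626, 47695, 54610, 68760, 63496, 59501,
    91129, 58793, 81535, 45486, 79890, 91273, 65705, 61816, 68728, 61863, 68775, 28921, 58790]

def Row.beq (r r' : Row) : Bool :=
  Nat.beq r.j.1 r'.j.1 && (bif r.neg then r'.neg else !r'.neg) &&
    match r.t, r'.t with
    | Int.ofNat a, Int.ofNat b => Nat.beq a b
    | Int.negSucc a, Int.negSucc b => Nat.beq a b
    | _, _ => false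

def Op.beq (o o' : Op) : Bool := o.r0.beq o'.r0 && (o.r1.beq o'.r1 && o.r2.beq o'.r2)

/-- The entries whose class is in the set `cm`. -/
def selectEntries (cm : ℕ) : List Entry → List Entry
  | [] => []
  | e :: l => bif Nat.testBit cm e.cls then e :: selectEntries cm l else selectEntries cm l

def byClass (T : List Entry) : List (List Entry) :=
  (List.range 16).map fun c => selectEntries (Nat.shiftLeft 1 c) T

def getList (T : List (List Entry)) (n : ℕ) : List Entry :=
  match T with
  | [] => []
  | a :: l => bif Nat.beq n 0 then a else getList l (Nat.pred n)

/-- Two operations of `L` with different codes are at least as close as `v`. -/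
def hasTwo (v : ℕ) : List Entry → Bool
  | [] => false
  | g :: l => bif ple g.vec v then l.any fun h => bif ple h.vec v then !(Nat.beq g.code h.code)
      else false
    else hasTwo v l

/-- `o` is in the table or two operations of the same class are at least as close. -/
def isCovered (T : List (List Entry)) (o : Op) : Bool :=
  forceNat o.cls fun c => forceNat (o.vec full full) fun v =>
    hasTwo v (getList T c) || (getList T c).any fun e => Op.beq e.op o

def permList : List (Fin 3 × Fin 3 × Fin 3) :=
  [(0, 1, 2), (0, 2, 1), (1, 0, 2), (1, 2, 0), (2, 0, 1), (2, 1, 0)]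

/-- All operations whose signs and translations are from a list. -/
def allOps (l : List (Bool × ℤ)) (P : Op → Bool) : Bool :=
  permList.all fun s => l.all fun p => l.all fun q => l.all fun r =>
    P ⟨⟨s.1, p.1, p.2⟩, ⟨s.2.1, q.1, q.2⟩, ⟨s.2.2, r.1, r.2⟩⟩

def evenRows : List (Bool × ℤ) := [(false, -2), (false, 0), (false, 2), (true, 0), (true, 2)]

def oddRows : List (Bool × ℤ) := [(false, -1), (false, 1), (true, -1), (true, 1), (true, 3)]

structure Node where
  e : Entry
  d : List Entry

/-- The node of `e` if at most one operation of the list dominates it. -/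
def nodeOf (e : Entry) : List Entry → List Node
  | [] => [⟨e, []⟩]
  | g :: l => bif ple g.vec e.vec then
      (bif Nat.beq g.code e.code then nodeOf e l else
        bif l.any fun h => bif ple h.vec e.vec then
          !(Nat.beq h.code e.code || Nat.beq h.code g.code) else false
        then [] else [⟨e, [g]⟩])
      else nodeOf e l

def nodes (C : List Entry) : List Entry → List Node
  | [] => []
  | e :: l => nodeOf e C ++ nodes C l

def tops : List Node → List Entry
  | [] => []
  | n :: l => match n.d with
    | [] => n.e :: tops l
    | _ :: _ => tops l

/-- Two operations of the list together are at least as close as a given pair. -/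
def hasPair (s : ℕ) : List Entry → Bool
  | [] => false
  | g :: l => (l.any fun h => ple (Nat.add g.vec h.vec) s) || hasPair s l

/-- If two other operations have together no larger squared distances than `u` and `v`, then `u` and
`v` cannot both be strictly closer than all others. Any list `V` of operations of the coset would be
sound; undominated ones are the most effective. -/
def pairRule (V : List Entry) (u v : Entry) : Bool :=
  forceNat (Nat.add u.vec v.vec) fun s =>
    hasPair s (V.filter fun g => !(Nat.beq g.code u.code || Nat.beq g.code v.code))

def addPair (V : List Entry) (u v : Entry) (S : List Op) : List Op :=
  bif Nat.beq u.code v.code || (S.any (Op.beq (u.op.inv.mul v.op)) || pairRule V u v) then S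
  else u.op.inv.mul v.op :: S

/-- For a second closest `u` that is dominated by `g`, the closest operation can only be `g`. For an
undominated `u` it can be any undominated operation. -/
def addNode (V : List Entry) (n : Node) (S : List Op) : List Op :=
  match n.d with
  | [] => V.foldr (fun v S => addPair V n.e v S) S
  | g :: _ => addPair V n.e g S

/-- Add to `S` all quotients `u⁻¹ v` of operations of `C` that can be closest and second closest. -/
def addCoset (C : List Entry) (S : List Op) : List Op :=
  (nodes C C).foldr (addNode (tops (nodes C C))) S

/-- The bitmask of the coset `i m`. -/
def cosetMask (m i : ℕ) : ℕ :=
  (List.range 16).foldr (fun j s => bif Nat.testBit m j then Nat.lor (Nat.shiftLeft 1 (mulC i j)) s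
    else s) 0

def insertNat (k : ℕ) (S : List ℕ) : List ℕ := bif S.any (Nat.beq k) then S else k :: S

def cosets (m : ℕ) : List ℕ :=
  (List.range 16).foldr (fun i S => forceNat (cosetMask m i) fun c => insertNat c S) []

/-- The candidates for neighbours under the group with mask `m`. -/
def candidates (Ts : List (List Entry)) (m : ℕ) : List Op :=
  Ts.foldr (fun T S => (cosets m).foldr (fun c S => addCoset (selectEntries c T) S) S) []

/-- The point `x` can be carried into one of the two halves; each half has its own table. -/
def tables (D : Simplex) : List (List Entry) := [entries half1 D closeOps, entries half2 D closeOps]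

/-- The subgroups of the group of classes, as bitmasks, with upper bounds for the number of
candidates. -/
def maskBounds : List (ℕ × ℕ) :=
  [(1, 10), (5, 15), (17, 25), (33, 14), (65, 25), (129, 14), (257, 25), (1025, 14), (4097, 14),
    (8193, 25), (16385, 14), (32769, 25), (15, 21), (85, 25), (165, 23), (1285, 25), (2565, 23),
    (4369, 25), (5185, 25), (8481, 25), (9345, 25), (16705, 25), (17425, 25), (20485, 11),
    (33153, 25), (33825, 25), (40965, 25), (255, 25), (3855, 25), (21845, 25), (23205, 23),
    (42405, 25), (43605, 25), (61455, 22), (65535, 25)]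

/-! #### Base points with nontrivial stabilizers -/

/-- Twelve times the translation, moved by 120 to be positive. For small rows the resulting
coordinates lie between 0 and 1023 and can serve as digits in base 1024. -/
def Row.shift (r : Row) : ℕ := (12 * r.t + 120).toNat

def coordOf (neg : Bool) (b d : ℕ) : ℕ := bif neg then Nat.sub b d else Nat.add b d

def Row.coord (r : Row) (d : Pt) : ℕ := coordOf r.neg r.shift (d.get r.j)

def Row.isSmall (r : Row) : Bool := Nat.ble 12 r.shift && Nat.ble r.shift 1000

def Op.isSmall (o : Op) : Bool := o.r0.isSmall && (o.r1.isSmall && o.r2.isSmall)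

/-- The coordinates of the images of the points of `Φ`, packed into one number. -/
def Op.image (Φ : List Pt) (o : Op) : ℕ :=
  Φ.foldr (fun d s => Nat.add (o.r0.coord d) (Nat.mul 1024 (Nat.add (o.r1.coord d)
    (Nat.mul 1024 (Nat.add (o.r2.coord d) (Nat.mul 1024 s)))))) 0

/-- On the points of `Φ` the row is on one side of the coordinate function `i`. -/
def Row.moves (Φ : List Pt) (i : Fin 3) (r : Row) : Bool :=
  bif Φ.all fun d => Nat.beq (r.coord d) (Nat.add 120 (d.get i)) then false else
    (Φ.all fun d => Nat.ble (r.coord d) (Nat.add 120 (d.get i))) ||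
    (Φ.all fun d => Nat.ble (Nat.add 120 (d.get i)) (r.coord d))

def Op.moves (Φ : List Pt) (o : Op) : Bool :=
  o.r0.moves Φ 0 || (o.r1.moves Φ 1 || o.r2.moves Φ 2)

def listOps (l : List (Bool × ℤ)) : List Op :=
  permList.flatMap fun s => l.flatMap fun p => l.flatMap fun q => l.map fun r =>
    ⟨⟨s.1, p.1, p.2⟩, ⟨s.2.1, q.1, q.2⟩, ⟨s.2.2, r.1, r.2⟩⟩

/-- The operations that can fix a point of the fundamental simplex. -/
def fixOps : List Op :=
  listOps [(false, 0), (true, 0), (true, 2)] ++ listOps [(false, -1), (false, 1), (true, 1)]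

/-- The operations that fix all points of `Φ`. -/
def fixers (Φ : List Pt) : List Op :=
  fixOps.filter fun o => Nat.beq (o.image Φ) (Op.one.image Φ)

/-- Every operation that can fix a point of the simplex either fixes the whole face or moves every
point of its relative interior, so the stabilizer is constant there. -/
def fixersOk (Φ : List Pt) : Bool :=
  fixOps.all fun o => o.isSmall && (Nat.beq (o.image Φ) (Op.one.image Φ) || o.moves Φ)

def addImages (Φ : List Pt) (F : List Op) (k : Op) (A : List ℕ) : List ℕ :=
  F.foldr (fun s A => forceNat ((s.mul k).image Φ) fun c => insertNat c A) A

/-- The images of `Φ` under the products of its fixers with the operations of `S`. -/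
def images (Φ : List Pt) (F S : List Op) : List ℕ :=
  S.foldr (addImages Φ F) [Op.one.image Φ]

/-- Either the crude count of products is at most 25, or the distinct images are counted; 26 is
allowed because the list contains the face itself as the image under the identity. -/
def imagesOk (Φ : List Pt) (F S : List Op) : Bool :=
  Nat.ble (Nat.mul F.length S.length) 25 ||
    ((S.all fun k => F.all fun s => (s.mul k).isSmall) && Nat.ble (images Φ F S).length 26)

def inMask (m : ℕ) (F : List Op) : List Op := F.filter fun o => Nat.testBit m o.cls

/-- The nonempty sublists. -/
def facesOf : List Pt → List (List Pt)
  | [] => []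
  | a :: l => [a] :: (facesOf l ++ (facesOf l).map (List.cons a))

def faces1 : List (List Pt) := facesOf [⟨0, 0, 0⟩, ⟨12, 0, 0⟩, ⟨6, 6, 6⟩, ⟨12, 6, 0⟩]

/-- The faces of the second half without the vertex `(12, 12, 0)` belong to the first half too. -/
def faces2 : List (List Pt) :=
  [⟨12, 12, 0⟩] :: (facesOf [⟨0, 0, 0⟩, ⟨6, 6, 6⟩, ⟨12, 6, 0⟩]).map (List.cons ⟨12, 12, 0⟩)

def boundsOk (Φs : List (List Pt × List Op)) (Ts : List (List Entry)) (b : ℕ × ℕ) : Bool :=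
  Nat.ble (candidates Ts b.1).length b.2 &&
    Φs.all fun Φ => imagesOk Φ.1 (inMask b.1 Φ.2) (candidates Ts b.1)

def withFixers (Φs : List (List Pt)) : List (List Pt × List Op) := Φs.map fun Φ => (Φ, fixers Φ)

end Cubic

namespace Cubic

/-! ### Certificates: verification -/

/-- A subdivision of the fundamental simplex. -/
def splitPieces : List Simplex :=
  [⟨⟨0, 0, 0⟩, ⟨9, 3, 3⟩, ⟨6, 6, 6⟩, ⟨12, 6, 0⟩⟩, ⟨⟨0, 0, 0⟩, ⟨12, 0, 0⟩, ⟨9, 3, 3⟩, ⟨12, 6, 0⟩⟩,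
    ⟨⟨0, 0, 0⟩, ⟨8, 8, 0⟩, ⟨6, 6, 6⟩, ⟨12, 6, 0⟩⟩, ⟨⟨8, 8, 0⟩, ⟨9, 9, 3⟩, ⟨6, 6, 6⟩, ⟨12, 6, 0⟩⟩,
    ⟨⟨8, 8, 0⟩, ⟨12, 12, 0⟩, ⟨9, 9, 3⟩, ⟨12, 6, 0⟩⟩]

/-- The masks `8193` and `32769` are the two coordinate forms of `F4_132`. On the halves of the
simplex only the bound 25 is recorded for them; the smaller pieces give 17. -/
def splitOk (D : Simplex) : Bool :=
  Nat.ble (candidates (tables D) 8193).length 17 && Nat.ble (candidates (tables D) 32769).length 17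

set_option maxRecDepth 100000 in
theorem fixers_ok1 : faces1.all fixersOk = true := by decide +kernel

set_option maxRecDepth 100000 in
theorem fixers_ok2 : faces2.all fixersOk = true := by decide +kernel

set_option maxRecDepth 100000 in
theorem split_ok : splitPieces.all splitOk = true := by decide +kernel

-- These two lists of rows suffice because an operation that is closest or second closest in its
-- class has small translations, by `abs_sub_lt_two` and `row_bounds`. Validity separates even from
-- odd translations.
set_option maxRecDepth 100000 in
theorem covered_even :
    allOps evenRows (isCovered (byClass (entries full full closeOps))) = true := by decide +kernel

set_option maxRecDepth 100000 in
theorem covered_odd :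
    allOps oddRows (isCovered (byClass (entries full full closeOps))) = true := by decide +kernel

end Cubic

namespace Cubic

/-! ### The numbers of candidates and of images for all masks -/

set_option maxRecDepth 100000 in
theorem bounds_ok1 :
    maskBounds.all (boundsOk (withFixers faces1) (tables half1)) = true := by decide +kernel

set_option maxRecDepth 100000 in
theorem bounds_ok2 :
    maskBounds.all (boundsOk (withFixers faces2) (tables half2)) = true := by decide +kernel

end Cubic

namespace Cubic

/-! ### Soundness of the packed arithmetic -/

theorem forceNat_eq {α : Type} (n : ℕ) (k : ℕ → α) : forceNat n k = k n := by cases n <;> rfl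

/-- Adding 2 to the power 19 to each digit of `B` before subtracting prevents every borrow, so the
subtraction of packed numbers is the subtraction of digits. -/
theorem ofDigits_zipWith_sub (A B : List ℕ) (hl : A.length = B.length)
    (hA : ∀ a ∈ A, a < 524288) :
    Nat.ofDigits 1048576 B + Nat.ofDigits 1048576 (List.replicate A.length 524288) =
      Nat.ofDigits 1048576 A +
        Nat.ofDigits 1048576 (List.zipWith (fun a b => b + 524288 - a) A B) := by
  induction A generalizing B with
  | nil =>
    cases B with
    | nil => rfl
    | cons b B => simp at hl
  | cons a A ih =>
    cases B with
    | nil => simp at hl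
    | cons b B =>
      have h1 := ih B (by simpa using hl) fun x hx => hA x (List.mem_cons_of_mem _ hx)
      have h2 := hA a List.mem_cons_self
      simp only [List.length_cons, List.replicate_succ, List.zipWith_cons_cons, Nat.ofDigits_cons]
      omega

/-- Each digit `b + 524288 - a` is below 2 to the power 20, so the conjunction acts digit by digit;
if the digit keeps its bit of value 524288, it is at least 524288, which means `a ≤ b`. -/
theorem forall₂_le_of_land (A B : List ℕ) (hl : A.length = B.length)
    (hA : ∀ a ∈ A, a < 524288) (hB : ∀ b ∈ B, b < 524288)
    (h : Nat.ofDigits 1048576 (List.zipWith (fun a b => b + 524288 - a) A B) &&&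
        Nat.ofDigits 1048576 (List.replicate A.length 524288) =
      Nat.ofDigits 1048576 (List.replicate A.length 524288)) :
    List.Forall₂ (· ≤ ·) A B := by
  induction A generalizing B with
  | nil =>
    cases B with
    | nil => exact List.Forall₂.nil
    | cons b B => simp at hl
  | cons a A ih =>
    cases B with
    | nil => simp at hl
    | cons b B =>
      have ha := hA a List.mem_cons_self
      have hb := hB b List.mem_cons_self
      simp only [List.length_cons, List.replicate_succ, List.zipWith_cons_cons, Nat.ofDigits_cons]
        at h
      have key : ∀ x y X Y : ℕ, x < 1048576 → y < 1048576 →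
          (x + 1048576 * X) &&& (y + 1048576 * Y) = y + 1048576 * Y → x &&& y = y ∧ X &&& Y = Y := by
        intro x y X Y hx hy hxy
        have e1 : (x + 1048576 * X) % 2 ^ 20 = x := by omega
        have e2 : (y + 1048576 * Y) % 2 ^ 20 = y := by omega
        have e3 : (x + 1048576 * X) / 2 ^ 20 = X := by omega
        have e4 : (y + 1048576 * Y) / 2 ^ 20 = Y := by omega
        constructor
        · have := congrArg (· % 2 ^ 20) hxy
          simp only [Nat.and_mod_two_pow, e1, e2] at this
          exact this
        · have := congrArg (· / 2 ^ 20) hxy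
          simp only [Nat.and_div_two_pow, e3, e4] at this
          exact this
      obtain ⟨h1, h2⟩ := key _ _ _ _ (by omega) (by norm_num) h
      refine List.Forall₂.cons ?_ (ih B (by simpa using hl)
        (fun x hx => hA x (List.mem_cons_of_mem _ hx)) (fun x hx => hB x (List.mem_cons_of_mem _ hx)) h2)
      have h3 : (b + 524288 - a) &&& 524288 ≤ b + 524288 - a := Nat.and_le_left
      omega

theorem half_eq : half = Nat.ofDigits 1048576 (List.replicate 16 524288) := by
  decide +kernel

theorem ple_sound {A B : List ℕ} (hlA : A.length = 16) (hlB : B.length = 16)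
    (hA : ∀ a ∈ A, a < 524288) (hB : ∀ b ∈ B, b < 524288)
    (h : ple (Nat.ofDigits 1048576 A) (Nat.ofDigits 1048576 B) = true) :
    List.Forall₂ (· ≤ ·) A B := by
  have h1 := ofDigits_zipWith_sub A B (hlA.trans hlB.symm) hA
  rw [hlA, ← half_eq] at h1
  refine forall₂_le_of_land A B (hlA.trans hlB.symm) hA hB ?_
  rw [hlA, ← half_eq]
  have h2 : Nat.land (Nat.ofDigits 1048576 B + half - Nat.ofDigits 1048576 A) half = half :=
    Nat.eq_of_beq_eq_true h
  rw [h1, Nat.add_sub_cancel_left] at h2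
  exact h2

def Simplex.verts (S : Simplex) : List Pt := [S.a, S.b, S.c, S.d]

/-- The square of twelve times the coordinate difference. -/
def Row.sq (r : Row) (x : ℕ) (d : Pt) : ℕ :=
  ((x : ℤ) - (r.signed (d.get r.j) + 12 * r.t)).natAbs ^ 2

def Op.sq (o : Op) (x d : Pt) : ℕ := o.r0.sq x.x d + o.r1.sq x.y d + o.r2.sq x.z d

def Op.digits (X D : Simplex) (o : Op) : List ℕ :=
  D.verts.flatMap fun d => X.verts.map fun x => o.sq x d

/-- The expansion of all sixteen squares with formal bases `w` and `W = w ^ 4`, for a row without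
change of sign; the shifts by 48 cancel. -/
theorem pack_identity_pos (w W b x0 x1 x2 x3 d0 d1 d2 d3 : ℤ) (hW : W = w ^ 4) :
    (1 + w * (1 + w * (1 + w * 1))) * (b * b * (1 + W * (1 + W * (1 + W * 1))) +
      (d0 * d0 + W * (d1 * d1 + W * (d2 * d2 + W * (d3 * d3))))) +
    (1 + W * (1 + W * (1 + W * 1))) *
      ((x0 + 48) * (x0 + 48) + w * ((x1 + 48) * (x1 + 48) + w * ((x2 + 48) * (x2 + 48) +
      w * ((x3 + 48) * (x3 + 48))))) +
    2 * b * ((d0 + W * (d1 + W * (d2 + W * d3))) * (1 + w * (1 + w * (1 + w * 1)))) =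
    ((x0 - (d0 + (b - 48))) ^ 2 + w *
      ((x1 - (d0 + (b - 48))) ^ 2 + w *
      ((x2 - (d0 + (b - 48))) ^ 2 + w *
      ((x3 - (d0 + (b - 48))) ^ 2 + w *
      ((x0 - (d1 + (b - 48))) ^ 2 + w *
      ((x1 - (d1 + (b - 48))) ^ 2 + w *
      ((x2 - (d1 + (b - 48))) ^ 2 + w *
      ((x3 - (d1 + (b - 48))) ^ 2 + w *
      ((x0 - (d2 + (b - 48))) ^ 2 + w *
      ((x1 - (d2 + (b - 48))) ^ 2 + w *
      ((x2 - (d2 + (b - 48))) ^ 2 + w *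
      ((x3 - (d2 + (b - 48))) ^ 2 + w *
      ((x0 - (d3 + (b - 48))) ^ 2 + w *
      ((x1 - (d3 + (b - 48))) ^ 2 + w *
      ((x2 - (d3 + (b - 48))) ^ 2 + w *
      ((x3 - (d3 + (b - 48))) ^ 2 + w *
      0)))))))))))))))) +
    (2 * b * ((1 + W * (1 + W * (1 + W * 1))) *
      ((x0 + 48) + w * ((x1 + 48) + w * ((x2 + 48) + w * (x3 + 48))))) +
    2 * ((d0 + W * (d1 + W * (d2 + W * d3))) * ((x0 + 48) + w * ((x1 + 48) + w * ((x2 + 48) + w * (x3 + 48)))))) := by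
  subst hW
  ring

theorem pack_identity_neg (w W b x0 x1 x2 x3 d0 d1 d2 d3 : ℤ) (hW : W = w ^ 4) :
    (1 + w * (1 + w * (1 + w * 1))) * (b * b * (1 + W * (1 + W * (1 + W * 1))) +
      (d0 * d0 + W * (d1 * d1 + W * (d2 * d2 + W * (d3 * d3))))) +
    (1 + W * (1 + W * (1 + W * 1))) *
      ((x0 + 48) * (x0 + 48) + w * ((x1 + 48) * (x1 + 48) + w * ((x2 + 48) * (x2 + 48) +
      w * ((x3 + 48) * (x3 + 48))))) +
    2 * ((d0 + W * (d1 + W * (d2 + W * d3))) * ((x0 + 48) + w * ((x1 + 48) + w * ((x2 + 48) + w * (x3 + 48))))) =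
    ((x0 - (-d0 + (b - 48))) ^ 2 + w *
      ((x1 - (-d0 + (b - 48))) ^ 2 + w *
      ((x2 - (-d0 + (b - 48))) ^ 2 + w *
      ((x3 - (-d0 + (b - 48))) ^ 2 + w *
      ((x0 - (-d1 + (b - 48))) ^ 2 + w *
      ((x1 - (-d1 + (b - 48))) ^ 2 + w *
      ((x2 - (-d1 + (b - 48))) ^ 2 + w *
      ((x3 - (-d1 + (b - 48))) ^ 2 + w *
      ((x0 - (-d2 + (b - 48))) ^ 2 + w *
      ((x1 - (-d2 + (b - 48))) ^ 2 + w *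
      ((x2 - (-d2 + (b - 48))) ^ 2 + w *
      ((x3 - (-d2 + (b - 48))) ^ 2 + w *
      ((x0 - (-d3 + (b - 48))) ^ 2 + w *
      ((x1 - (-d3 + (b - 48))) ^ 2 + w *
      ((x2 - (-d3 + (b - 48))) ^ 2 + w *
      ((x3 - (-d3 + (b - 48))) ^ 2 + w *
      0)))))))))))))))) +
    (2 * b * ((1 + W * (1 + W * (1 + W * 1))) *
      ((x0 + 48) + w * ((x1 + 48) + w * ((x2 + 48) + w * (x3 + 48))))) +
    2 * b * ((d0 + W * (d1 + W * (d2 + W * d3))) * (1 + w * (1 + w * (1 + w * 1))))) := by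
  subst hW
  ring

theorem row_pack (w W b : ℕ) (t : ℤ) (x0 x1 x2 x3 d0 d1 d2 d3 : ℕ) (neg : Bool)
    (hb : 12 * t = b - 48) (hW : (W : ℤ) = (w : ℤ) ^ 4) :
    pack4 w 1 1 1 1 * (b * b * pack4 W 1 1 1 1 +
          pack4 W (sqn d0) (sqn d1) (sqn d2) (sqn d3)) +
        pack4 W 1 1 1 1 * pack4 w (sqn (off x0)) (sqn (off x1)) (sqn (off x2)) (sqn (off x3)) +
        (bif neg then 2 * (pack4 W d0 d1 d2 d3 * pack4 w (off x0) (off x1) (off x2) (off x3))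
          else 2 * b * (pack4 W d0 d1 d2 d3 * pack4 w 1 1 1 1)) =
      Nat.ofDigits w ([d0, d1, d2, d3].flatMap fun d : ℕ => [x0, x1, x2, x3].map fun x : ℕ =>
        ((x : ℤ) - ((bif neg then -(d : ℤ) else d) + 12 * t)).natAbs ^ 2) +
      (2 * b * (pack4 W 1 1 1 1 * pack4 w (off x0) (off x1) (off x2) (off x3)) +
        (bif neg then 2 * b * (pack4 W d0 d1 d2 d3 * pack4 w 1 1 1 1)
          else 2 * (pack4 W d0 d1 d2 d3 * pack4 w (off x0) (off x1) (off x2) (off x3)))) := by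
  simp only [List.flatMap_cons, List.flatMap_nil, List.map_cons, List.map_nil,
    List.cons_append, List.nil_append, Nat.ofDigits_cons, Nat.ofDigits_nil]
  cases neg
  all_goals
    simp only [pack4, sqn, off, cond_true, cond_false, Nat.add_eq, Nat.mul_eq]
    apply Int.ofNat.inj
    simp only [Int.ofNat_eq_natCast]
    push_cast
    simp only [sq_abs, hb]
  · exact pack_identity_pos _ _ _ _ _ _ _ _ _ _ _ hW
  · exact pack_identity_neg _ _ _ _ _ _ _ _ _ _ _ hW

theorem rowVec_eq (X D : Simplex) (i j : Fin 3) (neg : Bool) (t : ℕ) :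
    rowVec X D i j neg t = onesX * (t * t * onesD + D.sqD j) + onesD * X.sqX i +
      (bif neg then 2 * (D.coordsD j * X.coordsX i) else 2 * t * (D.coordsD j * onesX)) -
      (2 * t * (onesD * X.coordsX i) +
        (bif neg then 2 * t * (D.coordsD j * onesX) else 2 * (D.coordsD j * X.coordsX i))) := rfl

/-- The bound on the translation keeps `12 t + 48` nonnegative, so that `Row.base` does not
truncate. -/
theorem row_vec_eq (X D : Simplex) (i : Fin 3) (r : Row) (h : -4 ≤ r.t) :
    rowVec X D i r.j r.neg r.base =
      Nat.ofDigits 1048576 (D.verts.flatMap fun d => X.verts.map fun x => r.sq (x.get i) d) := by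
  obtain ⟨j, neg, t⟩ := r
  obtain ⟨b, hb⟩ : ∃ b : ℕ, 12 * t + 48 = b := ⟨(12 * t + 48).toNat, by simp at h; omega⟩
  have hb' : (⟨j, neg, t⟩ : Row).base = b := by simp [Row.base, hb]
  have hb'' : 12 * t = b - 48 := by omega
  have hW : ((baseD : ℕ) : ℤ) = ((baseX : ℕ) : ℤ) ^ 4 := by
    have : baseD = baseX ^ 4 := by decide +kernel
    exact_mod_cast this
  rw [hb', rowVec_eq]
  exact Nat.sub_eq_of_eq_add (row_pack baseX baseD b t (X.a.get i) (X.b.get i) (X.c.get i)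
    (X.d.get i) (D.a.get j) (D.b.get j) (D.c.get j) (D.d.get j) neg hb'' hW)

theorem Op.vec_eq (X D : Simplex) (o : Op) (h0 : -4 ≤ o.r0.t) (h1 : -4 ≤ o.r1.t)
    (h2 : -4 ≤ o.r2.t) : o.vec X D = Nat.ofDigits 1048576 (o.digits X D) := by
  rw [Op.vec, forceNat_eq, forceNat_eq, forceNat_eq, row_vec_eq X D 0 _ h0, row_vec_eq X D 1 _ h1,
    row_vec_eq X D 2 _ h2, Nat.add_eq, Nat.add_eq,
    Nat.ofDigits_add_ofDigits_eq_ofDigits_zipWith_of_length_eq (by simp [Simplex.verts]),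
    Nat.ofDigits_add_ofDigits_eq_ofDigits_zipWith_of_length_eq (by simp [Simplex.verts])]
  simp only [Op.digits, Simplex.verts, List.flatMap_cons, List.flatMap_nil, List.map_cons,
    List.map_nil, List.cons_append, List.nil_append, List.zipWith_cons_cons, List.zipWith_nil_left,
    Op.sq, add_assoc]
  rfl

end Cubic

namespace Cubic

/-! ### Geometry of the simplices -/

noncomputable def Pt.toE (d : Pt) : E3 := WithLp.toLp 2 fun i => (d.get i : ℝ) / 12

@[simp] theorem Pt.toE_apply (d : Pt) (i : Fin 3) : d.toE i = (d.get i : ℝ) / 12 := rfl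

@[simp] theorem Pt.get_zero (d : Pt) : d.get 0 = d.x := rfl
@[simp] theorem Pt.get_one (d : Pt) : d.get 1 = d.y := rfl
@[simp] theorem Pt.get_two (d : Pt) : d.get 2 = d.z := rfl

def Simplex.hull (S : Simplex) : Set E3 := convexHull ℝ {y | ∃ d ∈ S.verts, y = d.toE}

theorem Simplex.vert_mem {S : Simplex} {d : Pt} (hd : d ∈ S.verts) : d.toE ∈ S.hull :=
  subset_convexHull ℝ _ ⟨d, hd, rfl⟩

theorem Simplex.hull_subset {S : Simplex} {K : Set E3} (hK : Convex ℝ K)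
    (h : ∀ d ∈ S.verts, d.toE ∈ K) : S.hull ⊆ K :=
  convexHull_min (by rintro _ ⟨d, hd, rfl⟩; exact h d hd) hK

theorem Simplex.mem_hull (S : Simplex) {p : E3} (w : Fin 4 → ℝ) (h0 : ∀ i, 0 ≤ w i)
    (h1 : ∑ i, w i = 1) (h : ∀ i, p i = w 0 * S.a.toE i + w 1 * S.b.toE i + w 2 * S.c.toE i +
      w 3 * S.d.toE i) : p ∈ S.hull := by
  have hc : Convex ℝ S.hull := convex_convexHull ℝ _
  have hv : ∀ i : Fin 4, (![S.a.toE, S.b.toE, S.c.toE, S.d.toE] : Fin 4 → E3) i ∈ S.hull := by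
    intro i
    fin_cases i <;> exact Simplex.vert_mem (by simp [Simplex.verts])
  have := hc.sum_mem (t := Finset.univ) (fun i _ => h0 i) h1 (fun i _ => hv i)
  convert this using 1
  ext i
  simp [Fin.sum_univ_four, h]

theorem Row.sq_eq (r : Row) (x : ℕ) (d : Pt) :
    (r.sq x d : ℝ) = 144 * ((x : ℝ) / 12 - r.eval d.toE) ^ 2 := by
  obtain ⟨j, n, t⟩ := r
  have h : ∀ z : ℤ, ((z.natAbs ^ 2 : ℕ) : ℝ) = (z : ℝ) ^ 2 := by
    intro z
    have : ((z.natAbs ^ 2 : ℕ) : ℤ) = z ^ 2 := by rw [Nat.cast_pow, Int.natAbs_sq]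
    calc ((z.natAbs ^ 2 : ℕ) : ℝ) = (((z.natAbs ^ 2 : ℕ) : ℤ) : ℝ) := by rw [Int.cast_natCast]
      _ = _ := by rw [this, Int.cast_pow]
  rw [Row.sq, h]
  cases n <;> simp [Row.eval, Row.signed] <;> ring

theorem Op.sq_eq (o : Op) (x d : Pt) :
    (o.sq x d : ℝ) = 144 * dist x.toE (o.act d.toE) ^ 2 := by
  rw [EuclideanSpace.dist_eq, Real.sq_sqrt (by positivity), Fin.sum_univ_three, Op.sq]
  push_cast
  rw [Row.sq_eq, Row.sq_eq, Row.sq_eq]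
  simp only [Real.dist_eq, sq_abs, Pt.toE_apply, Op.act_apply, Op.row_zero, Op.row_one, Op.row_two]
  simp only [Pt.get_zero, Pt.get_one, Pt.get_two]
  ring

/-- With two squared distances on either side the quadratic terms in `y` cancel, and a half-space or
a trivial condition remains. -/
theorem convex_sq_dist_pair (a b c d : E3) :
    Convex ℝ {y | dist y a ^ 2 + dist y b ^ 2 ≤ dist y c ^ 2 + dist y d ^ 2} := by
  have h : {y | dist y a ^ 2 + dist y b ^ 2 ≤ dist y c ^ 2 + dist y d ^ 2} =
      {y : E3 | inner ℝ (c + d - a - b) y ≤ (‖c‖ ^ 2 + ‖d‖ ^ 2 - ‖a‖ ^ 2 - ‖b‖ ^ 2) / 2} := by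
    ext y
    simp only [Set.mem_ofPred_eq, dist_eq_norm, norm_sub_sq_real, inner_sub_left, inner_add_left,
      real_inner_comm y]
    constructor <;> intro h <;> linarith
  rw [h]
  exact convex_halfSpace_le (innerSL ℝ (c + d - a - b)).toLinearMap.isLinear _

/-- Inequalities between sums of squared distances need to be checked for vertices only. -/
theorem sq_dist_pair_le {X D : Simplex} {g h u v : Op} (hg : g.IsPerm) (hh : h.IsPerm)
    (hu : u.IsPerm) (hv : v.IsPerm)
    (H : ∀ d ∈ D.verts, ∀ x ∈ X.verts, g.sq x d + h.sq x d ≤ u.sq x d + v.sq x d) {x p : E3}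
    (hx : x ∈ X.hull) (hp : p ∈ D.hull) :
    dist x (g.act p) ^ 2 + dist x (h.act p) ^ 2 ≤ dist x (u.act p) ^ 2 + dist x (v.act p) ^ 2 := by
  have h1 : ∀ d ∈ D.verts, ∀ x ∈ X.hull, dist x (g.act d.toE) ^ 2 + dist x (h.act d.toE) ^ 2 ≤
      dist x (u.act d.toE) ^ 2 + dist x (v.act d.toE) ^ 2 := by
    intro d hd y hy
    refine Set.mem_ofPred.1 (Simplex.hull_subset (convex_sq_dist_pair (g.act d.toE)
      (h.act d.toE) (u.act d.toE) (v.act d.toE)) (fun x hx => ?_) hy)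
    have := H d hd x hx
    have h2 : ((g.sq x d + h.sq x d : ℕ) : ℝ) ≤ ((u.sq x d + v.sq x d : ℕ) : ℝ) := by
      exact_mod_cast this
    push_cast at h2
    rw [Op.sq_eq, Op.sq_eq, Op.sq_eq, Op.sq_eq] at h2
    simp only [Set.mem_ofPred_eq]
    linarith
  -- The roles are exchanged: the operations are isometries, so for fixed `x` the inequality
  -- compares distances from `p` to the points `g⁻¹ x`, and the convexity argument applies to `p`.
  have key : ∀ p ∈ D.hull, dist p (g.inv.act x) ^ 2 + dist p (h.inv.act x) ^ 2 ≤
      dist p (u.inv.act x) ^ 2 + dist p (v.inv.act x) ^ 2 := by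
    intro q hq
    refine Set.mem_ofPred.1 (Simplex.hull_subset (convex_sq_dist_pair (g.inv.act x)
      (h.inv.act x) (u.inv.act x) (v.inv.act x)) (fun d hd => ?_) hq)
    have := h1 d hd x hx
    simp only [Set.mem_ofPred_eq]
    simp only [dist_comm d.toE]
    rwa [Op.dist_inv_act hg, Op.dist_inv_act hh, Op.dist_inv_act hu, Op.dist_inv_act hv]
  have := key p hp
  simp only [dist_comm p] at this
  rwa [Op.dist_inv_act hg, Op.dist_inv_act hh, Op.dist_inv_act hu, Op.dist_inv_act hv] at this

theorem dist_le_of_sq_le {X D : Simplex} {g u : Op} (hg : g.IsPerm) (hu : u.IsPerm)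
    (H : ∀ d ∈ D.verts, ∀ x ∈ X.verts, g.sq x d ≤ u.sq x d) {x p : E3}
    (hx : x ∈ X.hull) (hp : p ∈ D.hull) : dist x (g.act p) ≤ dist x (u.act p) := by
  have := sq_dist_pair_le hg hg hu hu (fun d hd x hx => add_le_add (H d hd x hx) (H d hd x hx)) hx hp
  have h2 : dist x (g.act p) ^ 2 ≤ dist x (u.act p) ^ 2 := by linarith
  exact le_of_sq_le_sq h2 dist_nonneg

/-! ### The fundamental simplex -/

theorem mem_full {p : E3} (h0 : 0 ≤ p 2) (h1 : p 2 ≤ p 1) (h2 : p 1 ≤ p 0) (h3 : p 0 + p 2 ≤ 1) :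
    p ∈ full.hull := by
  refine full.mem_hull ![1 - p 0 - p 2, p 0 - p 1, p 1 - p 2, 2 * p 2] ?_ ?_ ?_
  · intro i; fin_cases i <;> simp <;> linarith
  · simp [Fin.sum_univ_four]; ring
  · intro i; fin_cases i <;> simp [full] <;> ring

theorem mem_half1 {p : E3} (h0 : 0 ≤ p 2) (h1 : p 2 ≤ p 1) (h2 : p 1 - p 2 ≤ p 0 - p 1)
    (h3 : p 0 + p 2 ≤ 1) : p ∈ half1.hull := by
  refine half1.mem_hull ![1 - p 0 - p 2, p 0 - p 1 - (p 1 - p 2), 2 * p 2, 2 * (p 1 - p 2)] ?_ ?_ ?_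
  · intro i; fin_cases i <;> simp <;> linarith
  · simp [Fin.sum_univ_four]; ring
  · intro i; fin_cases i <;> simp [half1] <;> ring

theorem mem_half2 {p : E3} (h0 : 0 ≤ p 2) (h1 : p 1 ≤ p 0) (h2 : p 0 - p 1 ≤ p 1 - p 2)
    (h3 : p 0 + p 2 ≤ 1) : p ∈ half2.hull := by
  refine half2.mem_hull ![1 - p 0 - p 2, p 1 - p 2 - (p 0 - p 1), 2 * p 2, 2 * (p 0 - p 1)] ?_ ?_ ?_
  · intro i; fin_cases i <;> simp <;> linarith
  · simp [Fin.sum_univ_four]; ring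
  · intro i; fin_cases i <;> simp [half2] <;> ring

theorem full_bounds {p : E3} (hp : p ∈ full.hull) (i : Fin 3) : 0 ≤ p i ∧ p i ≤ 1 := by
  have hc : Convex ℝ {p : E3 | 0 ≤ p i ∧ p i ≤ 1} := by
    intro x hx y hy a b ha hb hab
    simp only [Set.mem_ofPred_eq, PiLp.add_apply, PiLp.smul_apply, smul_eq_mul] at hx hy ⊢
    constructor
    · nlinarith [mul_nonneg ha hx.1, mul_nonneg hb hy.1]
    · nlinarith [mul_le_mul_of_nonneg_left hx.2 ha, mul_le_mul_of_nonneg_left hy.2 hb]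
  refine Set.mem_ofPred.1 (Simplex.hull_subset hc (fun d hd => ?_) hp)
  rw [Set.mem_ofPred_eq]
  simp only [full, Simplex.verts, List.mem_cons, List.not_mem_nil, or_false] at hd
  rcases hd with rfl | rfl | rfl | rfl <;> fin_cases i <;> simp <;> norm_num

/-- Reflections in integer coordinate planes fold each coordinate into the unit interval, and a
permutation sorts the coordinates. At most one half of the resulting simplex has to be turned over.
-/
theorem exists_valid_mem (x : E3) : ∃ u : Op, u.Valid ∧ 0 ≤ u.act x 2 ∧ u.act x 2 ≤ u.act x 1 ∧
    u.act x 1 ≤ u.act x 0 ∧ u.act x 0 + u.act x 2 ≤ 1 := by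
  have h1 : ∀ r : ℝ, ∃ (n : Bool) (t : ℤ), 0 ≤ (bif n then -r else r) + ((2 * t : ℤ) : ℝ) ∧
      (bif n then -r else r) + ((2 * t : ℤ) : ℝ) ≤ 1 := by
    intro r
    have ha := Int.floor_le (r / 2)
    have hb := Int.lt_floor_add_one (r / 2)
    by_cases h : r - 2 * ⌊r / 2⌋ ≤ 1
    · exact ⟨false, -⌊r / 2⌋, by push_cast; simp only [cond_false]; linarith,
        by push_cast; simp only [cond_false]; linarith⟩
    · exact ⟨true, ⌊r / 2⌋ + 1, by push_cast; simp only [cond_true]; linarith,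
        by push_cast; simp only [cond_true]; linarith⟩
  choose n t hn using fun i => h1 (x i)
  have h2 : ∃ u : Op, u.Valid ∧ 0 ≤ u.act x 2 ∧ u.act x 2 ≤ u.act x 1 ∧
      u.act x 1 ≤ u.act x 0 ∧ u.act x 0 ≤ 1 := by
    have key : ∀ a b c : Fin 3, a ≠ b → a ≠ c → b ≠ c →
        (bif n c then -x c else x c) + ((2 * t c : ℤ) : ℝ) ≤
          (bif n b then -x b else x b) + ((2 * t b : ℤ) : ℝ) →
        (bif n b then -x b else x b) + ((2 * t b : ℤ) : ℝ) ≤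
          (bif n a then -x a else x a) + ((2 * t a : ℤ) : ℝ) → ∃ u : Op, u.Valid ∧ 0 ≤ u.act x 2 ∧
        u.act x 2 ≤ u.act x 1 ∧ u.act x 1 ≤ u.act x 0 ∧ u.act x 0 ≤ 1 := by
      intro a b c hab hac hbc h1 h2
      exact ⟨⟨⟨a, n a, 2 * t a⟩, ⟨b, n b, 2 * t b⟩, ⟨c, n c, 2 * t c⟩⟩, ⟨⟨hab, hac, hbc⟩,
        by simp, by simp⟩, (hn c).1, h1, h2, (hn a).2⟩
    rcases le_total ((bif n 0 then -x 0 else x 0) + ((2 * t 0 : ℤ) : ℝ))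
      ((bif n 1 then -x 1 else x 1) + ((2 * t 1 : ℤ) : ℝ)) with h01 | h01 <;>
    rcases le_total ((bif n 0 then -x 0 else x 0) + ((2 * t 0 : ℤ) : ℝ))
      ((bif n 2 then -x 2 else x 2) + ((2 * t 2 : ℤ) : ℝ)) with h02 | h02 <;>
    rcases le_total ((bif n 1 then -x 1 else x 1) + ((2 * t 1 : ℤ) : ℝ))
      ((bif n 2 then -x 2 else x 2) + ((2 * t 2 : ℤ) : ℝ)) with h12 | h12
    · exact key 2 1 0 (by decide) (by decide) (by decide) h01 h12
    · exact key 1 2 0 (by decide) (by decide) (by decide) h02 h12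
    · exact key 2 1 0 (by decide) (by decide) (by decide) h01 h12
    · exact key 1 0 2 (by decide) (by decide) (by decide) h02 h01
    · exact key 2 0 1 (by decide) (by decide) (by decide) h01 h02
    · exact key 0 1 2 (by decide) (by decide) (by decide) h12 h01
    · exact key 0 2 1 (by decide) (by decide) (by decide) h12 h02
    · exact key 0 1 2 (by decide) (by decide) (by decide) h12 h01
  obtain ⟨u, hu, h3, h4, h5, h6⟩ := h2
  by_cases h : u.act x 0 + u.act x 2 ≤ 1
  · exact ⟨u, hu, h3, h4, h5, h⟩
  -- The half-turn that sends `(x, y, z)` to `(1 - z, 1 - y, 1 - x)` preserves the order of the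
  -- coordinates and replaces `x + z` by `2 - (x + z)`.
  · let ρ : Op := ⟨⟨2, true, 1⟩, ⟨1, true, 1⟩, ⟨0, true, 1⟩⟩
    have hρ : ρ.Valid := by decide
    refine ⟨ρ.mul u, hρ.mul hu, ?_⟩
    have e0 : (ρ.mul u).act x 0 = 1 - u.act x 2 := by
      rw [Op.mul_act]; simp [ρ, Row.eval]; ring
    have e1 : (ρ.mul u).act x 1 = 1 - u.act x 1 := by
      rw [Op.mul_act]; simp [ρ, Row.eval]; ring
    have e2 : (ρ.mul u).act x 2 = 1 - u.act x 0 := by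
      rw [Op.mul_act]; simp [ρ, Row.eval]; ring
    rw [e0, e1, e2]
    refine ⟨?_, ?_, ?_, ?_⟩ <;> linarith

/-- Every point is equivalent to a point of one of the two halves of the fundamental simplex. -/
theorem exists_valid_mem_half (x : E3) : ∃ u : Op, u.Valid ∧ u.act x ∈ full.hull ∧
    (u.act x ∈ half1.hull ∨ u.act x ∈ half2.hull) := by
  obtain ⟨u, hu, h0, h1, h2, h3⟩ := exists_valid_mem x
  refine ⟨u, hu, mem_full h0 h1 h2 h3, ?_⟩
  rcases le_total (u.act x 1 - u.act x 2) (u.act x 0 - u.act x 1) with h | h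
  · exact Or.inl (mem_half1 h0 h1 h h3)
  · exact Or.inr (mem_half2 h0 h2 h h3)

end Cubic

namespace Cubic

/-! ### Soundness of the certificates -/

/-- All translations are at most four in absolute value. -/
def Op.Bdd (o : Op) : Prop :=
  (-4 ≤ o.r0.t ∧ o.r0.t ≤ 4) ∧ (-4 ≤ o.r1.t ∧ o.r1.t ≤ 4) ∧ (-4 ≤ o.r2.t ∧ o.r2.t ≤ 4)

instance (o : Op) : Decidable o.Bdd := by unfold Op.Bdd; infer_instance

def Pt.Bdd (d : Pt) : Prop := d.x ≤ 12 ∧ d.y ≤ 12 ∧ d.z ≤ 12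

instance (d : Pt) : Decidable d.Bdd := by unfold Pt.Bdd; infer_instance

def Simplex.Bdd (S : Simplex) : Prop := ∀ d ∈ S.verts, d.Bdd

theorem Pt.Bdd.get {d : Pt} (h : d.Bdd) (j : Fin 3) : d.get j ≤ 12 := by
  obtain ⟨h0, h1, h2⟩ := h
  fin_cases j <;> simpa

theorem Row.sq_le {r : Row} (h : -4 ≤ r.t ∧ r.t ≤ 4) {x : ℕ} (hx : x ≤ 12) {d : Pt} (hd : d.Bdd) :
    r.sq x d ≤ 5184 := by
  have h1 := hd.get r.j
  have h2 : ((x : ℤ) - (r.signed (d.get r.j) + 12 * r.t)).natAbs ≤ 72 := by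
    unfold Row.signed
    cases r.neg <;> simp only [cond_true, cond_false] <;> omega
  calc r.sq x d ≤ 72 ^ 2 := Nat.pow_le_pow_left h2 2
    _ = 5184 := by norm_num

theorem Op.Bdd.sq_le {o : Op} (h : o.Bdd) {x d : Pt} (hx : x.Bdd) (hd : d.Bdd) :
    o.sq x d ≤ 15552 := by
  have h0 := Row.sq_le h.1 hx.1 hd
  have h1 := Row.sq_le h.2.1 hx.2.1 hd
  have h2 := Row.sq_le h.2.2 hx.2.2 hd
  unfold Op.sq
  omega

theorem Op.digits_length (X D : Simplex) (o : Op) : (o.digits X D).length = 16 := by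
  simp [Op.digits, Simplex.verts]

theorem Op.Bdd.digits_le {o : Op} (h : o.Bdd) {X D : Simplex} (hX : X.Bdd) (hD : D.Bdd) :
    ∀ a ∈ o.digits X D, a ≤ 15552 := by
  intro a ha
  simp only [Op.digits, List.mem_flatMap, List.mem_map] at ha
  obtain ⟨d, hd, x, hx, rfl⟩ := ha
  exact h.sq_le (hX x hx) (hD d hd)

theorem forall_sq_le {X D : Simplex} {f g : Pt → Pt → ℕ}
    (h : List.Forall₂ (· ≤ ·) (D.verts.flatMap fun d => X.verts.map fun x => f x d)
      (D.verts.flatMap fun d => X.verts.map fun x => g x d)) :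
    ∀ d ∈ D.verts, ∀ x ∈ X.verts, f x d ≤ g x d := by
  simp only [Simplex.verts, List.flatMap_cons, List.flatMap_nil, List.map_cons, List.map_nil,
    List.cons_append, List.nil_append, List.forall₂_cons] at h
  intro d hd x hx
  simp only [Simplex.verts, List.mem_cons, List.not_mem_nil, or_false] at hd hx
  rcases hd with rfl | rfl | rfl | rfl <;> rcases hx with rfl | rfl | rfl | rfl <;> tauto

theorem sq_le_of_ple {X D : Simplex} (hX : X.Bdd) (hD : D.Bdd) {g u : Op} (hg : g.Bdd)
    (hu : u.Bdd) (h : ple (g.vec X D) (u.vec X D) = true) :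
    ∀ d ∈ D.verts, ∀ x ∈ X.verts, g.sq x d ≤ u.sq x d := by
  rw [Op.vec_eq X D g hg.1.1 hg.2.1.1 hg.2.2.1, Op.vec_eq X D u hu.1.1 hu.2.1.1 hu.2.2.1] at h
  exact forall_sq_le (f := fun x d => g.sq x d) (g := fun x d => u.sq x d)
    (ple_sound (Op.digits_length _ _ _) (Op.digits_length _ _ _)
      (fun a ha => (hg.digits_le hX hD a ha).trans_lt (by norm_num))
      (fun a ha => (hu.digits_le hX hD a ha).trans_lt (by norm_num)) h)

theorem vec_add_vec {X D : Simplex} {g h : Op} (hg : g.Bdd) (hh : h.Bdd) :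
    g.vec X D + h.vec X D = Nat.ofDigits 1048576
      (D.verts.flatMap fun d => X.verts.map fun x => g.sq x d + h.sq x d) := by
  rw [Op.vec_eq X D g hg.1.1 hg.2.1.1 hg.2.2.1, Op.vec_eq X D h hh.1.1 hh.2.1.1 hh.2.2.1,
    Nat.ofDigits_add_ofDigits_eq_ofDigits_zipWith_of_length_eq (by simp [Op.digits_length])]
  rfl

theorem sq_add_le_of_ple {X D : Simplex} (hX : X.Bdd) (hD : D.Bdd) {g h u v : Op} (hg : g.Bdd)
    (hh : h.Bdd) (hu : u.Bdd) (hv : v.Bdd)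
    (H : ple (g.vec X D + h.vec X D) (u.vec X D + v.vec X D) = true) :
    ∀ d ∈ D.verts, ∀ x ∈ X.verts, g.sq x d + h.sq x d ≤ u.sq x d + v.sq x d := by
  rw [vec_add_vec hg hh, vec_add_vec hu hv] at H
  have key : ∀ {g h : Op}, g.Bdd → h.Bdd → ∀ a ∈ (D.verts.flatMap fun d => X.verts.map fun x =>
      g.sq x d + h.sq x d), a < 524288 := by
    intro g h hg hh a ha
    simp only [List.mem_flatMap, List.mem_map] at ha
    obtain ⟨d, hd, x, hx, rfl⟩ := ha
    have h1 := hg.sq_le (hX x hx) (hD d hd)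
    have h2 := hh.sq_le (hX x hx) (hD d hd)
    omega
  exact forall_sq_le (f := fun x d => g.sq x d + h.sq x d) (g := fun x d => u.sq x d + v.sq x d)
    (ple_sound (by simp [Simplex.verts]) (by simp [Simplex.verts]) (key hg hh) (key hu hv) H)

/-! #### The table -/

def Row.encode (r : Row) : ℕ := r.j.1 + (bif r.neg then 3 else 0) + 6 * (r.t + 4).toNat

def Op.encode (o : Op) : ℕ := o.r0.encode + 48 * o.r1.encode + 2304 * o.r2.encode

/-- That `encode` recovers the code shows that different codes are different operations, so the
certificates may compare codes in place of operations. -/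
theorem closeOps_ok : ∀ n ∈ closeOps, (Op.ofCode n).Valid ∧ (Op.ofCode n).Bdd ∧
    (Op.ofCode n).encode = n := by
  decide +kernel

theorem ofCode_injOn {n n' : ℕ} (hn : n ∈ closeOps) (hn' : n' ∈ closeOps)
    (h : Op.ofCode n = Op.ofCode n') : n = n' := by
  rw [← (closeOps_ok n hn).2.2, h, (closeOps_ok n' hn').2.2]

structure Entry.Ok (X D : Simplex) (e : Entry) : Prop where
  mem : e.code ∈ closeOps
  op : e.op = Op.ofCode e.code
  cls : e.cls = e.op.cls
  vec : e.vec = e.op.vec X D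

theorem Entry.Ok.valid {X D : Simplex} {e : Entry} (h : e.Ok X D) : e.op.Valid := by
  rw [h.op]; exact (closeOps_ok _ h.mem).1

theorem Entry.Ok.bdd {X D : Simplex} {e : Entry} (h : e.Ok X D) : e.op.Bdd := by
  rw [h.op]; exact (closeOps_ok _ h.mem).2.1

theorem Entry.Ok.code_eq {X D : Simplex} {e e' : Entry} (h : e.Ok X D) (h' : e'.Ok X D) :
    e.code = e'.code ↔ e.op = e'.op := by
  constructor
  · intro hc; rw [h.op, h'.op, hc]
  · intro ho
    rw [h.op, h'.op] at ho
    exact ofCode_injOn h.mem h'.mem ho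

theorem Entry.Ok.beq_code {X D : Simplex} {e e' : Entry} (h : e.Ok X D) (h' : e'.Ok X D) :
    Nat.beq e.code e'.code = true ↔ e.op = e'.op := by
  rw [Nat.beq_eq, h.code_eq h']

theorem entries_ok (X D : Simplex) (l : List ℕ) (hl : l ⊆ closeOps) :
    ∀ e ∈ entries X D l, e.Ok X D := by
  induction l with
  | nil => intro e he; simp [entries] at he
  | cons n l ih =>
    intro e he
    rw [entries, forceNat_eq, forceNat_eq] at he
    rcases List.mem_cons.1 he with rfl | he
    · exact ⟨hl List.mem_cons_self, rfl, rfl, rfl⟩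
    · exact ih (fun x hx => hl (List.mem_cons_of_mem _ hx)) e he

theorem mem_entries (X D : Simplex) {l : List ℕ} {n : ℕ} (hn : n ∈ l) :
    ∃ e ∈ entries X D l, e.op = Op.ofCode n := by
  induction l with
  | nil => simp at hn
  | cons a l ih =>
    rw [entries, forceNat_eq, forceNat_eq]
    rcases List.mem_cons.1 hn with rfl | hn
    · exact ⟨_, List.mem_cons_self, rfl⟩
    · obtain ⟨e, he, h⟩ := ih hn
      exact ⟨e, List.mem_cons_of_mem _ he, h⟩

theorem Op.beq_iff (o o' : Op) : o.beq o' = true ↔ o = o' := by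
  have key : ∀ r r' : Row, r.beq r' = true ↔ r = r' := by
    rintro ⟨j, n, t⟩ ⟨j', n', t'⟩
    simp only [Row.beq, Bool.and_eq_true, Nat.beq_eq, Row.mk.injEq, Fin.ext_iff]
    rw [and_assoc]
    refine and_congr Iff.rfl (and_congr ?_ ?_)
    · cases n <;> cases n' <;> simp
    · cases t <;> cases t' <;> simp
  obtain ⟨a, b, c⟩ := o
  obtain ⟨a', b', c'⟩ := o'
  simp only [Op.beq, Bool.and_eq_true, key, Op.mk.injEq]

theorem mem_selectEntries {cm : ℕ} {T : List Entry} {e : Entry} :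
    e ∈ selectEntries cm T ↔ e ∈ T ∧ Nat.testBit cm e.cls = true := by
  induction T with
  | nil => simp [selectEntries]
  | cons a T ih =>
    rw [selectEntries]
    by_cases h : Nat.testBit cm a.cls = true
    · rw [h, cond_true, List.mem_cons, List.mem_cons, ih]
      constructor
      · rintro (rfl | h')
        · exact ⟨Or.inl rfl, h⟩
        · exact ⟨Or.inr h'.1, h'.2⟩
      · rintro ⟨rfl | h1, h2⟩
        · exact Or.inl rfl
        · exact Or.inr ⟨h1, h2⟩
    · have h' := h
      rw [Bool.not_eq_true] at h'
      rw [h', cond_false, ih, List.mem_cons]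
      constructor
      · rintro ⟨h1, h2⟩
        exact ⟨Or.inr h1, h2⟩
      · rintro ⟨rfl | h1, h2⟩
        · exact absurd h2 h
        · exact ⟨h1, h2⟩

theorem testBit_one_shiftLeft (k b : ℕ) : Nat.testBit (Nat.shiftLeft 1 k) b = true ↔ k = b := by
  change Nat.testBit (1 <<< k) b = true ↔ k = b
  rw [Nat.one_shiftLeft, Nat.testBit_two_pow, decide_eq_true_eq]

theorem getList_byClass {T : List Entry} {c : ℕ} (hc : c < 16) :
    getList (byClass T) c = selectEntries (Nat.shiftLeft 1 c) T := by
  have key : ∀ (l : List (List Entry)) (n : ℕ) (h : n < l.length), getList l n = l[n] := by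
    intro l
    induction l with
    | nil => intro n h; simp at h
    | cons a l ih =>
      intro n h
      cases n with
      | zero => rfl
      | succ n => exact ih n (by simpa using h)
  rw [key _ _ (by simpa [byClass] using hc)]
  simp [byClass]

theorem hasTwo_sound {v : ℕ} {L : List Entry} (h : hasTwo v L = true) :
    ∃ g ∈ L, ∃ h ∈ L, ple g.vec v = true ∧ ple h.vec v = true ∧ g.code ≠ h.code := by
  induction L with
  | nil => simp [hasTwo] at h
  | cons a L ih =>
    rw [hasTwo] at h
    by_cases ha : ple a.vec v = true
    · rw [ha, cond_true, List.any_eq_true] at h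
      obtain ⟨b, hb, h⟩ := h
      by_cases hbv : ple b.vec v = true
      · rw [hbv, cond_true, Bool.not_eq_true', ← Bool.not_eq_true, Nat.beq_eq] at h
        exact ⟨a, List.mem_cons_self, b, List.mem_cons_of_mem _ hb, ha, hbv, h⟩
      · rw [Bool.not_eq_true] at hbv
        simp [hbv] at h
    · rw [Bool.not_eq_true] at ha
      rw [ha, cond_false] at h
      obtain ⟨g, hg, h', hh, H⟩ := ih h
      exact ⟨g, List.mem_cons_of_mem _ hg, h', List.mem_cons_of_mem _ hh, H⟩

theorem full_bdd : full.Bdd := by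
  unfold Simplex.Bdd Simplex.verts full
  decide

theorem half1_bdd : half1.Bdd := by
  unfold Simplex.Bdd Simplex.verts half1
  decide

theorem half2_bdd : half2.Bdd := by
  unfold Simplex.Bdd Simplex.verts half2
  decide

/-- Outside the table there are two other operations of the same class that are at least as close
for all points of the simplex, which excludes `o` from being closest or second closest. -/
theorem isCovered_sound {o : Op} (ho : o.IsPerm) (hb : o.Bdd)
    (h : isCovered (byClass (entries full full closeOps)) o = true) :
    (∃ n ∈ closeOps, Op.ofCode n = o) ∨ ∃ g h : Op, g.Valid ∧ h.Valid ∧ g ≠ h ∧ g ≠ o ∧ h ≠ o ∧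
      g.cls = o.cls ∧ h.cls = o.cls ∧ ∀ x ∈ full.hull, ∀ p ∈ full.hull,
        dist x (g.act p) ≤ dist x (o.act p) ∧ dist x (h.act p) ≤ dist x (o.act p) := by
  rw [isCovered, forceNat_eq, forceNat_eq, getList_byClass o.cls_lt, Bool.or_eq_true] at h
  have hok := entries_ok full full closeOps (List.Subset.refl _)
  by_cases hmem : ∃ n ∈ closeOps, Op.ofCode n = o
  · exact Or.inl hmem
  · right
    have hne : ∀ e ∈ entries full full closeOps, e.op ≠ o := fun e he heq =>
      hmem ⟨e.code, (hok e he).mem, by rw [← (hok e he).op, heq]⟩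
    rcases h with h | h
    · obtain ⟨g, hg, h, hh, h1, h2, h3⟩ := hasTwo_sound h
      rw [mem_selectEntries, testBit_one_shiftLeft] at hg hh
      have kg := hok g hg.1
      have kh := hok h hh.1
      refine ⟨g.op, h.op, kg.valid, kh.valid, fun heq => h3 ((kg.code_eq kh).2 heq), hne g hg.1,
        hne h hh.1, by rw [← kg.cls, hg.2], by rw [← kh.cls, hh.2], fun x hx p hp => ⟨?_, ?_⟩⟩
      · rw [kg.vec] at h1
        exact dist_le_of_sq_le kg.valid.1 ho (sq_le_of_ple full_bdd full_bdd kg.bdd hb h1) hx hp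
      · rw [kh.vec] at h2
        exact dist_le_of_sq_le kh.valid.1 ho (sq_le_of_ple full_bdd full_bdd kh.bdd hb h2) hx hp
    · rw [List.any_eq_true] at h
      obtain ⟨e, he, h⟩ := h
      rw [mem_selectEntries] at he
      exact absurd ((Op.beq_iff _ _).1 h) (hne e he.1)

end Cubic

namespace Cubic

/-! ### The table contains all closest and second closest operations -/

theorem allOps_sound {l : List (Bool × ℤ)} {P : Op → Bool} (h : allOps l P = true) {o : Op}
    (ho : o.IsPerm) (h0 : (o.r0.neg, o.r0.t) ∈ l) (h1 : (o.r1.neg, o.r1.t) ∈ l)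
    (h2 : (o.r2.neg, o.r2.t) ∈ l) : P o = true := by
  simp only [allOps, List.all_eq_true] at h
  exact h _ ho.cases _ h0 _ h1 _ h2

def translation (a b c : ℤ) : Op := ⟨⟨0, false, a⟩, ⟨1, false, b⟩, ⟨2, false, c⟩⟩

theorem translation_cls {a b c : ℤ} (h : (a + b + c) % 4 = 0) : (translation a b c).cls = 0 := by
  rw [Op.cls_eq]
  simp [translation, Op.tsum, Op.sgn, Op.even_eq, h]

theorem translation_valid {a b c : ℤ} (ha : a % 2 = 0) (hb : b % 2 = 0) (hc : c % 2 = 0) :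
    (translation a b c).Valid :=
  ⟨⟨by simp [translation], by simp [translation], by simp [translation]⟩, by simp [translation, ha, hb],
    by simp [translation, ha, hc]⟩

theorem translation_act (a b c : ℤ) (x : E3) :
    (translation a b c).act x 0 = x 0 + a ∧ (translation a b c).act x 1 = x 1 + b ∧
      (translation a b c).act x 2 = x 2 + c := by
  simp [translation, Row.eval]

theorem dist_le_translation {a b c : ℤ} {x y : E3}
    (h : (x 0 - y 0 + a) ^ 2 + (x 1 - y 1 + b) ^ 2 + (x 2 - y 2 + c) ^ 2 ≤
      (x 0 - y 0) ^ 2 + (x 1 - y 1) ^ 2 + (x 2 - y 2) ^ 2) :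
    dist y ((translation a b c).act x) ≤ dist y x := by
  rw [EuclideanSpace.dist_eq, EuclideanSpace.dist_eq]
  apply Real.sqrt_le_sqrt
  obtain ⟨e0, e1, e2⟩ := translation_act a b c x
  rw [Fin.sum_univ_three, Fin.sum_univ_three, e0, e1, e2]
  simp only [Real.dist_eq, sq_abs]
  linarith

theorem exists_sign (z : ℝ) : ∃ s : ℤ, (s = 2 ∨ s = -2) ∧ (s : ℝ) * z = -2 * |z| := by
  rcases le_total 0 z with h | h
  · exact ⟨-2, Or.inr rfl, by rw [abs_of_nonneg h]; push_cast; ring⟩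
  · exact ⟨2, Or.inl rfl, by rw [abs_of_nonpos h]; push_cast; ring⟩

/-- An operation that is closest or second closest in its class moves points by little. -/
theorem abs_sub_lt_two {w v : Op} (hw : w.Valid) {y p : E3}
    (h : ∀ w' : Op, w'.Valid → w'.cls = w.cls → w' ≠ w → dist y (w'.act p) ≤ dist y (w.act p) →
      w' = v) (i : Fin 3) : |w.act p i - y i| < 2 := by
  -- Composing `w` with a nonzero translation of class zero stays in the class, so any such
  -- translation that does not increase the distance must lead to `v`.
  have h1 : ∀ a b c : ℤ, a % 2 = 0 → b % 2 = 0 → c % 2 = 0 → (a + b + c) % 4 = 0 →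
      (a ≠ 0 ∨ b ≠ 0 ∨ c ≠ 0) →
      (w.act p 0 - y 0 + a) ^ 2 + (w.act p 1 - y 1 + b) ^ 2 + (w.act p 2 - y 2 + c) ^ 2 ≤
        (w.act p 0 - y 0) ^ 2 + (w.act p 1 - y 1) ^ 2 + (w.act p 2 - y 2) ^ 2 →
      (translation a b c).mul w = v := by
    intro a b c ha hb hc habc hne hle
    have hv := translation_valid ha hb hc
    refine h _ (hv.mul hw) ?_ ?_ ?_
    · rw [Op.cls_mul hv hw, translation_cls habc, zero_mulC _ w.cls_lt]
    · intro heq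
      have h2 := congrArg (fun o : Op => o.act p) heq
      simp only [Op.mul_act] at h2
      obtain ⟨e0, e1, e2⟩ := translation_act a b c (w.act p)
      rw [h2] at e0 e1 e2
      rcases hne with hne | hne | hne
      · exact hne (by exact_mod_cast (show (a : ℝ) = 0 by linarith))
      · exact hne (by exact_mod_cast (show (b : ℝ) = 0 by linarith))
      · exact hne (by exact_mod_cast (show (c : ℝ) = 0 by linarith))
    · rw [Op.mul_act]
      exact dist_le_translation hle
  have h2 : ∀ a b c a' b' c' : ℤ, (translation a b c).mul w = v →
      (translation a' b' c').mul w = v → a = a' ∧ b = b' ∧ c = c' := by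
    intro a b c a' b' c' e e'
    have h2 := congrArg (fun o : Op => o.act p) (e.trans e'.symm)
    simp only [Op.mul_act] at h2
    obtain ⟨e0, e1, e2⟩ := translation_act a b c (w.act p)
    obtain ⟨f0, f1, f2⟩ := translation_act a' b' c' (w.act p)
    rw [h2] at e0 e1 e2
    refine ⟨?_, ?_, ?_⟩
    · exact_mod_cast (show (a : ℝ) = a' by linarith)
    · exact_mod_cast (show (b : ℝ) = b' by linarith)
    · exact_mod_cast (show (c : ℝ) = c' by linarith)
  by_contra hi
  rw [not_lt] at hi
  set z : Fin 3 → ℝ := fun i => w.act p i - y i with hz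
  obtain ⟨s0, hs0, k0⟩ := exists_sign (z 0)
  obtain ⟨s1, hs1, k1⟩ := exists_sign (z 1)
  obtain ⟨s2, hs2, k2⟩ := exists_sign (z 2)
  have q : ∀ s : ℤ, (s = 2 ∨ s = -2) → (s : ℝ) ^ 2 = 4 := by
    rintro s (rfl | rfl) <;> norm_num
  have a0 := abs_nonneg (z 0)
  have a1 := abs_nonneg (z 1)
  have a2 := abs_nonneg (z 2)
  have q0 := q s0 hs0
  have q1 := q s1 hs1
  have q2 := q s2 hs2
  -- Moving two coordinates by 2 towards `y` changes the squared distance by `8 - 4 (|z 0| + |z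
  -- 1|)`.
  have t01 : 4 ≤ 2 * |z 0| + 2 * |z 1| → (translation s0 s1 0).mul w = v := by
    intro hle
    refine h1 s0 s1 0 (by omega) (by omega) (by omega) (by omega) (by omega) ?_
    change (z 0 + _) ^ 2 + (z 1 + _) ^ 2 + (z 2 + _) ^ 2 ≤ z 0 ^ 2 + z 1 ^ 2 + z 2 ^ 2
    push_cast
    nlinarith
  have t02 : 4 ≤ 2 * |z 0| + 2 * |z 2| → (translation s0 0 s2).mul w = v := by
    intro hle
    refine h1 s0 0 s2 (by omega) (by omega) (by omega) (by omega) (by omega) ?_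
    change (z 0 + _) ^ 2 + (z 1 + _) ^ 2 + (z 2 + _) ^ 2 ≤ z 0 ^ 2 + z 1 ^ 2 + z 2 ^ 2
    push_cast
    nlinarith
  have t12 : 4 ≤ 2 * |z 1| + 2 * |z 2| → (translation 0 s1 s2).mul w = v := by
    intro hle
    refine h1 0 s1 s2 (by omega) (by omega) (by omega) (by omega) (by omega) ?_
    change (z 0 + _) ^ 2 + (z 1 + _) ^ 2 + (z 2 + _) ^ 2 ≤ z 0 ^ 2 + z 1 ^ 2 + z 2 ^ 2
    push_cast
    nlinarith
  have hi' : 2 ≤ |z i| := hi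
  have h3 : i = 0 ∨ i = 1 ∨ i = 2 := by fin_cases i <;> simp
  -- A coordinate difference of at least 2 makes two different translations admissible, but both
  -- would have to yield `v`.
  rcases h3 with rfl | rfl | rfl
  · have := h2 _ _ _ _ _ _ (t01 (by linarith)) (t02 (by linarith)); omega
  · have := h2 _ _ _ _ _ _ (t01 (by linarith)) (t12 (by linarith)); omega
  · have := h2 _ _ _ _ _ _ (t02 (by linarith)) (t12 (by linarith)); omega

theorem row_bounds {r : Row} {y : ℝ} {p : E3} (hp : ∀ j, 0 ≤ p j ∧ p j ≤ 1) (hy : 0 ≤ y ∧ y ≤ 1)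
    (h : |r.eval p - y| < 2) : (r.neg = false ∧ -2 ≤ r.t ∧ r.t ≤ 2) ∨
      (r.neg = true ∧ -1 ≤ r.t ∧ r.t ≤ 3) := by
  obtain ⟨j, n, t⟩ := r
  rw [abs_lt] at h
  have hj := hp j
  cases n <;> simp only [Row.eval, cond_true, cond_false] at h
  · left
    have h1 : (-3 : ℝ) < t := by linarith
    have h2 : (t : ℝ) < 3 := by linarith
    have h1' : (-3 : ℤ) < t := by exact_mod_cast h1
    have h2' : t < 3 := by exact_mod_cast h2
    exact ⟨rfl, by change -2 ≤ t; omega, by change t ≤ 2; omega⟩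
  · right
    have h1 : (-2 : ℝ) < t := by linarith
    have h2 : (t : ℝ) < 4 := by linarith
    have h1' : (-2 : ℤ) < t := by exact_mod_cast h1
    have h2' : t < 4 := by exact_mod_cast h2
    exact ⟨rfl, by change -1 ≤ t; omega, by change t ≤ 3; omega⟩

theorem mem_evenRows {r : Row} (h : (r.neg = false ∧ -2 ≤ r.t ∧ r.t ≤ 2) ∨
    (r.neg = true ∧ -1 ≤ r.t ∧ r.t ≤ 3)) (he : r.t % 2 = 0) : (r.neg, r.t) ∈ evenRows := by
  have : (r.neg = false ∧ (r.t = -2 ∨ r.t = 0 ∨ r.t = 2)) ∨ (r.neg = true ∧ (r.t = 0 ∨ r.t = 2)) := by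
    rcases h with ⟨h, h1, h2⟩ | ⟨h, h1, h2⟩
    · exact Or.inl ⟨h, by omega⟩
    · exact Or.inr ⟨h, by omega⟩
  rcases this with ⟨h, h1 | h1 | h1⟩ | ⟨h, h1 | h1⟩ <;> rw [h, h1] <;> decide

theorem mem_oddRows {r : Row} (h : (r.neg = false ∧ -2 ≤ r.t ∧ r.t ≤ 2) ∨
    (r.neg = true ∧ -1 ≤ r.t ∧ r.t ≤ 3)) (he : r.t % 2 = 1) : (r.neg, r.t) ∈ oddRows := by
  have : (r.neg = false ∧ (r.t = -1 ∨ r.t = 1)) ∨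
      (r.neg = true ∧ (r.t = -1 ∨ r.t = 1 ∨ r.t = 3)) := by
    rcases h with ⟨h, h1, h2⟩ | ⟨h, h1, h2⟩
    · exact Or.inl ⟨h, by omega⟩
    · exact Or.inr ⟨h, by omega⟩
  rcases this with ⟨h, h1 | h1⟩ | ⟨h, h1 | h1 | h1⟩ <;> rw [h, h1] <;> decide

/-- An operation that is closest or second closest in its class is in the table. -/
theorem exists_code {w v : Op} (hw : w.Valid) {y p : E3} (hy : y ∈ full.hull) (hp : p ∈ full.hull)
    (h : ∀ w' : Op, w'.Valid → w'.cls = w.cls → w' ≠ w → dist y (w'.act p) ≤ dist y (w.act p) →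
      w' = v) : ∃ n ∈ closeOps, Op.ofCode n = w := by
  have h0 := row_bounds (full_bounds hp) (full_bounds hy 0) (abs_sub_lt_two hw h 0)
  have h1 := row_bounds (full_bounds hp) (full_bounds hy 1) (abs_sub_lt_two hw h 1)
  have h2 := row_bounds (full_bounds hp) (full_bounds hy 2) (abs_sub_lt_two hw h 2)
  rw [Op.row_zero] at h0
  rw [Op.row_one] at h1
  rw [Op.row_two] at h2
  have hb : w.Bdd := ⟨by omega, by omega, by omega⟩
  obtain ⟨hperm, p1, p2⟩ := hw
  have hcov : isCovered (byClass (entries full full closeOps)) w = true := by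
    rcases Int.emod_two_eq_zero_or_one w.r0.t with he | he
    · exact allOps_sound covered_even hperm (mem_evenRows h0 he) (mem_evenRows h1 (by omega))
        (mem_evenRows h2 (by omega))
    · exact allOps_sound covered_odd hperm (mem_oddRows h0 he) (mem_oddRows h1 (by omega))
        (mem_oddRows h2 (by omega))
  rcases isCovered_sound hperm hb hcov with h | ⟨g, g', hg, hg', hne, hgo, hgo', hc, hc', H⟩
  · exact h
  · have e1 := h g hg hc hgo (H y hy p hp).1
    have e2 := h g' hg' hc' hgo' (H y hy p hp).2
    exact absurd (e1.trans e2.symm) hne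

/-! #### The list of candidates -/

theorem mem_foldr_of_mem {α β : Type} {f : α → List β → List β} (hf : ∀ a S, S ⊆ f a S) {k : β}
    {a : α} (hk : ∀ S, k ∈ f a S) {l : List α} (ha : a ∈ l) (S : List β) : k ∈ l.foldr f S := by
  induction l with
  | nil => simp at ha
  | cons b l ih =>
    rw [List.foldr_cons]
    rcases List.mem_cons.1 ha with rfl | ha
    · exact hk _
    · exact hf _ _ (ih ha)

theorem subset_foldr {α β : Type} {f : α → List β → List β} (hf : ∀ a S, S ⊆ f a S) (l : List α)
    (S : List β) : S ⊆ l.foldr f S := by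
  induction l with
  | nil => exact List.Subset.refl _
  | cons b l ih => exact List.Subset.trans ih (hf _ _)

theorem subset_addPair (V : List Entry) (u v : Entry) (S : List Op) : S ⊆ addPair V u v S := by
  unfold addPair
  cases Nat.beq u.code v.code || (S.any (Op.beq (u.op.inv.mul v.op)) || pairRule V u v)
  · exact List.subset_cons_self _ _
  · exact List.Subset.refl _

theorem subset_addNode (V : List Entry) (n : Node) (S : List Op) : S ⊆ addNode V n S := by
  unfold addNode
  split
  · exact subset_foldr (fun v S => subset_addPair V n.e v S) _ _
  · exact subset_addPair _ _ _ _

theorem subset_addCoset (C : List Entry) (S : List Op) : S ⊆ addCoset C S :=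
  subset_foldr (fun n S => subset_addNode _ n S) _ _

theorem mem_addPair {V : List Entry} {u v : Entry} (h1 : Nat.beq u.code v.code = false)
    (h2 : pairRule V u v = false) (S : List Op) : u.op.inv.mul v.op ∈ addPair V u v S := by
  unfold addPair
  rw [h1, h2, Bool.or_false, Bool.false_or]
  cases h : S.any (Op.beq (u.op.inv.mul v.op))
  · exact List.mem_cons_self
  · rw [List.any_eq_true] at h
    obtain ⟨k, hk, h⟩ := h
    rw [Op.beq_iff] at h
    rw [cond_true, h]
    exact hk

theorem hasPair_sound {s : ℕ} {L : List Entry} (h : hasPair s L = true) :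
    ∃ g ∈ L, ∃ h ∈ L, ple (g.vec + h.vec) s = true := by
  induction L with
  | nil => simp [hasPair] at h
  | cons a L ih =>
    rw [hasPair, Bool.or_eq_true] at h
    rcases h with h | h
    · rw [List.any_eq_true] at h
      obtain ⟨b, hb, h⟩ := h
      exact ⟨a, List.mem_cons_self, b, List.mem_cons_of_mem _ hb, h⟩
    · obtain ⟨g, hg, b, hb, h⟩ := ih h
      exact ⟨g, List.mem_cons_of_mem _ hg, b, List.mem_cons_of_mem _ hb, h⟩

/-- `nodeOf` drops `e` only on finding two distinct operations that dominate it. If `v` is the only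
possible one, `e` survives, either undominated or with `v` attached. -/
theorem nodeOf_cases {X D : Simplex} {e : Entry} (he : e.Ok X D) {v : Op} {C : List Entry}
    (hC : ∀ g ∈ C, g.Ok X D)
    (h : ∀ g ∈ C, ple g.vec e.vec = true → g.op ≠ e.op → g.op = v) :
    nodeOf e C = [⟨e, []⟩] ∨ ∃ g ∈ C, nodeOf e C = [⟨e, [g]⟩] ∧ g.op = v ∧ g.op ≠ e.op ∧
      ple g.vec e.vec = true := by
  induction C with
  | nil => exact Or.inl rfl
  | cons a C ih =>
    have ih' := ih (fun g hg => hC g (List.mem_cons_of_mem _ hg))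
      (fun g hg => h g (List.mem_cons_of_mem _ hg))
    have ih'' : nodeOf e C = [⟨e, []⟩] ∨ ∃ g ∈ a :: C, nodeOf e C = [⟨e, [g]⟩] ∧ g.op = v ∧
        g.op ≠ e.op ∧ ple g.vec e.vec = true := by
      rcases ih' with h | ⟨g, hg, h⟩
      · exact Or.inl h
      · exact Or.inr ⟨g, List.mem_cons_of_mem _ hg, h⟩
    have ka := hC a List.mem_cons_self
    rw [nodeOf]
    cases h1 : ple a.vec e.vec
    · exact ih''
    · rw [cond_true]
      cases h2 : Nat.beq a.code e.code
      · rw [cond_false]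
        have hne : a.op ≠ e.op := fun heq => by
          rw [(ka.beq_code he).2 heq] at h2; exact absurd h2 (by decide)
        have hav := h a List.mem_cons_self h1 hne
        cases h3 : C.any fun h => bif ple h.vec e.vec then
          !(Nat.beq h.code e.code || Nat.beq h.code a.code) else false
        · exact Or.inr ⟨a, List.mem_cons_self, rfl, hav, hne, h1⟩
        · exfalso
          rw [List.any_eq_true] at h3
          obtain ⟨b, hb, h3⟩ := h3
          cases h4 : ple b.vec e.vec
          · simp [h4] at h3
          · rw [h4, cond_true, Bool.not_eq_true', Bool.or_eq_false_iff] at h3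
            have kb := hC b (List.mem_cons_of_mem _ hb)
            have hbe : b.op ≠ e.op := fun heq => by
              rw [(kb.beq_code he).2 heq] at h3; exact absurd h3.1 (by decide)
            have hbv := h b (List.mem_cons_of_mem _ hb) h4 hbe
            have := (kb.beq_code ka).2 (hbv.trans hav.symm)
            rw [this] at h3
            exact absurd h3.2 (by decide)
      · rw [cond_true]
        exact ih''

theorem nodes_eq (C l : List Entry) : nodes C l = l.flatMap fun e => nodeOf e C := by
  induction l with
  | nil => rfl
  | cons a l ih => rw [nodes, ih, List.flatMap_cons]

theorem nodeOf_e {e : Entry} {C : List Entry} {n : Node} (hn : n ∈ nodeOf e C) : n.e = e := by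
  induction C with
  | nil => rw [nodeOf, List.mem_singleton] at hn; rw [hn]
  | cons a C ih =>
    rw [nodeOf] at hn
    cases h1 : ple a.vec e.vec
    · rw [h1, cond_false] at hn; exact ih hn
    · rw [h1, cond_true] at hn
      cases h2 : Nat.beq a.code e.code
      · rw [h2, cond_false] at hn
        cases h3 : C.any fun h => bif ple h.vec e.vec then
          !(Nat.beq h.code e.code || Nat.beq h.code a.code) else false
        · rw [h3, cond_false, List.mem_singleton] at hn; rw [hn]
        · rw [h3, cond_true] at hn; simp at hn
      · rw [h2, cond_true] at hn; exact ih hn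

theorem mem_tops {N : List Node} {e : Entry} : e ∈ tops N ↔ ∃ n ∈ N, n.e = e ∧ n.d = [] := by
  induction N with
  | nil => simp [tops]
  | cons n N ih =>
    rw [tops]
    split
    · next h =>
      rw [List.mem_cons, ih]
      constructor
      · rintro (rfl | ⟨n', h1, h2⟩)
        · exact ⟨n, List.mem_cons_self, rfl, h⟩
        · exact ⟨n', List.mem_cons_of_mem _ h1, h2⟩
      · rintro ⟨n', h1, h2, h3⟩
        rcases List.mem_cons.1 h1 with rfl | h1
        · exact Or.inl h2.symm
        · exact Or.inr ⟨n', h1, h2, h3⟩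
    · next h =>
      rw [ih]
      constructor
      · rintro ⟨n', h1, h2⟩
        exact ⟨n', List.mem_cons_of_mem _ h1, h2⟩
      · rintro ⟨n', h1, h2, h3⟩
        rcases List.mem_cons.1 h1 with rfl | h1
        · rw [h3] at h; exact absurd h (by simp)
        · exact ⟨n', h1, h2, h3⟩

theorem tops_subset {C : List Entry} : tops (nodes C C) ⊆ C := by
  intro e he
  obtain ⟨n, hn, h1, -⟩ := mem_tops.1 he
  rw [nodes_eq, List.mem_flatMap] at hn
  obtain ⟨e', he', hn⟩ := hn
  rw [← h1, nodeOf_e hn]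
  exact he'

/-- If `v` is closest and `u` is second closest then `u⁻¹ v` is added to the list. -/
theorem mem_addCoset {X D : Simplex} (hX : X.Bdd) (hD : D.Bdd) {C : List Entry}
    (hC : ∀ g ∈ C, g.Ok X D) {u v : Entry} (hu : u ∈ C) (hv : v ∈ C) {y p : E3} (hy : y ∈ X.hull)
    (hp : p ∈ D.hull) (hvu : dist y (v.op.act p) < dist y (u.op.act p))
    (H : ∀ g ∈ C, g.op ≠ u.op → g.op ≠ v.op → dist y (u.op.act p) < dist y (g.op.act p))
    (S : List Op) : u.op.inv.mul v.op ∈ addCoset C S := by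
  have ku := hC u hu
  have kv := hC v hv
  have hle : ∀ {g h : Entry}, g ∈ C → h ∈ C → ple g.vec h.vec = true →
      dist y (g.op.act p) ≤ dist y (h.op.act p) := by
    intro g h hg hh hgh
    have kg := hC g hg
    have kh := hC h hh
    rw [kg.vec, kh.vec] at hgh
    exact dist_le_of_sq_le kg.valid.1 kh.valid.1 (sq_le_of_ple hX hD kg.bdd kh.bdd hgh) hy hp
  have hne : u.op ≠ v.op := fun heq => by rw [heq] at hvu; exact lt_irrefl _ hvu
  -- An operation dominating `v` would be at least as close as the strictly closest one.
  have hvtop : v ∈ tops (nodes C C) := by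
    rw [mem_tops]
    have h1 : nodeOf v C = [⟨v, []⟩] := by
      have hcl : ∀ g ∈ C, ple g.vec v.vec = true → g.op ≠ v.op → False := by
        intro g hg hgv hgne
        have h1 := hle hg hv hgv
        by_cases h2 : g.op = u.op
        · rw [h2] at h1; exact absurd hvu (not_lt.2 h1)
        · have := H g hg h2 hgne; linarith
      rcases nodeOf_cases kv (v := u.op) hC
        (fun g hg h1 h2 => (hcl g hg h1 h2).elim) with h | ⟨g, hg, -, -, h2, h3⟩
      · exact h
      · exact (hcl g hg h3 h2).elim
    refine ⟨⟨v, []⟩, ?_, rfl, rfl⟩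
    rw [nodes_eq, List.mem_flatMap]
    exact ⟨v, hv, by rw [h1]; exact List.mem_cons_self⟩
  -- Two operations other than `u` and `v` are both strictly farther than `u`, hence farther than
  -- `v`, so the sum of their squared distances exceeds that of `u` and `v` and the pair rule does
  -- not fire.
  have hpr : ∀ w : Entry, w ∈ C → w.op = v.op → pairRule (tops (nodes C C)) u w = false := by
    intro w hw hwv
    have kw := hC w hw
    rw [← Bool.not_eq_true]
    intro h
    rw [pairRule, forceNat_eq] at h
    obtain ⟨g, hg, h', hh, h⟩ := hasPair_sound h
    rw [List.mem_filter, Bool.not_eq_true', Bool.or_eq_false_iff] at hg hh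
    have key : ∀ g : Entry, g ∈ tops (nodes C C) → Nat.beq g.code u.code = false →
        Nat.beq g.code w.code = false → dist y (u.op.act p) < dist y (g.op.act p) := by
      intro g hg h1 h2
      have hg' := tops_subset hg
      have kg := hC g hg'
      refine H g hg' (fun heq => ?_) (fun heq => ?_)
      · rw [(kg.beq_code ku).2 heq] at h1; exact absurd h1 (by decide)
      · rw [(kg.beq_code kw).2 (heq.trans hwv.symm)] at h2; exact absurd h2 (by decide)
    have k1 := key g hg.1 hg.2.1 hg.2.2
    have k2 := key h' hh.1 hh.2.1 hh.2.2
    have kg := hC g (tops_subset hg.1)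
    have kh := hC h' (tops_subset hh.1)
    rw [Nat.add_eq, kg.vec, kh.vec, ku.vec, kw.vec] at h
    have h3 := sq_dist_pair_le kg.valid.1 kh.valid.1 ku.valid.1 kw.valid.1
      (sq_add_le_of_ple hX hD kg.bdd kh.bdd ku.bdd kw.bdd h) hy hp
    rw [hwv] at h3
    have h4 := dist_nonneg (x := y) (y := v.op.act p)
    nlinarith
  have hbeq : ∀ w : Entry, w ∈ C → w.op = v.op → Nat.beq u.code w.code = false := by
    intro w hw hwv
    rw [← Bool.not_eq_true, ku.beq_code (hC w hw), hwv]
    exact hne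
  rcases nodeOf_cases ku (v := v.op) hC (fun g hg h1 h2 => by
      by_contra h3
      have := H g hg h2 h3
      have := hle hg hu h1
      linarith) with h | ⟨g, hg, h, hgv, -, -⟩
  · refine mem_foldr_of_mem (fun n S => subset_addNode _ n S) (a := ⟨u, []⟩) (fun S => ?_) ?_ S
    · exact mem_foldr_of_mem (fun v S => subset_addPair _ u v S)
        (fun S => mem_addPair (hbeq v hv rfl) (hpr v hv rfl) S) hvtop S
    · rw [nodes_eq, List.mem_flatMap]
      exact ⟨u, hu, by rw [h]; exact List.mem_cons_self⟩
  · refine mem_foldr_of_mem (fun n S => subset_addNode _ n S) (a := ⟨u, [g]⟩) (fun S => ?_) ?_ S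
    · rw [← hgv]
      exact mem_addPair (hbeq g hg hgv) (hpr g hg hgv) S
    · rw [nodes_eq, List.mem_flatMap]
      exact ⟨u, hu, by rw [h]; exact List.mem_cons_self⟩

theorem testBit_cosetMask {m i b : ℕ} :
    Nat.testBit (cosetMask m i) b = true ↔ ∃ j < 16, Nat.testBit m j = true ∧ mulC i j = b := by
  have key : ∀ l : List ℕ, Nat.testBit (l.foldr (fun j s => bif Nat.testBit m j then
      Nat.lor (Nat.shiftLeft 1 (mulC i j)) s else s) 0) b = true ↔
      ∃ j ∈ l, Nat.testBit m j = true ∧ mulC i j = b := by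
    intro l
    induction l with
    | nil => simp
    | cons a l ih =>
      rw [List.foldr_cons]
      cases h : Nat.testBit m a
      · rw [cond_false, ih]
        constructor
        · rintro ⟨j, h1, h2⟩; exact ⟨j, List.mem_cons_of_mem _ h1, h2⟩
        · rintro ⟨j, h1, h2, h3⟩
          rcases List.mem_cons.1 h1 with rfl | h1
          · rw [h2] at h; exact absurd h (by decide)
          · exact ⟨j, h1, h2, h3⟩
      · rw [cond_true]
        have e : ∀ x y : ℕ, Nat.testBit (Nat.lor x y) b = (Nat.testBit x b || Nat.testBit y b) :=
          fun x y => Nat.testBit_or x y b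
        rw [e, Bool.or_eq_true, ih, testBit_one_shiftLeft]
        constructor
        · rintro (h1 | ⟨j, h1, h2⟩)
          · exact ⟨a, List.mem_cons_self, h, h1⟩
          · exact ⟨j, List.mem_cons_of_mem _ h1, h2⟩
        · rintro ⟨j, h1, h2, h3⟩
          rcases List.mem_cons.1 h1 with rfl | h1
          · exact Or.inl h3
          · exact Or.inr ⟨j, h1, h2, h3⟩
  rw [cosetMask, key]
  simp only [List.mem_range]

theorem mem_cosets {m i : ℕ} (hi : i < 16) : cosetMask m i ∈ cosets m := by
  unfold cosets
  have h1 : ∀ (k : ℕ) (S : List ℕ), S ⊆ insertNat k S ∧ k ∈ insertNat k S := by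
    intro k S
    unfold insertNat
    cases h : S.any (Nat.beq k)
    · exact ⟨List.subset_cons_self _ _, List.mem_cons_self⟩
    · refine ⟨List.Subset.refl _, ?_⟩
      rw [List.any_eq_true] at h
      obtain ⟨x, hx, h⟩ := h
      rw [Nat.beq_eq] at h
      rw [h]
      exact hx
  refine mem_foldr_of_mem (a := i) (fun a S => ?_) (fun S => ?_) (List.mem_range.2 hi) []
  · rw [forceNat_eq]; exact (h1 _ _).1
  · rw [forceNat_eq]; exact (h1 _ _).2

/-- The candidates contain every operation that can take the base point to a neighbour. -/
theorem mem_candidates {D : Simplex} (hD : D.Bdd) (hDf : D.hull ⊆ full.hull) {m : ℕ}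
    (hm : Nat.testBit m 0 = true) {x p : E3} (hp : p ∈ D.hull) {k : Op} (hk : k.Valid)
    (hkm : Nat.testBit m k.cls = true) (h1 : dist x (k.act p) < dist x p)
    (h2 : ∀ g : Op, g.Valid → Nat.testBit m g.cls = true → g ≠ Op.one → g ≠ k →
      dist x p < dist x (g.act p)) : k ∈ candidates (tables D) m := by
  -- The point `x` is carried into the fundamental simplex by an operation `u` of the full
  -- normalizer, which need not lie in the group of the mask. This replaces the group by its left
  -- coset `u M` acting on `p`.
  obtain ⟨u, hu, hxf, hx⟩ := exists_valid_mem_half x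
  have hv := hu.mul hk
  obtain ⟨v, hvdef⟩ : ∃ v, v = u.mul k := ⟨_, rfl⟩
  rw [← hvdef] at hv
  have huv : dist (u.act x) (v.act p) < dist (u.act x) (u.act p) := by
    rw [hvdef, Op.mul_act, Op.dist_act hu.1, Op.dist_act hu.1]
    exact h1
  have H : ∀ w : Op, w.Valid → (∃ j < 16, Nat.testBit m j = true ∧ mulC u.cls j = w.cls) → w ≠ u →
      w ≠ v → dist (u.act x) (u.act p) < dist (u.act x) (w.act p) := by
    rintro w hw ⟨j, hj, hjm, hjw⟩ hwu hwv
    have hw' : w = u.mul (u.inv.mul w) := by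
      rw [← Op.mul_assoc, hu.1.mul_inv, Op.one_mul]
    have hcls : (u.inv.mul w).cls = j := by
      rw [Op.cls_mul hu.inv hw, Op.cls_inv hu, ← hjw,
        ← mulC_assoc _ (invC_lt _ u.cls_lt) _ u.cls_lt _ hj, invC_mulC _ u.cls_lt, zero_mulC _ hj]
    have hm' : Nat.testBit m (u.inv.mul w).cls = true := by rw [hcls]; exact hjm
    have hne1 : u.inv.mul w ≠ Op.one := fun heq => hwu (by rw [hw', heq, Op.mul_one])
    have hne2 : u.inv.mul w ≠ k := fun heq => hwv (by rw [hw', heq, hvdef])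
    have hlt := h2 (u.inv.mul w) (hu.inv.mul hw) hm' hne1 hne2
    rw [← Op.dist_act hu.1, ← Op.dist_act hu.1 x, ← Op.mul_act u, ← hw'] at hlt
    exact hlt
  have hucos : ∃ j < 16, Nat.testBit m j = true ∧ mulC u.cls j = u.cls :=
    ⟨0, by norm_num, hm, mulC_zero _ u.cls_lt⟩
  have hvcos : ∃ j < 16, Nat.testBit m j = true ∧ mulC u.cls j = v.cls :=
    ⟨k.cls, k.cls_lt, hkm, by rw [hvdef, Op.cls_mul hu hk]⟩
  -- Within the class of `u` only `v` may be at least as close, so `u` occurs in the table; the same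
  -- holds for `v`, with nothing else as close.
  obtain ⟨nu, hnu, hnu'⟩ := exists_code (v := v) hu hxf (hDf hp) (by
    intro w hw hc hne hle
    exact Classical.byContradiction fun hwv =>
      absurd (H w hw (by rw [hc]; exact hucos) hne hwv) (not_lt.2 hle))
  obtain ⟨nv, hnv, hnv'⟩ := exists_code (v := v) hv hxf (hDf hp) (by
    intro w hw hc hne hle
    rcases eq_or_ne w u with hwu | hwu
    · rw [hwu] at hle; exact absurd huv (not_lt.2 hle)
    · have := H w hw (by rw [hc]; exact hvcos) hwu hne
      linarith)
  have key : ∀ X : Simplex, X.Bdd → u.act x ∈ X.hull → ∀ S : List Op,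
      k ∈ addCoset (selectEntries (cosetMask m u.cls) (entries X D closeOps)) S := by
    intro X hX hxX S
    have hok := entries_ok X D closeOps (List.Subset.refl _)
    obtain ⟨eu, heu, hu'⟩ := mem_entries X D hnu
    obtain ⟨ev, hev, hv'⟩ := mem_entries X D hnv
    rw [hnu'] at hu'
    rw [hnv'] at hv'
    have hk' : k = eu.op.inv.mul ev.op := by
      rw [hu', hv', hvdef, ← Op.mul_assoc, hu.1.inv_mul, Op.one_mul]
    have hC : ∀ g ∈ selectEntries (cosetMask m u.cls) (entries X D closeOps), g.Ok X D :=
      fun g hg => hok g (mem_selectEntries.1 hg).1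
    have hmu : eu ∈ selectEntries (cosetMask m u.cls) (entries X D closeOps) := by
      rw [mem_selectEntries, testBit_cosetMask, (hok eu heu).cls, hu']
      exact ⟨heu, hucos⟩
    have hmv : ev ∈ selectEntries (cosetMask m u.cls) (entries X D closeOps) := by
      rw [mem_selectEntries, testBit_cosetMask, (hok ev hev).cls, hv']
      exact ⟨hev, hvcos⟩
    have hfar : ∀ g ∈ selectEntries (cosetMask m u.cls) (entries X D closeOps), g.op ≠ eu.op →
        g.op ≠ ev.op → dist (u.act x) (eu.op.act p) < dist (u.act x) (g.op.act p) := by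
      intro g hg
      rw [mem_selectEntries, testBit_cosetMask] at hg
      rw [hu', hv']
      have kg := hok g hg.1
      exact H g.op kg.valid (by rw [← kg.cls]; exact hg.2)
    have hlt : dist (u.act x) (ev.op.act p) < dist (u.act x) (eu.op.act p) := by
      rw [hu', hv']; exact huv
    rw [hk']
    generalize selectEntries (cosetMask m u.cls) (entries X D closeOps) = C at *
    exact mem_addCoset hX hD hC hmu hmv hxX hp hlt hfar S
  have hsub : ∀ (T : List Entry) (S : List Op),
      S ⊆ (cosets m).foldr (fun c S => addCoset (selectEntries c T) S) S :=
    fun T S => subset_foldr (fun c S => subset_addCoset _ S) _ _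
  have hmem : ∀ X : Simplex, X.Bdd → u.act x ∈ X.hull → ∀ S : List Op,
      k ∈ (cosets m).foldr (fun c S => addCoset (selectEntries c (entries X D closeOps)) S) S := by
    intro X hX hxX S
    have hk := key X hX hxX
    generalize entries X D closeOps = T at *
    exact mem_foldr_of_mem (f := fun c S => addCoset (selectEntries c T) S)
      (fun c S => subset_addCoset _ S) (a := cosetMask m u.cls) hk (mem_cosets u.cls_lt) S
  have h₁ := hmem half1 half1_bdd
  have h₂ := hmem half2 half2_bdd
  clear key hmem
  unfold candidates tables
  generalize entries half1 D closeOps = T₁, entries half2 D closeOps = T₂ at *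
  rcases hx with hx | hx
  · exact mem_foldr_of_mem hsub (h₁ hx) (l := [T₁, T₂]) List.mem_cons_self []
  · exact mem_foldr_of_mem hsub (h₂ hx) (l := [T₁, T₂])
      (List.mem_cons_of_mem _ List.mem_cons_self) []

end Cubic

namespace Cubic

/-! ### Stabilizers -/

/-- `p` is in the relative interior of the convex hull of the points of `Φ`. -/
def InFace (Φ : List Pt) (p : E3) : Prop :=
  ∃ w : Pt → ℝ, (∀ d ∈ Φ, 0 < w d) ∧ (Φ.map w).sum = 1 ∧
    ∀ i, p i = (Φ.map fun d => w d * d.toE i).sum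

theorem sum_map_affine (Φ : List Pt) (w f : Pt → ℝ) (a t : ℝ) :
    (Φ.map fun d => w d * (a * f d + t)).sum =
      a * (Φ.map fun d => w d * f d).sum + t * (Φ.map w).sum := by
  induction Φ with
  | nil => simp
  | cons d Φ ih =>
    simp only [List.map_cons, List.sum_cons, ih]
    ring

theorem Row.eval_eq_mul (r : Row) (x : E3) :
    r.eval x = (bif r.neg then -1 else 1) * x r.j + r.t := by
  unfold Row.eval
  cases r.neg <;> simp

theorem Row.eval_face {Φ : List Pt} {p : E3} {w : Pt → ℝ} (h1 : (Φ.map w).sum = 1)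
    (h2 : ∀ i, p i = (Φ.map fun d => w d * d.toE i).sum) (r : Row) :
    r.eval p = (Φ.map fun d => w d * r.eval d.toE).sum := by
  simp only [Row.eval_eq_mul]
  rw [sum_map_affine Φ w (fun d => d.toE r.j), h1, h2]
  ring

theorem Op.act_face {Φ : List Pt} {p : E3} (hp : InFace Φ p) {o o' : Op}
    (h : ∀ d ∈ Φ, o.act d.toE = o'.act d.toE) : o.act p = o'.act p := by
  obtain ⟨w, -, h1, h2⟩ := hp
  ext i
  rw [Op.act_apply, Op.act_apply, Row.eval_face h1 h2, Row.eval_face h1 h2]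
  congr 1
  refine List.map_congr_left fun d hd => ?_
  have := congrArg (fun y : E3 => y i) (h d hd)
  simp only [Op.act_apply] at this
  rw [this]

theorem Row.coord_bounds {r : Row} (hr : r.isSmall = true) {d : Pt} (hd : d.Bdd) :
    r.coord d < 1024 ∧ (r.coord d : ℝ) = 12 * r.eval d.toE + 120 := by
  obtain ⟨j, n, t⟩ := r
  simp only [Row.isSmall, Bool.and_eq_true, Nat.ble_eq, Row.shift] at hr
  have hj := hd.get j
  have hz : ((12 * t + 120).toNat : ℤ) = 12 * t + 120 := by omega
  have hR : ((12 * t + 120).toNat : ℝ) = 12 * t + 120 := by exact_mod_cast hz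
  simp only [Row.coord, Row.shift, coordOf]
  cases n
  · simp only [cond_false, Nat.add_eq]
    refine ⟨by omega, ?_⟩
    push_cast
    rw [hR]
    simp [Row.eval]
    ring
  · simp only [cond_true, Nat.sub_eq]
    refine ⟨by omega, ?_⟩
    rw [Nat.cast_sub (by omega), hR]
    simp [Row.eval]
    ring

theorem Op.image_cons (d : Pt) (Φ : List Pt) (o : Op) : o.image (d :: Φ) =
    o.r0.coord d + 1024 * (o.r1.coord d + 1024 * (o.r2.coord d + 1024 * o.image Φ)) := rfl

/-- The packed images have digits below 1024, so equal numbers have equal digits. -/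
theorem Op.image_inj {Φ : List Pt} (hΦ : ∀ d ∈ Φ, d.Bdd) {o o' : Op} (ho : o.isSmall = true)
    (ho' : o'.isSmall = true) (h : o.image Φ = o'.image Φ) :
    ∀ d ∈ Φ, o.act d.toE = o'.act d.toE := by
  simp only [Op.isSmall, Bool.and_eq_true] at ho ho'
  induction Φ with
  | nil => simp
  | cons d Φ ih =>
    have hd := hΦ d List.mem_cons_self
    obtain ⟨a0, b0⟩ := Row.coord_bounds ho.1 hd
    obtain ⟨a1, b1⟩ := Row.coord_bounds ho.2.1 hd
    obtain ⟨a2, b2⟩ := Row.coord_bounds ho.2.2 hd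
    obtain ⟨a0', b0'⟩ := Row.coord_bounds ho'.1 hd
    obtain ⟨a1', b1'⟩ := Row.coord_bounds ho'.2.1 hd
    obtain ⟨a2', b2'⟩ := Row.coord_bounds ho'.2.2 hd
    rw [Op.image_cons, Op.image_cons] at h
    have e0 : o.r0.coord d = o'.r0.coord d := by omega
    have e1 : o.r1.coord d = o'.r1.coord d := by omega
    have e2 : o.r2.coord d = o'.r2.coord d := by omega
    have e3 : o.image Φ = o'.image Φ := by omega
    intro d' hd'
    rcases List.mem_cons.1 hd' with rfl | hd'
    · ext i
      rw [e0] at b0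
      rw [e1] at b1
      rw [e2] at b2
      fin_cases i
      · change o.r0.eval _ = o'.r0.eval _; linarith
      · change o.r1.eval _ = o'.r1.eval _; linarith
      · change o.r2.eval _ = o'.r2.eval _; linarith
    · exact ih (fun d hd => hΦ d (List.mem_cons_of_mem _ hd)) e3 d' hd'

theorem sum_map_pos (Φ : List Pt) (w f : Pt → ℝ) (hw : ∀ d ∈ Φ, 0 < w d) (hf : ∀ d ∈ Φ, 0 ≤ f d)
    (hne : ∃ d ∈ Φ, f d ≠ 0) : 0 < (Φ.map fun d => w d * f d).sum := by
  have hnn : ∀ Φ : List Pt, (∀ d ∈ Φ, 0 < w d) → (∀ d ∈ Φ, 0 ≤ f d) →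
      0 ≤ (Φ.map fun d => w d * f d).sum := by
    intro Φ hw hf
    refine List.sum_nonneg fun x hx => ?_
    obtain ⟨d, hd, rfl⟩ := List.mem_map.1 hx
    exact mul_nonneg (hw d hd).le (hf d hd)
  induction Φ with
  | nil => simp at hne
  | cons d Φ ih =>
    rw [List.map_cons, List.sum_cons]
    have hw' := fun d hd => hw d (List.mem_cons_of_mem _ hd)
    have hf' := fun d hd => hf d (List.mem_cons_of_mem _ hd)
    obtain ⟨d', hd', h⟩ := hne
    rcases List.mem_cons.1 hd' with rfl | hd'
    · have h1 := mul_pos (hw d' List.mem_cons_self)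
        (lt_of_le_of_ne (hf d' List.mem_cons_self) (Ne.symm h))
      have := hnn Φ hw' hf'
      linarith
    · have h1 := mul_nonneg (hw d List.mem_cons_self).le (hf d List.mem_cons_self)
      have := ih hw' hf' ⟨d', hd', h⟩
      linarith

/-- The difference of the row and the coordinate is an affine function that has one sign on the
vertices and is nonzero at some vertex. With all weights positive it cannot vanish. -/
theorem Row.eval_ne_of_moves {Φ : List Pt} (hΦ : ∀ d ∈ Φ, d.Bdd) {p : E3} (hp : InFace Φ p)
    {r : Row} (hr : r.isSmall = true) {i : Fin 3} (h : r.moves Φ i = true) : r.eval p ≠ p i := by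
  obtain ⟨w, h0, h1, h2⟩ := hp
  unfold Row.moves at h
  cases hall : Φ.all fun d => Nat.beq (r.coord d) (Nat.add 120 (d.get i))
  · rw [hall, cond_false, Bool.or_eq_true] at h
    rw [List.all_eq_false] at hall
    obtain ⟨d₀, hd₀, hne⟩ := hall
    rw [Nat.beq_eq, Nat.add_eq] at hne
    have key : ∀ d ∈ Φ, (r.coord d : ℝ) - ((120 + d.get i : ℕ) : ℝ) =
        12 * (r.eval d.toE - d.toE i) := by
      intro d hd
      rw [(Row.coord_bounds hr (hΦ d hd)).2, Pt.toE_apply]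
      push_cast
      ring
    have hne' : r.eval d₀.toE - d₀.toE i ≠ 0 := by
      intro h0
      have := key d₀ hd₀
      rw [h0, mul_zero, sub_eq_zero] at this
      exact hne (by exact_mod_cast this)
    have hsum : ∀ a : ℝ, (Φ.map fun d => w d * (a * (r.eval d.toE - d.toE i))).sum =
        a * (r.eval p - p i) := by
      intro a
      rw [Row.eval_face h1 h2, h2 i]
      clear h0 h1 h2 hne hne' h key hΦ hd₀
      induction Φ with
      | nil => simp
      | cons d Φ ih => simp only [List.map_cons, List.sum_cons, ih]; ring
    rcases h with h | h
    · rw [List.all_eq_true] at h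
      have := sum_map_pos Φ w (fun d => -1 * (r.eval d.toE - d.toE i)) h0 (fun d hd => by
        have h3 := h d hd
        rw [Nat.ble_eq, Nat.add_eq] at h3
        have h4 : (r.coord d : ℝ) ≤ ((120 + d.get i : ℕ) : ℝ) := by exact_mod_cast h3
        have := key d hd
        linarith) ⟨d₀, hd₀, mul_ne_zero (by norm_num) hne'⟩
      rw [hsum] at this
      intro heq
      rw [heq] at this
      simp at this
    · rw [List.all_eq_true] at h
      have := sum_map_pos Φ w (fun d => 1 * (r.eval d.toE - d.toE i)) h0 (fun d hd => by
        have h3 := h d hd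
        rw [Nat.ble_eq, Nat.add_eq] at h3
        have h4 : ((120 + d.get i : ℕ) : ℝ) ≤ (r.coord d : ℝ) := by exact_mod_cast h3
        have := key d hd
        linarith) ⟨d₀, hd₀, mul_ne_zero (by norm_num) hne'⟩
      rw [hsum] at this
      intro heq
      rw [heq] at this
      simp at this
  · rw [hall, cond_true] at h
    exact absurd h (by decide)

/-- A fixed point with coordinates in the unit interval leaves only few possible translations in
each row. -/
theorem mem_fixOps {o : Op} (ho : o.Valid) {p : E3} (hb : ∀ i, 0 ≤ p i ∧ p i ≤ 1)
    (h : o.act p = p) : o ∈ fixOps := by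
  obtain ⟨hperm, p1, p2⟩ := ho
  have key : ∀ i, ((o.row i).neg = false ∧ -1 ≤ (o.row i).t ∧ (o.row i).t ≤ 1) ∨
      ((o.row i).neg = true ∧ 0 ≤ (o.row i).t ∧ (o.row i).t ≤ 2) := by
    intro i
    have hi : (o.row i).eval p = p i := by rw [← Op.act_apply, h]
    generalize o.row i = r at hi
    obtain ⟨j, n, t⟩ := r
    have h1 := hb i
    have h2 := hb j
    cases n <;> simp only [Row.eval, cond_true, cond_false] at hi
    · left
      have h3 : (-1 : ℝ) ≤ t := by linarith
      have h4 : (t : ℝ) ≤ 1 := by linarith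
      exact ⟨rfl, by exact_mod_cast h3, by exact_mod_cast h4⟩
    · right
      have h3 : (0 : ℝ) ≤ t := by linarith
      have h4 : (t : ℝ) ≤ 2 := by linarith
      exact ⟨rfl, by exact_mod_cast h3, by exact_mod_cast h4⟩
  have k0 := key 0
  have k1 := key 1
  have k2 := key 2
  rw [Op.row_zero] at k0
  rw [Op.row_one] at k1
  rw [Op.row_two] at k2
  have mem : ∀ {l : List (Bool × ℤ)}, (o.r0.neg, o.r0.t) ∈ l → (o.r1.neg, o.r1.t) ∈ l →
      (o.r2.neg, o.r2.t) ∈ l → o ∈ listOps l := by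
    intro l h0 h1 h2
    simp only [listOps, List.mem_flatMap, List.mem_map]
    exact ⟨_, hperm.cases, _, h0, _, h1, _, h2, rfl⟩
  have even : ∀ r : Row, ((r.neg = false ∧ -1 ≤ r.t ∧ r.t ≤ 1) ∨
      (r.neg = true ∧ 0 ≤ r.t ∧ r.t ≤ 2)) → r.t % 2 = 0 →
      (r.neg, r.t) ∈ [(false, (0 : ℤ)), (true, 0), (true, 2)] := by
    rintro r (⟨h, h1, h2⟩ | ⟨h, h1, h2⟩) he
    · rw [h, show r.t = 0 by omega]; decide
    · rcases (show r.t = 0 ∨ r.t = 2 by omega) with h3 | h3 <;> rw [h, h3] <;> decide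
  have odd : ∀ r : Row, ((r.neg = false ∧ -1 ≤ r.t ∧ r.t ≤ 1) ∨
      (r.neg = true ∧ 0 ≤ r.t ∧ r.t ≤ 2)) → r.t % 2 = 1 →
      (r.neg, r.t) ∈ [(false, (-1 : ℤ)), (false, 1), (true, 1)] := by
    rintro r (⟨h, h1, h2⟩ | ⟨h, h1, h2⟩) he
    · rcases (show r.t = -1 ∨ r.t = 1 by omega) with h3 | h3 <;> rw [h, h3] <;> decide
    · rw [h, show r.t = 1 by omega]; decide
  rw [fixOps, List.mem_append]
  rcases Int.emod_two_eq_zero_or_one o.r0.t with he | he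
  · exact Or.inl (mem (even _ k0 he) (even _ k1 (by omega)) (even _ k2 (by omega)))
  · exact Or.inr (mem (odd _ k0 he) (odd _ k1 (by omega)) (odd _ k2 (by omega)))

theorem one_isSmall : Op.one.isSmall = true := by decide

theorem mem_fixers {Φ : List Pt} (hΦ : ∀ d ∈ Φ, d.Bdd) (hok : fixersOk Φ = true) {o : Op}
    (ho : o.Valid) {p : E3} (hp : InFace Φ p) (hb : ∀ i, 0 ≤ p i ∧ p i ≤ 1) (h : o.act p = p) :
    o ∈ fixers Φ := by
  have hmem := mem_fixOps ho hb h
  rw [fixersOk, List.all_eq_true] at hok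
  have h1 := hok o hmem
  rw [Bool.and_eq_true, Bool.or_eq_true] at h1
  obtain ⟨hs, h1 | h1⟩ := h1
  · exact List.mem_filter.2 ⟨hmem, h1⟩
  · exfalso
    have hrow : ∀ i, (o.row i).eval p = p i := fun i => by rw [← Op.act_apply, h]
    simp only [Op.isSmall, Bool.and_eq_true] at hs
    simp only [Op.moves, Bool.or_eq_true] at h1
    rcases h1 with h1 | h1 | h1
    · exact Row.eval_ne_of_moves hΦ hp hs.1 h1 (hrow 0)
    · exact Row.eval_ne_of_moves hΦ hp hs.2.1 h1 (hrow 1)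
    · exact Row.eval_ne_of_moves hΦ hp hs.2.2 h1 (hrow 2)

theorem encard_le_length {α : Type*} {Q : Set α} {L : List α} (h : ∀ q ∈ Q, q ∈ L) :
    Q.encard ≤ (L.length : ℕ∞) := by
  classical
  calc Q.encard ≤ (L.toFinset : Set α).encard :=
        Set.encard_le_encard fun q hq => by simpa using h q hq
    _ = (L.toFinset.card : ℕ∞) := Set.encard_coe_eq_coe_finsetCard _
    _ ≤ L.length := by exact_mod_cast L.toFinset_card_le

theorem mem_insertNat (k : ℕ) (S : List ℕ) : S ⊆ insertNat k S ∧ k ∈ insertNat k S := by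
  unfold insertNat
  cases h : S.any (Nat.beq k)
  · exact ⟨List.subset_cons_self _ _, List.mem_cons_self⟩
  · refine ⟨List.Subset.refl _, ?_⟩
    rw [List.any_eq_true] at h
    obtain ⟨x, hx, h⟩ := h
    rw [Nat.beq_eq] at h
    rw [h]
    exact hx

theorem subset_addImages (Φ : List Pt) (F : List Op) (k : Op) (A : List ℕ) :
    A ⊆ addImages Φ F k A :=
  subset_foldr (fun s A => by rw [forceNat_eq]; exact (mem_insertNat _ _).1) _ _

theorem mem_images {Φ : List Pt} {F S : List Op} {s k : Op} (hs : s ∈ F) (hk : k ∈ S) :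
    (s.mul k).image Φ ∈ images Φ F S := by
  refine mem_foldr_of_mem (subset_addImages Φ F) (a := k) (fun A => ?_) hk _
  refine mem_foldr_of_mem (fun s A => ?_) (a := s) (fun A => ?_) hs A
  · rw [forceNat_eq]; exact (mem_insertNat _ _).1
  · rw [forceNat_eq]; exact (mem_insertNat _ _).2

/-- Operations with equal images of the vertices agree at `p`, so the sites in `Q` inject into the
list of images. The image under the identity is in the list too but belongs to `p` itself, which is
not in `Q`; this accounts for the difference between 26 and 25. -/
theorem encard_images_le {Φ : List Pt} (hΦ : ∀ d ∈ Φ, d.Bdd) {F S : List Op}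
    (hok : imagesOk Φ F S = true) {p : E3} (hp : InFace Φ p) {Q : Set E3} (hpQ : p ∉ Q)
    (hQ : ∀ q ∈ Q, ∃ s ∈ F, ∃ k ∈ S, q = (s.mul k).act p) : Q.encard ≤ 25 := by
  rw [imagesOk, Bool.or_eq_true, Nat.ble_eq, Bool.and_eq_true, Nat.ble_eq] at hok
  rcases hok with hok | ⟨hsm, hlen⟩
  · refine (encard_le_length (L := F.flatMap fun s => S.map fun k => (s.mul k).act p) ?_).trans ?_
    · intro q hq
      obtain ⟨s, hs, k, hk, rfl⟩ := hQ q hq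
      exact List.mem_flatMap.2 ⟨s, hs, List.mem_map.2 ⟨k, hk, rfl⟩⟩
    · rw [List.length_flatMap]
      simp only [List.length_map, List.map_const', List.sum_replicate, smul_eq_mul]
      exact_mod_cast hok
  · haveI : Inhabited Op := ⟨Op.one⟩
    choose! s hs k hk hq using hQ
    simp only [List.all_eq_true] at hsm
    let c : E3 → ℕ := fun q => ((s q).mul (k q)).image Φ
    have hinj : Set.InjOn c Q := by
      intro q hq1 q' hq1' heq
      rw [hq q hq1, hq q' hq1']
      exact Op.act_face hp (Op.image_inj hΦ (hsm _ (hk q hq1) _ (hs q hq1))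
        (hsm _ (hk q' hq1') _ (hs q' hq1')) heq)
    have hone : Op.one.image Φ ∉ c '' Q := by
      rintro ⟨q, hq1, heq⟩
      apply hpQ
      have := Op.act_face hp (Op.image_inj hΦ (hsm _ (hk q hq1) _ (hs q hq1)) one_isSmall heq)
      rw [Op.one_act, ← hq q hq1] at this
      rwa [← this]
    have h1 : (insert (Op.one.image Φ) (c '' Q)).encard ≤ ((images Φ F S).length : ℕ∞) := by
      refine encard_le_length fun n hn => ?_
      rcases hn with rfl | ⟨q, hq1, rfl⟩
      · exact subset_foldr (subset_addImages Φ F) S _ (List.mem_singleton.2 rfl)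
      · exact mem_images (hs q hq1) (hk q hq1)
    rw [Set.encard_insert_of_notMem hone, hinj.encard_image] at h1
    have h2 : Q.encard + 1 ≤ 25 + 1 := h1.trans (by exact_mod_cast hlen)
    exact (ENat.add_le_add_iff_right (by simp)).1 h2

/-- Discarding the vertices of weight zero turns a point of a simplex into a relatively interior
point of a face. -/
theorem mem_faces_of_weights {Φ : List Pt} {p : E3} (w : Pt → ℝ) (h0 : ∀ d ∈ Φ, 0 ≤ w d)
    (h1 : (Φ.map w).sum = 1) (h2 : ∀ i, p i = (Φ.map fun d => w d * d.toE i).sum) :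
    InFace (Φ.filter fun d => decide (0 < w d)) p := by
  have key : ∀ f : Pt → ℝ, ((Φ.filter fun d => decide (0 < w d)).map fun d => w d * f d).sum =
      (Φ.map fun d => w d * f d).sum := by
    intro f
    clear h1 h2
    induction Φ with
    | nil => simp
    | cons d Φ ih =>
      have ih' := ih fun d hd => h0 d (List.mem_cons_of_mem _ hd)
      rw [List.filter_cons]
      by_cases h : 0 < w d
      · simp only [h, decide_true, if_true, List.map_cons, List.sum_cons, ih']
      · have h3 : w d = 0 := le_antisymm (not_lt.1 h) (h0 d List.mem_cons_self)
        simp only [List.map_cons, List.sum_cons, h3]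
        simpa using ih'
  refine ⟨w, fun d hd => ?_, ?_, fun i => ?_⟩
  · simpa using (List.mem_filter.1 hd).2
  · have := key fun _ => 1
    simp only [mul_one] at this
    rw [← h1]
    exact this
  · rw [h2 i]
    exact (key fun d => d.toE i).symm

end Cubic

namespace Cubic

open MeasureTheory

/-! ### Generic points -/

/-- Countably many proper affine hyperplanes do not cover a nonempty open set. -/
theorem exists_generic {V : Type*} [NormedAddCommGroup V] [NormedSpace ℝ V] [FiniteDimensional ℝ V]
    {ι : Type*} [Countable ι] (L : ι → V →ₗ[ℝ] ℝ) (c : ι → ℝ) (h : ∀ i, ∃ x, L i x + c i ≠ 0)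
    {U : Set V} (hU : IsOpen U) (hne : U.Nonempty) : ∃ x ∈ U, ∀ i, L i x + c i ≠ 0 := by
  letI : MeasurableSpace V := borel V
  haveI : BorelSpace V := ⟨rfl⟩
  let μ : Measure V := Measure.addHaar
  let H : ι → AffineSubspace ℝ V := fun i =>
    (AffineSubspace.mk' (0 : ℝ) ⊥).comap ((L i).toAffineMap + AffineMap.const ℝ V (c i))
  have hH : ∀ i x, x ∈ H i ↔ L i x + c i = 0 := by
    intro i x
    simp [H, AffineSubspace.mem_comap, AffineSubspace.mem_mk']
  have h0 : μ (⋃ i, (H i : Set V)) = 0 := by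
    rw [measure_iUnion_null_iff]
    intro i
    refine Measure.addHaar_affineSubspace μ (H i) fun htop => ?_
    obtain ⟨x, hx⟩ := h i
    exact hx ((hH i x).1 (by rw [htop]; trivial))
  have hpos : 0 < μ U := hU.measure_pos μ hne
  by_contra hcon
  push Not at hcon
  have hsub : U ⊆ ⋃ i, (H i : Set V) := by
    intro x hx
    obtain ⟨i, hi⟩ := hcon x hx
    exact Set.mem_iUnion.2 ⟨i, (hH i x).2 hi⟩
  have := measure_mono (μ := μ) hsub
  rw [h0] at this
  exact absurd hpos (not_lt.2 this)

/-- A countable family of affine functions, none of which vanishes on a convex set, has a common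
nonzero in the set. -/
theorem exists_generic_of_convex {F : Set E3} (hF : Convex ℝ F) (hne : F.Nonempty) {ι : Type*}
    [Countable ι] (L : ι → E3 →ₗ[ℝ] ℝ) (c : ι → ℝ) (h : ∀ i, ∃ x ∈ F, L i x + c i ≠ 0) :
    ∃ x ∈ F, ∀ i, L i x + c i ≠ 0 := by
  obtain ⟨A, hAF, hspan, hind⟩ := exists_affineIndependent ℝ E3 F
  have hfin : Finite A := finite_of_fin_dim_affineIndependent ℝ hind
  have := Fintype.ofFinite A
  have hAne : Nonempty A := by
    by_contra hemp
    rw [not_nonempty_iff] at hemp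
    have hA : A = ∅ := Set.isEmpty_coe_sort.1 hemp
    rw [hA, AffineSubspace.span_empty] at hspan
    obtain ⟨x, hx⟩ := hne
    have := mem_affineSpan ℝ hx
    rw [← hspan] at this
    exact AffineSubspace.notMem_bot ℝ E3 x this
  -- The set `A` is an affine basis of the affine hull of `F`. In barycentric weights each affine
  -- function becomes a linear form, nonzero because the function does not vanish on all of `A`.
  -- Generic positive weights are chosen and then normalized.
  let M : ι → (A → ℝ) →ₗ[ℝ] ℝ := fun i =>
    ∑ a : A, (L i a + c i) • LinearMap.proj a
  have hM : ∀ i w, M i w = ∑ a : A, (L i a + c i) * w a := by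
    intro i w
    simp [M]
  obtain ⟨w, hw, hwne⟩ := exists_generic M (fun _ => 0) (fun i => by
    have hex : ∃ a ∈ A, L i a + c i ≠ 0 := by
      by_contra hcon
      push Not at hcon
      obtain ⟨x, hx, hxne⟩ := h i
      let f : E3 →ᵃ[ℝ] ℝ := (L i).toAffineMap + AffineMap.const ℝ E3 (c i)
      have hle : affineSpan ℝ A ≤ (AffineSubspace.mk' (0 : ℝ) ⊥).comap f := by
        rw [affineSpan_le]
        intro a ha
        have : L i a + c i = 0 := hcon a ha
        simpa [f, AffineSubspace.mem_comap, AffineSubspace.mem_mk'] using this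
      have hx' : x ∈ affineSpan ℝ A := by rw [hspan]; exact mem_affineSpan ℝ hx
      have := hle hx'
      apply hxne
      simpa [f, AffineSubspace.mem_comap, AffineSubspace.mem_mk'] using this
    obtain ⟨a, ha, hane⟩ := hex
    classical
    refine ⟨Pi.single ⟨a, ha⟩ 1, ?_⟩
    rw [hM, Finset.sum_eq_single ⟨a, ha⟩]
    · simpa using hane
    · intro b _ hb; simp [hb]
    · simp) (U := Set.univ.pi fun _ => Set.Ioi 0)
    (isOpen_set_pi Set.finite_univ fun _ _ => isOpen_Ioi) ⟨fun _ => 1, fun _ _ => by simp⟩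
  have hwpos : ∀ a, 0 < w a := fun a => hw a (Set.mem_univ a)
  have hsum : 0 < ∑ a, w a := Finset.sum_pos (fun a _ => hwpos a) Finset.univ_nonempty
  refine ⟨∑ a : A, (w a / ∑ a, w a) • (a : E3), ?_, fun i => ?_⟩
  · refine hF.sum_mem (fun a _ => (div_pos (hwpos a) hsum).le) ?_ fun a _ => hAF a.2
    rw [← Finset.sum_div, div_self hsum.ne']
  · have h1 := hwne i
    rw [add_zero, hM] at h1
    have h2 : L i (∑ a : A, (w a / ∑ a, w a) • (a : E3)) + c i =
        (∑ a : A, (L i a + c i) * w a) / ∑ a, w a := by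
      rw [map_sum, eq_div_iff hsum.ne', add_mul, Finset.sum_mul, Finset.mul_sum,
        ← Finset.sum_add_distrib]
      refine Finset.sum_congr rfl fun a _ => ?_
      rw [map_smul, smul_eq_mul]
      field_simp
    rw [h2]
    exact div_ne_zero h1 hsum.ne'

/-! ### Facets of Voronoi cells -/

/-- `q` is a neighbour of `p` in the set of sites `S`. -/
def NB (S : Set E3) (p q : E3) : Prop :=
  q ∈ S ∧ q ≠ p ∧ ∃ x, dist x p = dist x q ∧ ∀ r ∈ S, r ≠ p → r ≠ q → dist x p < dist x r

def LocFin (S : Set E3) : Prop := ∀ (x : E3) (r : ℝ), (S ∩ Metric.closedBall x r).Finite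

theorem LocFin.countable {S : Set E3} (hS : LocFin S) : S.Countable := by
  have : S = ⋃ n : ℕ, S ∩ Metric.closedBall 0 n := by
    rw [← Set.inter_iUnion, Metric.iUnion_closedBall_nat, Set.inter_univ]
  rw [this]
  exact Set.countable_iUnion fun n => (hS 0 n).countable

open Filter Topology in
-- Sites at distance more than `dist x p + 2` stay farther than `p` on the unit ball around `x`; the
-- finitely many others are handled by continuity.
theorem LocFin.eventually {S : Set E3} (hS : LocFin S) (x p : E3) :
    ∀ᶠ y in 𝓝 x, ∀ q ∈ S, dist x p < dist x q → dist y p < dist y q := by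
  have h1 : ∀ᶠ y in 𝓝 x, ∀ q ∈ S ∩ Metric.closedBall x (dist x p + 2), dist x p < dist x q →
      dist y p < dist y q := by
    rw [Filter.eventually_all_finite (hS x _)]
    intro q _
    by_cases h : dist x p < dist x q
    · have : ∀ᶠ y in 𝓝 x, dist y p < dist y q :=
        (continuous_id.dist continuous_const).continuousAt.eventually_lt
          (continuous_id.dist continuous_const).continuousAt h
      filter_upwards [this] with y hy _ using hy
    · exact Filter.Eventually.of_forall fun y hy => absurd hy h
  filter_upwards [h1, Metric.ball_mem_nhds x one_pos] with y hy hyx q hq hlt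
  by_cases hqx : q ∈ Metric.closedBall x (dist x p + 2)
  · exact hy q ⟨hq, hqx⟩ hlt
  · rw [Metric.mem_closedBall, not_le] at hqx
    rw [Metric.mem_ball] at hyx
    have h2 := dist_triangle y x p
    have h3 := dist_triangle x y q
    rw [dist_comm q x] at hqx
    rw [dist_comm x y] at h3
    linarith

/-- The affine function whose zero set is the bisector of `p` and `q`. -/
theorem sq_dist_sub (x p q : E3) : dist x p ^ 2 - dist x q ^ 2 =
    2 * inner ℝ (q - p) x + (‖p‖ ^ 2 - ‖q‖ ^ 2) := by
  rw [dist_eq_norm, dist_eq_norm, norm_sub_sq_real, norm_sub_sq_real, inner_sub_left,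
    real_inner_comm x p, real_inner_comm x q]
  ring

theorem dist_eq_iff_affine (x p q : E3) :
    dist x p = dist x q ↔ (2 • innerSL ℝ (q - p)).toLinearMap x + (‖p‖ ^ 2 - ‖q‖ ^ 2) = 0 := by
  have h : (2 • innerSL ℝ (q - p)).toLinearMap x + (‖p‖ ^ 2 - ‖q‖ ^ 2) =
      dist x p ^ 2 - dist x q ^ 2 := by
    rw [sq_dist_sub]
    simp [two_smul, two_mul, inner_sub_left]
  rw [h, sub_eq_zero]
  exact ⟨fun h => by rw [h], fun h => by
    exact (sq_eq_sq₀ dist_nonneg dist_nonneg).1 h⟩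

theorem convex_voronoiCell (S : Set E3) (p : E3) : Convex ℝ (voronoiCell S p) := by
  have : voronoiCell S p = ⋂ q ∈ S, {x | dist x p ^ 2 + dist x p ^ 2 ≤ dist x q ^ 2 + dist x q ^ 2} := by
    ext x
    simp only [voronoiCell, Set.mem_ofPred_eq, Set.mem_iInter]
    refine forall₂_congr fun q _ => ?_
    constructor
    · intro h
      have := pow_le_pow_left₀ dist_nonneg h 2
      linarith
    · intro h
      exact le_of_sq_le_sq (by linarith) dist_nonneg
  rw [this]
  exact convex_iInter₂ fun q _ => convex_sq_dist_pair _ _ _ _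

end Cubic

namespace Cubic

open Filter Topology

/-! ### Facets come from neighbours -/

/-- Sites on a common line through `p` have parallel bisectors, and parallel planes with a common
point coincide. -/
theorem eq_of_bisector_eq {x₀ p q r : E3} {t : ℝ} (hp : q ≠ p) (h : r - p = t • (q - p))
    (hr : r ≠ p) (h1 : dist x₀ p = dist x₀ q) (h2 : dist x₀ p = dist x₀ r) : r = q := by
  have key : ∀ y : E3, dist x₀ p = dist x₀ y → 2 * inner ℝ (x₀ - p) (y - p) = ‖y - p‖ ^ 2 := by
    intro y hy
    have h3 : x₀ - y = (x₀ - p) - (y - p) := by abel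
    rw [dist_eq_norm, dist_eq_norm, h3] at hy
    have h4 := norm_sub_sq_real (x₀ - p) (y - p)
    rw [← hy] at h4
    linarith
  have k1 := key q h1
  have k2 := key r h2
  rw [h, inner_smul_right, norm_smul, mul_pow, Real.norm_eq_abs, sq_abs] at k2
  have hpos : 0 < ‖q - p‖ ^ 2 := by
    have : 0 < ‖q - p‖ := norm_pos_iff.2 (sub_ne_zero.2 hp)
    positivity
  have h3 : t * (t - 1) * ‖q - p‖ ^ 2 = 0 := by rw [← k1] at k2 ⊢; linarith
  have h4 : t * (t - 1) = 0 := (mul_eq_zero.1 h3).resolve_right hpos.ne'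
  rcases mul_eq_zero.1 h4 with h5 | h5
  · rw [h5, zero_smul, sub_eq_zero] at h
    exact absurd h hr
  · rw [sub_eq_zero.1 h5, one_smul] at h
    exact sub_left_injective h

theorem inner_eq_of_bisector {p q x : E3} (h : dist x p = dist x q) :
    2 * inner ℝ (q - p) x = ‖q‖ ^ 2 - ‖p‖ ^ 2 := by
  have := sq_dist_sub x p q
  rw [h] at this
  linarith

/-- A planar set lies in at most one bisector of `p`. -/
theorem bisector_unique {F : Set E3} (hF : Module.finrank ℝ (vectorSpan ℝ F) = 2) {p q r : E3}
    (hq : q ≠ p) (hr : r ≠ p) (h1 : ∀ x ∈ F, dist x p = dist x q)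
    (h2 : ∀ x ∈ F, dist x p = dist x r) (hne : F.Nonempty) : r = q := by
  by_contra hrq
  obtain ⟨x₀, hx₀⟩ := hne
  have hind : LinearIndependent ℝ ![q - p, r - p] := by
    rw [LinearIndependent.pair_iff' (sub_ne_zero.2 hq)]
    intro t ht
    exact hrq (eq_of_bisector_eq hq ht.symm hr (h1 x₀ hx₀) (h2 x₀ hx₀))
  have hsp : Module.finrank ℝ (Submodule.span ℝ (Set.range ![q - p, r - p])) = 2 := by
    rw [finrank_span_eq_card hind]; rfl
  -- All differences of points of `F` are orthogonal to the two independent normals, so a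
  -- two-dimensional space would be orthogonal to another one in dimension three.
  have hle : vectorSpan ℝ F ≤ (Submodule.span ℝ (Set.range ![q - p, r - p]))ᗮ := by
    rw [vectorSpan, Submodule.span_le]
    rintro _ ⟨x, hx, y, hy, rfl⟩
    rw [SetLike.mem_coe, Submodule.mem_orthogonal]
    intro u hu
    have hker : Submodule.span ℝ (Set.range ![q - p, r - p]) ≤ (ℝ ∙ (x - y))ᗮ := by
      rw [Submodule.span_le]
      rintro _ ⟨i, rfl⟩
      rw [SetLike.mem_coe, Submodule.mem_orthogonal_singleton_iff_inner_left]
      fin_cases i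
      · have a := inner_eq_of_bisector (h1 x hx)
        have b := inner_eq_of_bisector (h1 y hy)
        change inner ℝ (q - p) (x - y) = 0
        rw [inner_sub_right]
        linarith
      · have a := inner_eq_of_bisector (h2 x hx)
        have b := inner_eq_of_bisector (h2 y hy)
        change inner ℝ (r - p) (x - y) = 0
        rw [inner_sub_right]
        linarith
    exact Submodule.mem_orthogonal_singleton_iff_inner_left.1 (hker hu)
  have h3 := Submodule.finrank_mono hle
  have h4 := Submodule.finrank_add_finrank_orthogonal (Submodule.span ℝ (Set.range ![q - p, r - p]))
  have h5 : Module.finrank ℝ E3 = 3 := by simp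
  omega

/-- A point of `F` is chosen off all bisectors of `p` that do not contain `F`. Some bisector passes
through it, since it would otherwise be interior to the cell, and only one does, since a plane
determines the site. This bisector belongs to the neighbour. -/
theorem exists_neighbour_of_facet {S : Set E3} (hS : LocFin S) {p : E3} (hp : p ∈ S) {F : Set E3}
    (hF : F ∈ facets (voronoiCell S p)) :
    ∃ q, NB S p q ∧ F = {x ∈ voronoiCell S p | dist x p = dist x q} := by
  obtain ⟨hexp, hdim⟩ := hF
  have hne : F.Nonempty := by
    by_contra hemp
    rw [Set.not_nonempty_iff_eq_empty] at hemp
    rw [hemp, vectorSpan_empty, finrank_bot] at hdim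
    exact absurd hdim (by norm_num)
  obtain ⟨l, hl⟩ := hexp hne
  have hFP : F ⊆ voronoiCell S p := fun x hx => by rw [hl] at hx; exact hx.1
  have hconv : Convex ℝ F := hexp.convex (convex_voronoiCell S p)
  let bad : Set E3 := {q | q ∈ S ∧ ∃ x ∈ F, dist x p ≠ dist x q}
  have hbad : bad.Countable := hS.countable.mono fun q hq => hq.1
  have : Countable bad := hbad.to_subtype
  obtain ⟨x, hxF, hx⟩ := exists_generic_of_convex hconv hne
    (fun q : bad => (2 • innerSL ℝ ((q : E3) - p)).toLinearMap)
    (fun q : bad => ‖p‖ ^ 2 - ‖(q : E3)‖ ^ 2) (fun q => by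
      obtain ⟨-, x, hx, hne⟩ := q.2
      exact ⟨x, hx, fun h => hne ((dist_eq_iff_affine x p q).2 h)⟩)
  have hgen : ∀ q ∈ S, dist x p = dist x q → ∀ y ∈ F, dist y p = dist y q := by
    intro q hq heq y hy
    by_contra hyne
    exact hx ⟨q, hq, y, hy, hyne⟩ ((dist_eq_iff_affine x p q).1 heq)
  have hxP := hFP hxF
  have hmax : ∀ y ∈ voronoiCell S p, l y ≤ l x := by rw [hl] at hxF; exact hxF.2
  -- If no other site is equidistant, then `x` is an interior point at which the linear form `l` has
  -- a maximum. So `l` is zero and `F` is the whole cell, which has dimension three.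
  have hex : ∃ q ∈ S, q ≠ p ∧ dist x p = dist x q := by
    by_contra hcon
    push Not at hcon
    have hnear : ∀ᶠ y in 𝓝 x, y ∈ voronoiCell S p := by
      filter_upwards [hS.eventually x p] with y hy q hq
      rcases eq_or_ne q p with rfl | hqp
      · exact le_rfl
      · exact (hy q hq (lt_of_le_of_ne (hxP q hq) (hcon q hq hqp))).le
    have hloc : IsLocalMax l x := by
      filter_upwards [hnear] with y hy using hmax y hy
    have hl0 : l = 0 := by
      have := hloc.fderiv_eq_zero
      rwa [l.fderiv] at this
    have hFeq : F = voronoiCell S p := by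
      rw [hl, hl0]
      ext y
      simp
    have htop : vectorSpan ℝ F = ⊤ := by
      rw [hFeq, ← direction_affineSpan]
      have : (interior (voronoiCell S p)).Nonempty := ⟨x, mem_interior_iff_mem_nhds.2 hnear⟩
      have h1 := isOpen_interior.affineSpan_eq_top this
      have h2 := affineSpan_mono ℝ (interior_subset (s := voronoiCell S p))
      rw [h1, top_le_iff] at h2
      rw [h2, AffineSubspace.direction_top]
    rw [htop, finrank_top] at hdim
    simp at hdim
  obtain ⟨q, hq, hqp, hxq⟩ := hex
  have hstrict : ∀ r ∈ S, r ≠ p → r ≠ q → dist x p < dist x r := by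
    intro r hr hrp hrq
    refine lt_of_le_of_ne (hxP r hr) fun heq => hrq ?_
    exact bisector_unique hdim hqp hrp (hgen q hq hxq) (hgen r hr heq) hne
  refine ⟨q, ⟨hq, hqp, x, hxq, hstrict⟩, ?_⟩
  apply Set.Subset.antisymm
  · intro y hy
    exact ⟨hFP hy, hgen q hq hxq y hy⟩
  -- From `x` one can move a little away from `y` inside the bisector without leaving the cell. As
  -- `l` is maximal at `x`, it does not increase in this direction, so its value at `y` is at least
  -- that at `x`.
  · rintro y ⟨hyP, hyq⟩
    have hcont : Tendsto (fun t : ℝ => x + t • (x - y)) (𝓝 0) (𝓝 x) := by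
      have : Continuous fun t : ℝ => x + t • (x - y) := by fun_prop
      have h := this.tendsto 0
      simpa using h
    have hev : ∀ᶠ t : ℝ in 𝓝 0, x + t • (x - y) ∈ voronoiCell S p := by
      filter_upwards [hcont.eventually (hS.eventually x p)] with t ht r hr
      by_cases hrp : r = p
      · rw [hrp]
      by_cases hrq : r = q
      · rw [hrq]
        refine le_of_eq ((dist_eq_iff_affine _ p q).2 ?_)
        have e1 := (dist_eq_iff_affine x p q).1 hxq
        have e2 := (dist_eq_iff_affine y p q).1 hyq
        generalize (2 • innerSL ℝ (q - p)).toLinearMap = L at e1 e2 ⊢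
        rw [map_add, map_smul, map_sub, smul_eq_mul]
        linear_combination (1 + t) * e1 - t * e2
      · exact (ht r hr (hstrict r hr hrp hrq)).le
    obtain ⟨ε, hε, hball⟩ := Metric.eventually_nhds_iff.1 hev
    have h1 := hmax _ (hball (y := ε / 2) (by
      rw [Real.dist_eq, sub_zero, abs_of_pos (by positivity)]; linarith))
    rw [map_add, map_smul, map_sub, smul_eq_mul] at h1
    have h2 : l x ≤ l y := by nlinarith
    rw [hl]
    exact ⟨hyP, fun z hz => (hmax z hz).trans h2⟩

/-- A Voronoi cell has at most as many facets as neighbours. -/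
theorem encard_facets_le {S : Set E3} (hS : LocFin S) {p : E3} (hp : p ∈ S) :
    (facets (voronoiCell S p)).encard ≤ {q | NB S p q}.encard := by
  choose! f hf hfe using fun F (hF : F ∈ facets (voronoiCell S p)) =>
    exists_neighbour_of_facet hS hp hF
  refine Set.encard_le_encard_of_injOn (f := f) (fun F hF => hf F hF) ?_
  intro F hF F' hF' heq
  rw [hfe F hF, hfe F' hF', heq]

/-- The second closest site can be made strictly farther than the closest one. -/
theorem NB.exists_strict {S : Set E3} (hS : LocFin S) {p q : E3} (h : NB S p q) :
    ∃ x, dist x q < dist x p ∧ ∀ r ∈ S, r ≠ p → r ≠ q → dist x p < dist x r := by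
  obtain ⟨hq, hqp, x, hxq, hstrict⟩ := h
  have hcont : Tendsto (fun t : ℝ => x + t • (q - p)) (𝓝 0) (𝓝 x) := by
    have : Continuous fun t : ℝ => x + t • (q - p) := by fun_prop
    have h := this.tendsto 0
    simpa using h
  obtain ⟨ε, hε, hball⟩ := Metric.eventually_nhds_iff.1 (hcont.eventually (hS.eventually x p))
  have h1 := hball (y := ε / 2) (by
      rw [Real.dist_eq, sub_zero, abs_of_pos (by positivity)]; linarith)
  refine ⟨x + (ε / 2) • (q - p), ?_, fun r hr hrp hrq => h1 r hr (hstrict r hr hrp hrq)⟩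
  have h2 := sq_dist_sub (x + (ε / 2) • (q - p)) p q
  have h3 := sq_dist_sub x p q
  rw [hxq, sub_self] at h3
  rw [inner_add_right, inner_smul_right, real_inner_self_eq_norm_sq] at h2
  have hpos : 0 < ‖q - p‖ ^ 2 := by
    have : 0 < ‖q - p‖ := norm_pos_iff.2 (sub_ne_zero.2 hqp)
    positivity
  have h4 : 0 < ε / 2 * ‖q - p‖ ^ 2 := by positivity
  refine lt_of_pow_lt_pow_left₀ 2 dist_nonneg ?_
  linarith

end Cubic

namespace Cubic

open Filter Topology

/-! ### Perturbation of the base point -/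

noncomputable def bisL (g h : E3) : E3 →ₗ[ℝ] ℝ := (2 • innerSL ℝ (h - g)).toLinearMap

noncomputable def bisC (g h : E3) : ℝ := ‖g‖ ^ 2 - ‖h‖ ^ 2

theorem bis_apply (g h y : E3) : bisL g h y + bisC g h = dist y g ^ 2 - dist y h ^ 2 := by
  rw [sq_dist_sub]
  simp [bisL, bisC, two_smul, two_mul, inner_sub_left]

/-- A segment from `Ua` to `Ub` contains a point that is equally far from `A` and `B`. For generic
endpoints the segment misses all points that are equidistant from three sites, so this point has
exactly two nearest sites, one in each set. -/
theorem exists_crossing {A B : Set E3} (hA : A.Finite) (hB : B.Finite) (hAn : A.Nonempty)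
    (hBn : B.Nonempty) (hdisj : Disjoint A B) {Ua Ub : Set E3} (hUa : IsOpen Ua) (hUb : IsOpen Ub)
    (hUan : Ua.Nonempty) (hUbn : Ub.Nonempty)
    (ha : ∀ y ∈ Ua, Metric.infDist y A < Metric.infDist y B)
    (hb : ∀ y ∈ Ub, Metric.infDist y B < Metric.infDist y A) :
    ∃ a ∈ Ua, ∃ b ∈ Ub, ∃ x ∈ segment ℝ a b, ∃ α ∈ A, ∃ β ∈ B, dist x α = dist x β ∧
      ∀ z ∈ A ∪ B, z ≠ α → z ≠ β → dist x α < dist x z := by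
  have hZ : (A ∪ B).Finite := hA.union hB
  have : Finite ↑(A ∪ B) := hZ.to_subtype
  let I₂ := {s : ↑(A ∪ B) × ↑(A ∪ B) // (s.1 : E3) ≠ s.2}
  obtain ⟨b, hbU, hbg⟩ := exists_generic (fun s : I₂ => bisL s.1.1 s.1.2)
    (fun s : I₂ => bisC s.1.1 s.1.2) (fun s => by
      refine ⟨(s.1.1 : E3), ?_⟩
      rw [bis_apply, dist_self]
      have : 0 < dist (s.1.1 : E3) s.1.2 := dist_pos.2 s.2
      nlinarith) hUb hUbn
  let I₃ := {s : ↑(A ∪ B) × ↑(A ∪ B) × ↑(A ∪ B) //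
    (s.1 : E3) ≠ s.2.1 ∧ (s.1 : E3) ≠ s.2.2 ∧ (s.2.1 : E3) ≠ s.2.2}
  let f : E3 → E3 → E3 → ℝ := fun g h y => dist y g ^ 2 - dist y h ^ 2
  have hfb : ∀ g ∈ A ∪ B, ∀ h ∈ A ∪ B, g ≠ h → f g h b ≠ 0 := by
    intro g hg h hh hne
    have := hbg ⟨(⟨g, hg⟩, ⟨h, hh⟩), hne⟩
    rwa [bis_apply] at this
  -- With `b` fixed, the segment can meet two bisectors of `g` in the same point only if the
  -- determinant of the values of their affine functions at `a` and `b` vanishes. This determinant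
  -- is an affine function of `a`, to be shown not identically zero.
  obtain ⟨a, haU, hag⟩ := exists_generic
    (fun s : I₃ => f s.1.1 s.1.2.1 b • bisL s.1.1 s.1.2.2 - f s.1.1 s.1.2.2 b • bisL s.1.1 s.1.2.1)
    (fun s : I₃ => f s.1.1 s.1.2.1 b * bisC s.1.1 s.1.2.2 - f s.1.1 s.1.2.2 b * bisC s.1.1 s.1.2.1)
    (fun s => by
      obtain ⟨⟨⟨g, hg⟩, ⟨h, hh⟩, ⟨k, hk⟩⟩, h1, h2, h3⟩ := s
      simp only at h1 h2 h3 ⊢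
      by_contra hcon
      push Not at hcon
      have key : ∀ x, f g h b * f g k x = f g k b * f g h x := by
        intro x
        have e := hcon x
        have e1 := bis_apply g h x
        have e2 := bis_apply g k x
        simp only [LinearMap.sub_apply, LinearMap.smul_apply, smul_eq_mul] at e
        simp only [f] at e ⊢
        rw [← e1, ← e2]
        linear_combination e
      -- If the determinant vanished identically, its values at the three sites would give two
      -- relations of Pythagorean form, with right angles at `k` and at `h`. Together they force the
      -- distance of `h` and `k` to be zero.
      have u0 := hfb g hg h hh h1
      have k1 := key g
      have k2 := key h
      have k3 := key k
      simp only [f, dist_self] at k1 k2 k3 u0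
      rw [dist_comm h g] at k2
      rw [dist_comm k g, dist_comm k h] at k3
      have hR : 0 < dist h k ^ 2 := by
        have := dist_pos.2 h3
        positivity
      set u := dist b g ^ 2 - dist b h ^ 2
      set v := dist b g ^ 2 - dist b k ^ 2
      have e1 : u * (dist g h ^ 2 - dist h k ^ 2 - dist g k ^ 2) = 0 := by linarith
      have e2 := (mul_eq_zero.1 e1).resolve_left u0
      have hv : v ≠ 0 := hfb g hg k hk h2
      have e3 : v * (dist g k ^ 2 - dist h k ^ 2 - dist g h ^ 2) = 0 := by linarith
      have e4 := (mul_eq_zero.1 e3).resolve_left hv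
      linarith) hUa hUan
  -- The difference of the distances to `A` and `B` changes sign along the segment.
  have hcontA : Continuous fun t : ℝ => Metric.infDist (AffineMap.lineMap a b t : E3) A -
      Metric.infDist (AffineMap.lineMap a b t : E3) B := by
    have hl : Continuous fun t : ℝ => (AffineMap.lineMap a b t : E3) := AffineMap.lineMap_continuous
    exact ((Metric.continuous_infDist_pt A).comp hl).sub ((Metric.continuous_infDist_pt B).comp hl)
  have hIVT := intermediate_value_Icc (zero_le_one (α := ℝ)) hcontA.continuousOn
  have h0 : (0 : ℝ) ∈ Set.Icc
      (Metric.infDist (AffineMap.lineMap a b (0 : ℝ) : E3) A -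
        Metric.infDist (AffineMap.lineMap a b (0 : ℝ) : E3) B)
      (Metric.infDist (AffineMap.lineMap a b (1 : ℝ) : E3) A -
        Metric.infDist (AffineMap.lineMap a b (1 : ℝ) : E3) B) := by
    rw [AffineMap.lineMap_apply_zero, AffineMap.lineMap_apply_one]
    have h1 := ha a haU
    have h2 := hb b hbU
    constructor <;> linarith
  obtain ⟨t, ht, hx⟩ := hIVT h0
  simp only at hx
  set x : E3 := AffineMap.lineMap a b t with hxdef
  obtain ⟨α, hα, hαx⟩ := hA.isCompact.exists_infDist_eq_dist hAn x
  obtain ⟨β, hβ, hβx⟩ := hB.isCompact.exists_infDist_eq_dist hBn x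
  have hαβ : dist x α = dist x β := by linarith
  refine ⟨a, haU, b, hbU, x, ?_, α, hα, β, hβ, hαβ, ?_⟩
  · rw [segment_eq_image_lineMap]
    exact ⟨t, ht, rfl⟩
  · intro z hz hzα hzβ
    have hle : dist x α ≤ dist x z := by
      rcases hz with hz | hz
      · rw [← hαx]; exact Metric.infDist_le_dist_of_mem hz
      · rw [hαβ, ← hβx]; exact Metric.infDist_le_dist_of_mem hz
    refine lt_of_le_of_ne hle fun heq => ?_
    have hne : α ≠ β := fun h => Set.disjoint_left.1 hdisj hα (h ▸ hβ)
    have hK := hag ⟨(⟨α, Or.inl hα⟩, ⟨β, Or.inr hβ⟩, ⟨z, hz⟩), hne, hzα.symm, hzβ.symm⟩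
    simp only [LinearMap.sub_apply, LinearMap.smul_apply, smul_eq_mul] at hK
    have hline : ∀ g h : E3, f g h x = (1 - t) * f g h a + t * f g h b := by
      intro g h
      simp only [f]
      rw [← bis_apply, ← bis_apply, ← bis_apply, hxdef, AffineMap.lineMap_apply_module, map_add,
        map_smul, map_smul, smul_eq_mul, smul_eq_mul]
      ring
    have f1 : f α β x = 0 := by simp only [f]; rw [hαβ]; ring
    have f2 : f α z x = 0 := by simp only [f]; rw [heq]; ring
    rw [hline] at f1 f2
    have e1 := bis_apply α β a
    have e2 := bis_apply α z a
    have hK' : f α β b * f α z a - f α z b * f α β a ≠ 0 := by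
      intro h0
      apply hK
      simp only [f] at h0 ⊢
      rw [← e1, ← e2] at h0
      linear_combination h0
    -- Both affine functions vanish at `x`; eliminating their values at `b` leaves the determinant
    -- times `1 - t`. The case `t = 1` is excluded because `b` lies on no bisector.
    have h3 : (1 - t) * (f α β b * f α z a - f α z b * f α β a) = 0 := by
      linear_combination f α β b * f2 - f α z b * f1
    rcases mul_eq_zero.1 h3 with h4 | h4
    · have ht1 : t = 1 := by linarith
      rw [ht1] at f1
      have : f α β b = 0 := by linarith
      exact hfb α (Or.inl hα) β (Or.inr hβ) hne this
    · exact hK' h4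

/-! #### Orbits -/

/-- The set of classes `m` is a subgroup. -/
structure IsMask (m : ℕ) : Prop where
  zero : Nat.testBit m 0 = true
  mul : ∀ i < 16, ∀ j < 16, Nat.testBit m i = true → Nat.testBit m j = true →
    Nat.testBit m (mulC i j) = true
  inv : ∀ i < 16, Nat.testBit m i = true → Nat.testBit m (invC i) = true

/-- The valid operations with class in `m`. -/
def InM (m : ℕ) (o : Op) : Prop := o.Valid ∧ Nat.testBit m o.cls = true

theorem IsMask.one_mem {m : ℕ} (hm : IsMask m) : InM m Op.one :=
  ⟨Op.one_valid, by rw [Op.cls_one]; exact hm.zero⟩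

theorem IsMask.mul_mem {m : ℕ} (hm : IsMask m) {o o' : Op} (h : InM m o) (h' : InM m o') :
    InM m (o.mul o') :=
  ⟨h.1.mul h'.1, by rw [Op.cls_mul h.1 h'.1]; exact hm.mul _ o.cls_lt _ o'.cls_lt h.2 h'.2⟩

theorem IsMask.inv_mem {m : ℕ} (hm : IsMask m) {o : Op} (h : InM m o) : InM m o.inv :=
  ⟨h.1.inv, by rw [Op.cls_inv h.1]; exact hm.inv _ o.cls_lt h.2⟩

def orb (m : ℕ) (p : E3) : Set E3 := {q | ∃ o, InM m o ∧ o.act p = q}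

theorem IsMask.self_mem {m : ℕ} (hm : IsMask m) (p : E3) : p ∈ orb m p :=
  ⟨Op.one, hm.one_mem, Op.one_act p⟩

theorem finite_rows (N : ℤ) : {r : Row | |r.t| ≤ N}.Finite := by
  have : {r : Row | |r.t| ≤ N} ⊆ (fun s : Fin 3 × Bool × ℤ => (⟨s.1, s.2.1, s.2.2⟩ : Row)) ''
      (Set.univ ×ˢ (Set.univ ×ˢ Set.Icc (-N) N)) := by
    rintro ⟨j, n, t⟩ h
    exact ⟨(j, n, t), ⟨trivial, trivial, abs_le.1 h⟩, rfl⟩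
  exact (Set.Finite.image _ (Set.finite_univ.prod (Set.finite_univ.prod (Set.finite_Icc _ _)))).subset
    this

theorem abs_apply_le_norm (x : E3) (i : Fin 3) : |x i| ≤ ‖x‖ := by
  have := PiLp.norm_apply_le x i
  simpa using this

/-- The image of `p` being bounded bounds all translations, and there are finitely many permutations
and signs. Local finiteness of the orbits follows. -/
theorem finite_ops (p x : E3) (r : ℝ) : {o : Op | dist (o.act p) x ≤ r}.Finite := by
  obtain ⟨N, hN⟩ := exists_int_gt (r + ‖x‖ + ‖p‖)
  have key : ∀ o : Op, dist (o.act p) x ≤ r → ∀ i, |(o.row i).t| ≤ N := by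
    intro o ho i
    have h1 : |o.act p i - x i| ≤ r := by
      have := abs_apply_le_norm (o.act p - x) i
      rw [← dist_eq_norm] at this
      exact this.trans ho
    rw [Op.act_apply] at h1
    have h2 := abs_apply_le_norm x i
    have h3 := abs_apply_le_norm p (o.row i).j
    have h4 : (((o.row i).t : ℤ) : ℝ) = ((o.row i).eval p - x i) + x i -
        (bif (o.row i).neg then -p (o.row i).j else p (o.row i).j) := by
      unfold Row.eval; ring
    have h5 : |(bif (o.row i).neg then -p (o.row i).j else p (o.row i).j)| = |p (o.row i).j| := by
      cases (o.row i).neg <;> simp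
    have h6 : |(((o.row i).t : ℤ) : ℝ)| ≤ N := by
      rw [h4]
      calc _ ≤ |((o.row i).eval p - x i) + x i| +
            |(bif (o.row i).neg then -p (o.row i).j else p (o.row i).j)| := abs_sub _ _
        _ ≤ |(o.row i).eval p - x i| + |x i| + |p (o.row i).j| := by
            rw [h5]; gcongr; exact abs_add_le _ _
        _ ≤ N := by linarith
    exact_mod_cast h6
  have hsub : {o : Op | dist (o.act p) x ≤ r} ⊆
      (fun s : Row × Row × Row => (⟨s.1, s.2.1, s.2.2⟩ : Op)) ''
        ({r : Row | |r.t| ≤ N} ×ˢ ({r : Row | |r.t| ≤ N} ×ˢ {r : Row | |r.t| ≤ N})) := by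
    intro o ho
    exact ⟨(o.r0, o.r1, o.r2), ⟨key o ho 0, key o ho 1, key o ho 2⟩, rfl⟩
  exact (Set.Finite.image _ ((finite_rows N).prod ((finite_rows N).prod (finite_rows N)))).subset hsub

theorem locFin_orb (m : ℕ) (p : E3) : LocFin (orb m p) := by
  intro x r
  refine ((finite_ops p x r).image fun o => o.act p).subset ?_
  rintro _ ⟨⟨o, -, rfl⟩, hr⟩
  exact ⟨o, hr, rfl⟩

instance : Countable Op := by
  refine Function.Injective.countable
    (f := fun o : Op => ((o.r0.j, o.r0.neg, o.r0.t), (o.r1.j, o.r1.neg, o.r1.t),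
      (o.r2.j, o.r2.neg, o.r2.t))) ?_
  rintro ⟨⟨a, b, c⟩, ⟨d, e, f⟩, ⟨g, h, i⟩⟩ ⟨⟨a', b', c'⟩, ⟨d', e', f'⟩, ⟨g', h', i'⟩⟩ heq
  simp only [Prod.mk.injEq] at heq
  simp only [Op.mk.injEq, Row.mk.injEq]
  tauto

/-- In every nonempty open set there is a point that is fixed by the identity only. -/
theorem exists_trivial_stabilizer {U : Set E3} (hU : IsOpen U) (hne : U.Nonempty) :
    ∃ p ∈ U, ∀ g : Op, g.act p = p → g = Op.one := by
  have hex : ∀ g : {g : Op // g ≠ Op.one}, ∃ (i : Fin 3) (x : E3), (g : Op).act x i ≠ x i := by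
    rintro ⟨g, hg⟩
    by_contra hcon
    push Not at hcon
    refine hg (Op.ext_act fun x => ?_)
    rw [Op.one_act]
    ext i
    exact hcon i x
  choose i x hx using hex
  let L : {g : Op // g ≠ Op.one} → E3 →ₗ[ℝ] ℝ := fun g =>
    ((bif ((g : Op).row (i g)).neg then (-1 : ℝ) else 1) •
      EuclideanSpace.proj (𝕜 := ℝ) ((g : Op).row (i g)).j - EuclideanSpace.proj (i g)).toLinearMap
  have hL : ∀ g y, L g y + (((g : Op).row (i g)).t : ℝ) = (g : Op).act y (i g) - y (i g) := by
    intro g y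
    rw [Op.act_apply, Row.eval_eq_mul]
    simp [L]
    ring
  obtain ⟨p, hp, hgen⟩ := exists_generic L (fun g => (((g : Op).row (i g)).t : ℝ))
    (fun g => ⟨x g, by rw [hL]; exact sub_ne_zero.2 (hx g)⟩) hU hne
  refine ⟨p, hp, fun g hg => ?_⟩
  by_contra hne
  have := hgen ⟨g, hne⟩
  rw [hL] at this
  simp only at this
  rw [hg, sub_self] at this
  exact this rfl

end Cubic

namespace Cubic

open Filter Topology

/-! ### Neighbours of special points as limits of neighbours of generic points -/

theorem LocFin.gap {S : Set E3} (hS : LocFin S) (x : E3) (R : ℝ) :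
    ∃ η > 0, ∀ r ∈ S, R < dist x r → R + η ≤ dist x r := by
  have h1 : ∀ᶠ η in 𝓝[>] (0 : ℝ), ∀ r ∈ S ∩ Metric.closedBall x (R + 1), R < dist x r →
      R + η ≤ dist x r := by
    rw [eventually_all_finite (hS x (R + 1))]
    intro r _
    by_cases h : R < dist x r
    · filter_upwards [nhdsWithin_le_nhds (eventually_le_nhds (sub_pos.2 h))] with η hη _
      linarith
    · exact Eventually.of_forall fun η h' => absurd h' h
  have h2 : ∀ᶠ η in 𝓝[>] (0 : ℝ), η ≤ 1 := nhdsWithin_le_nhds (eventually_le_nhds one_pos)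
  obtain ⟨η, ⟨hη, hη1⟩, hη0⟩ := ((h1.and h2).and self_mem_nhdsWithin).exists
  refine ⟨η, hη0, fun r hr hlt => ?_⟩
  by_cases h : dist x r ≤ R + 1
  · exact hη r ⟨hr, by rwa [Metric.mem_closedBall, dist_comm]⟩ hlt
  · linarith

theorem exists_near_closer {x p q : E3} (hqp : q ≠ p) (h : dist x p = dist x q) {δ : ℝ}
    (hδ : 0 < δ) : ∃ y ∈ Metric.ball x δ, dist y q < dist y p := by
  have hcont : Tendsto (fun t : ℝ => x + t • (q - p)) (𝓝 0) (𝓝 x) := by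
    have : Continuous fun t : ℝ => x + t • (q - p) := by fun_prop
    have h := this.tendsto 0
    simpa using h
  obtain ⟨ε, hε, hball⟩ := Metric.eventually_nhds_iff.1 (hcont.eventually (Metric.ball_mem_nhds x hδ))
  have h1 := hball (y := ε / 2) (by
      rw [Real.dist_eq, sub_zero, abs_of_pos (by positivity)]; linarith)
  refine ⟨x + (ε / 2) • (q - p), h1, ?_⟩
  have h2 := sq_dist_sub (x + (ε / 2) • (q - p)) p q
  have h3 := sq_dist_sub x p q
  rw [h, sub_self] at h3
  rw [inner_add_right, inner_smul_right, real_inner_self_eq_norm_sq] at h2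
  have hpos : 0 < ‖q - p‖ ^ 2 := by
    have : 0 < ‖q - p‖ := norm_pos_iff.2 (sub_ne_zero.2 hqp)
    positivity
  have h4 : 0 < ε / 2 * ‖q - p‖ ^ 2 := by positivity
  refine lt_of_pow_lt_pow_left₀ 2 dist_nonneg ?_
  linarith

theorem infDist_lt_infDist {A B : Set E3} {y a₀ p q : E3} {κ : ℝ} (hκ : 0 < κ)
    (hgap : dist a₀ p + κ = dist a₀ q) (hy : dist y a₀ < κ / 8)
    (hA : ∀ z ∈ A, dist z p < κ / 8) (hAn : A.Nonempty) (hB : ∀ z ∈ B, dist z q < κ / 8)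
    (hBn : B.Nonempty) : Metric.infDist y A < Metric.infDist y B := by
  obtain ⟨a, ha⟩ := hAn
  have h1 : Metric.infDist y A ≤ dist y a := Metric.infDist_le_dist_of_mem ha
  have h2 : dist a₀ q - κ / 4 ≤ Metric.infDist y B := by
    rw [Metric.le_infDist hBn]
    intro b hb
    have h3 := dist_triangle4 a₀ y b q
    have h4 := hB b hb
    rw [dist_comm a₀ y] at h3
    linarith
  have h5 := dist_triangle4 y a₀ p a
  have h6 := hA a ha
  rw [dist_comm a p] at h6
  linarith

/-- Every neighbour of `p` is the limit of neighbours of generic points. -/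
theorem NB.perturb {m : ℕ} (hm : IsMask m) {C : Set E3} (hC : Convex ℝ C)
    (hCi : (interior C).Nonempty) {p q : E3} (hp : p ∈ C) (h : NB (orb m p) p q) :
    ∃ p' ∈ C, ∃ s k : Op, InM m s ∧ InM m k ∧ s.act p = p ∧ q = (s.mul k).act p ∧
      (∀ g : Op, g.act p' = p' → g = Op.one) ∧ NB (orb m p') p' (k.act p') := by
  obtain ⟨⟨g₀, hg₀, hg₀q⟩, hqp, x, hxq, hstrict⟩ := h
  obtain ⟨η, hη, hgap⟩ := (locFin_orb m p).gap x (dist x p)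
  obtain ⟨a₀, ha₀, ha₀lt⟩ := exists_near_closer hqp.symm hxq.symm (by positivity : 0 < η / 8)
  obtain ⟨b₀, hb₀, hb₀lt⟩ := exists_near_closer hqp hxq (by positivity : 0 < η / 8)
  set κa := dist a₀ q - dist a₀ p with hκa
  set κb := dist b₀ p - dist b₀ q with hκb
  have hκa0 : 0 < κa := sub_pos.2 ha₀lt
  have hκb0 : 0 < κb := sub_pos.2 hb₀lt
  set ρ := min (η / 8) (min (κa / 8) (κb / 8)) with hρ
  have hρ0 : 0 < ρ := by positivity
  have hρ1 : ρ ≤ η / 8 := min_le_left _ _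
  have hρ2 : ρ ≤ κa / 8 := (min_le_right _ _).trans (min_le_left _ _)
  have hρ3 : ρ ≤ κb / 8 := (min_le_right _ _).trans (min_le_right _ _)
  have hpc : p ∈ closure (interior C) := by
    rw [hC.closure_interior_eq_closure_of_nonempty_interior hCi]
    exact subset_closure hp
  obtain ⟨p', ⟨hp'i, hp'b⟩, hp'g⟩ := exists_trivial_stabilizer
    (isOpen_interior.inter (Metric.isOpen_ball (x := p) (ε := ρ)))
    (by
      obtain ⟨y, hy, hyd⟩ := Metric.mem_closure_iff.1 hpc ρ hρ0
      exact ⟨y, hy, by rwa [Metric.mem_ball, dist_comm]⟩)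
  have hdisp : ∀ g : Op, g.Valid → dist (g.act p') (g.act p) < ρ := fun g hg => by
    rw [Op.dist_act hg.1]; exact hp'b
  have hinj : ∀ g h : Op, g.Valid → h.Valid → g.act p' = h.act p' → g.act p = h.act p := by
    intro g h hg hh heq
    have h1 : (g.inv.mul h).act p' = p' := by rw [Op.mul_act, ← heq, hg.1.inv_act]
    have h2 := hp'g _ h1
    have h3 : g.act ((g.inv.mul h).act p) = h.act p := by rw [Op.mul_act, hg.1.act_inv]
    rwa [h2, Op.one_act] at h3
  -- After the perturbation the site `p` splits into the cluster `A` and the site `q` into the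
  -- cluster `B`, each within `ρ` of the old site. All other sites remain farther away by the gap
  -- `η`.
  let A : Set E3 := {z | ∃ g, InM m g ∧ g.act p = p ∧ g.act p' = z}
  let B : Set E3 := {z | ∃ g, InM m g ∧ g.act p = q ∧ g.act p' = z}
  have hAd : ∀ z ∈ A, dist z p < ρ := by
    rintro _ ⟨g, hg, hgp, rfl⟩
    have := hdisp g hg.1
    rwa [hgp] at this
  have hBd : ∀ z ∈ B, dist z q < ρ := by
    rintro _ ⟨g, hg, hgp, rfl⟩
    have := hdisp g hg.1
    rwa [hgp] at this
  have hAn : A.Nonempty := ⟨_, Op.one, hm.one_mem, Op.one_act p, rfl⟩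
  have hBn : B.Nonempty := ⟨_, g₀, hg₀, hg₀q, rfl⟩
  have hAf : A.Finite := by
    refine (locFin_orb m p' p ρ).subset fun z hz => ⟨?_, (hAd z hz).le⟩
    obtain ⟨g, hg, -, rfl⟩ := hz
    exact ⟨g, hg, rfl⟩
  have hBf : B.Finite := by
    refine (locFin_orb m p' q ρ).subset fun z hz => ⟨?_, (hBd z hz).le⟩
    obtain ⟨g, hg, -, rfl⟩ := hz
    exact ⟨g, hg, rfl⟩
  have hdisj : Disjoint A B := by
    rw [Set.disjoint_left]
    rintro z ⟨g, hg, hgp, rfl⟩ ⟨h, hh, hhp, heq⟩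
    have := hinj h g hh.1 hg.1 heq
    rw [hgp, hhp] at this
    exact hqp this
  obtain ⟨a, ha, b, hb, x', hx', α, ⟨g₁, hg₁, hg₁p, rfl⟩, β, ⟨g₂, hg₂, hg₂q, rfl⟩, heq, hfar⟩ :=
    exists_crossing hAf hBf hAn hBn hdisj
      (Ua := Metric.ball a₀ (κa / 8) ∩ Metric.ball x (η / 8))
      (Ub := Metric.ball b₀ (κb / 8) ∩ Metric.ball x (η / 8))
      (Metric.isOpen_ball.inter Metric.isOpen_ball) (Metric.isOpen_ball.inter Metric.isOpen_ball)
      ⟨a₀, Metric.mem_ball_self (by positivity), ha₀⟩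
      ⟨b₀, Metric.mem_ball_self (by positivity), hb₀⟩
      (fun y hy => infDist_lt_infDist hκa0 (by rw [hκa]; ring) hy.1
        (fun z hz => (hAd z hz).trans_le hρ2) hAn (fun z hz => (hBd z hz).trans_le hρ2) hBn)
      (fun y hy => infDist_lt_infDist hκb0 (by rw [hκb]; ring) hy.1
        (fun z hz => (hBd z hz).trans_le hρ3) hBn (fun z hz => (hAd z hz).trans_le hρ3) hAn)
  have hx'b : dist x' x < η / 8 :=
    (convex_ball x (η / 8)).segment_subset ha.2 hb.2 hx'
  -- The crossing point has nearest sites `g₁ p'` and `g₂ p'`. Applying the inverse of `g₁` makes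
  -- `p'` itself one of them, with neighbour `k p'` for `k = g₁⁻¹ g₂`; the operation `g₁` fixes `p`
  -- and plays the part of `s`.
  refine ⟨p', interior_subset hp'i, g₁, g₁.inv.mul g₂, hg₁, hm.mul_mem (hm.inv_mem hg₁) hg₂, hg₁p,
    ?_, hp'g, ⟨_, hm.mul_mem (hm.inv_mem hg₁) hg₂, rfl⟩, ?_, g₁.inv.act x', ?_, ?_⟩
  · rw [Op.mul_act, Op.mul_act, hg₁.1.1.act_inv, hg₂q]
  · intro hcon
    rw [Op.mul_act] at hcon
    have h1 : g₂.act p' = g₁.act p' := by rw [← hg₁.1.1.act_inv (g₂.act p'), hcon]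
    have h2 := hinj _ _ hg₂.1 hg₁.1 h1
    rw [hg₁p, hg₂q] at h2
    exact hqp h2
  · rw [Op.dist_inv_act hg₁.1.1, Op.dist_inv_act hg₁.1.1, Op.mul_act, hg₁.1.1.act_inv, heq]
  · rintro _ ⟨o, ho, rfl⟩ h1 h2
    rw [Op.dist_inv_act hg₁.1.1, Op.dist_inv_act hg₁.1.1, ← Op.mul_act]
    have hmem := hm.mul_mem hg₁ ho
    have n1 : (g₁.mul o).act p' ≠ g₁.act p' := fun e => h1 (by
      rw [Op.mul_act] at e; exact Op.act_inj hg₁.1.1 e)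
    have n2 : (g₁.mul o).act p' ≠ g₂.act p' := fun e => h2 (by
      rw [Op.mul_act g₁.inv, ← e, Op.mul_act, hg₁.1.1.inv_act])
    by_cases c1 : (g₁.mul o).act p = p
    · exact hfar _ (Or.inl ⟨_, hmem, c1, rfl⟩) n1 n2
    by_cases c2 : (g₁.mul o).act p = q
    · exact hfar _ (Or.inr ⟨_, hmem, c2, rfl⟩) n1 n2
    -- Sites outside both clusters: `x'`, the cluster point and the perturbed site are each
    -- displaced by less than `η / 8`, four displacements in all, which is less than the gap `η`.
    have h3 := hgap _ ⟨_, hmem, rfl⟩ (hstrict _ ⟨_, hmem, rfl⟩ c1 c2)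
    have h4 := hdisp _ hmem.1
    have h5 := dist_triangle4 x x' ((g₁.mul o).act p') ((g₁.mul o).act p)
    have h6 := hdisp _ hg₁.1
    rw [hg₁p] at h6
    have h7 := dist_triangle4 x' x p (g₁.act p')
    rw [dist_comm x x'] at h5
    rw [dist_comm (g₁.act p') p] at h6
    linarith

end Cubic

namespace Cubic

/-! ### Counting neighbours -/

theorem filter_mem_facesOf (P : Pt → Bool) :
    ∀ l : List Pt, l.filter P ≠ [] → l.filter P ∈ facesOf l
  | [], h => absurd rfl h
  | a :: l, h => by
    have ih := filter_mem_facesOf P l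
    rw [facesOf]
    by_cases ha : P a = true
    · rw [List.filter_cons_of_pos ha]
      by_cases hl : l.filter P = []
      · rw [hl]; exact List.mem_cons_self
      · exact List.mem_cons_of_mem _ (List.mem_append_right _ (List.mem_map.2 ⟨_, ih hl, rfl⟩))
    · rw [List.filter_cons_of_neg ha] at h ⊢
      exact List.mem_cons_of_mem _ (List.mem_append_left _ (ih h))

theorem InFace.ne_nil {Φ : List Pt} {p : E3} (h : InFace Φ p) : Φ ≠ [] := by
  rintro rfl
  obtain ⟨w, -, h1, -⟩ := h
  simp at h1

/-- The four barycentric coordinates as a function on points; only the values at the vertices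
matter. -/
def weight (a b c d : ℝ) (A B C : Pt) (v : Pt) : ℝ :=
  if v = A then a else if v = B then b else if v = C then c else d

theorem exists_face1 {p : E3} (h0 : 0 ≤ p 2) (h1 : p 2 ≤ p 1) (h2 : p 1 - p 2 ≤ p 0 - p 1)
    (h3 : p 0 + p 2 ≤ 1) : ∃ Φ ∈ faces1, InFace Φ p := by
  have h := mem_faces_of_weights (Φ := [⟨0, 0, 0⟩, ⟨12, 0, 0⟩, ⟨6, 6, 6⟩, ⟨12, 6, 0⟩]) (p := p)
    (weight (1 - p 0 - p 2) (p 0 - p 1 - (p 1 - p 2)) (2 * p 2) (2 * (p 1 - p 2)) ⟨0, 0, 0⟩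
      ⟨12, 0, 0⟩ ⟨6, 6, 6⟩)
    (by
      intro d hd
      simp only [List.mem_cons, List.not_mem_nil, or_false] at hd
      rcases hd with rfl | rfl | rfl | rfl <;> simp [weight] <;> linarith)
    (by simp [weight]; ring)
    (by intro i; fin_cases i <;> simp [weight] <;> ring)
  exact ⟨_, filter_mem_facesOf _ _ h.ne_nil, h⟩

theorem exists_face2 {p : E3} (h0 : 0 ≤ p 2) (h1 : p 1 ≤ p 0) (h2 : p 0 - p 1 < p 1 - p 2)
    (h3 : p 0 + p 2 ≤ 1) : ∃ Φ ∈ faces2, InFace Φ p := by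
  have h := mem_faces_of_weights (Φ := [⟨12, 12, 0⟩, ⟨0, 0, 0⟩, ⟨6, 6, 6⟩, ⟨12, 6, 0⟩]) (p := p)
    (weight (1 - p 0 - p 2) (p 1 - p 2 - (p 0 - p 1)) (2 * p 2) (2 * (p 0 - p 1)) ⟨0, 0, 0⟩
      ⟨12, 12, 0⟩ ⟨6, 6, 6⟩)
    (by
      intro d hd
      simp only [List.mem_cons, List.not_mem_nil, or_false] at hd
      rcases hd with rfl | rfl | rfl | rfl <;> simp [weight] <;> linarith)
    (by simp [weight]; ring)
    (by intro i; fin_cases i <;> simp [weight] <;> ring)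
  refine ⟨_, ?_, h⟩
  rw [List.filter_cons_of_pos (by simp [weight]; linarith), faces2]
  by_cases hl : ([⟨0, 0, 0⟩, ⟨6, 6, 6⟩, ⟨12, 6, 0⟩] : List Pt).filter (fun d => decide (0 <
    weight (1 - p 0 - p 2) (p 1 - p 2 - (p 0 - p 1)) (2 * p 2) (2 * (p 0 - p 1)) ⟨0, 0, 0⟩
      ⟨12, 12, 0⟩ ⟨6, 6, 6⟩ d)) = []
  · rw [hl]; exact List.mem_cons_self
  · exact List.mem_cons_of_mem _ (List.mem_map.2 ⟨_, filter_mem_facesOf _ _ hl, rfl⟩)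

theorem faces1_bdd : ∀ Φ ∈ faces1, ∀ d ∈ Φ, d.Bdd := by decide

theorem faces2_bdd : ∀ Φ ∈ faces2, ∀ d ∈ Φ, d.Bdd := by decide

theorem convex_full_ineq :
    Convex ℝ {p : E3 | 0 ≤ p 2 ∧ p 2 ≤ p 1 ∧ p 1 ≤ p 0 ∧ p 0 + p 2 ≤ 1} := by
  intro x hx y hy a b ha hb hab
  simp only [Set.mem_ofPred_eq, PiLp.add_apply, PiLp.smul_apply, smul_eq_mul] at hx hy ⊢
  obtain ⟨x0, x1, x2, x3⟩ := hx
  obtain ⟨y0, y1, y2, y3⟩ := hy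
  refine ⟨?_, ?_, ?_, ?_⟩
  · positivity
  · nlinarith
  · nlinarith
  · nlinarith

theorem hull_subset_full {D : Simplex} (h : ∀ d ∈ D.verts, d.z ≤ d.y ∧ d.y ≤ d.x ∧ d.x + d.z ≤ 12) :
    D.hull ⊆ full.hull := by
  refine (Simplex.hull_subset convex_full_ineq fun d hd => ?_).trans
    fun p hp => mem_full hp.1 hp.2.1 hp.2.2.1 hp.2.2.2
  obtain ⟨h1, h2, h3⟩ := h d hd
  have h1' : (d.z : ℝ) ≤ d.y := by exact_mod_cast h1
  have h2' : (d.y : ℝ) ≤ d.x := by exact_mod_cast h2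
  have h3' : (d.x : ℝ) + d.z ≤ 12 := by exact_mod_cast h3
  simp only [Set.mem_ofPred_eq, Pt.toE_apply, Pt.get_zero, Pt.get_one, Pt.get_two]
  refine ⟨by positivity, ?_, ?_, ?_⟩ <;> linarith

theorem half1_subset : half1.hull ⊆ full.hull := hull_subset_full (by decide)

theorem half2_subset : half2.hull ⊆ full.hull := hull_subset_full (by decide)

theorem isOpen_ineq (f : E3 → ℝ) (hf : Continuous f) : IsOpen {p : E3 | 0 < f p} :=
  isOpen_lt continuous_const hf

theorem half1_interior : (interior half1.hull).Nonempty := by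
  have ho : IsOpen {p : E3 | 0 < p 2 ∧ 0 < p 1 - p 2 ∧ 0 < p 0 - p 1 - (p 1 - p 2) ∧
      0 < 1 - (p 0 + p 2)} :=
    (isOpen_ineq _ (by fun_prop)).inter ((isOpen_ineq _ (by fun_prop)).inter
      ((isOpen_ineq _ (by fun_prop)).inter (isOpen_ineq _ (by fun_prop))))
  refine ⟨!₂[(0.7 : ℝ), 0.3, 0.1], mem_interior.2 ⟨_, fun p hp => ?_, ho, ?_⟩⟩
  · obtain ⟨h0, h1, h2, h3⟩ := hp
    exact mem_half1 h0.le (by linarith) (by linarith) (by linarith)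
  · simp; norm_num

theorem half2_interior : (interior half2.hull).Nonempty := by
  have ho : IsOpen {p : E3 | 0 < p 2 ∧ 0 < p 0 - p 1 ∧ 0 < p 1 - p 2 - (p 0 - p 1) ∧
      0 < 1 - (p 0 + p 2)} :=
    (isOpen_ineq _ (by fun_prop)).inter ((isOpen_ineq _ (by fun_prop)).inter
      ((isOpen_ineq _ (by fun_prop)).inter (isOpen_ineq _ (by fun_prop))))
  refine ⟨!₂[(0.7 : ℝ), 0.6, 0.1], mem_interior.2 ⟨_, fun p hp => ?_, ho, ?_⟩⟩
  · obtain ⟨h0, h1, h2, h3⟩ := hp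
    exact mem_half2 h0.le (by linarith) (by linarith) (by linarith)
  · simp; norm_num

theorem splitPieces_bdd : ∀ D ∈ splitPieces, ∀ d ∈ D.verts, d.Bdd := by decide

theorem splitPieces_subset :
    ∀ D ∈ splitPieces, ∀ d ∈ D.verts, d.z ≤ d.y ∧ d.y ≤ d.x ∧ d.x + d.z ≤ 12 := by decide

theorem exists_splitPiece {p : E3} (h0 : 0 ≤ p 2) (h1 : p 2 ≤ p 1) (h2 : p 1 ≤ p 0)
    (h3 : p 0 + p 2 ≤ 1) : ∃ D ∈ splitPieces, p ∈ D.hull := by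
  simp only [splitPieces, List.mem_cons, List.not_mem_nil, or_false, exists_eq_or_imp,
    exists_eq_left]
  rcases le_total (p 1 - p 2) (p 0 - p 1) with h | h
  · rcases le_total (p 0 - p 1 - (p 1 - p 2)) (2 * p 2) with h' | h'
    · refine Or.inl (Simplex.mem_hull _ ![1 - p 0 - p 2, 2 * (p 0 - p 1 - (p 1 - p 2)),
        2 * p 2 - (p 0 - p 1 - (p 1 - p 2)), 2 * (p 1 - p 2)] ?_ ?_ ?_)
      · intro i; fin_cases i <;> simp <;> linarith
      · simp [Fin.sum_univ_four]; ring
      · intro i; fin_cases i <;> simp <;> ring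
    · refine Or.inr (Or.inl (Simplex.mem_hull _ ![1 - p 0 - p 2,
        p 0 - p 1 - (p 1 - p 2) - 2 * p 2, 4 * p 2, 2 * (p 1 - p 2)] ?_ ?_ ?_))
      · intro i; fin_cases i <;> simp <;> linarith
      · simp [Fin.sum_univ_four]; ring
      · intro i; fin_cases i <;> simp <;> ring
  · rcases le_total (p 1 - p 2 - (p 0 - p 1)) (2 * (1 - p 0 - p 2)) with h' | h'
    · refine Or.inr (Or.inr (Or.inl (Simplex.mem_hull _
        ![1 - p 0 - p 2 - (p 1 - p 2 - (p 0 - p 1)) / 2, 3 / 2 * (p 1 - p 2 - (p 0 - p 1)), 2 * p 2,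
          2 * (p 0 - p 1)] ?_ ?_ ?_)))
      · intro i; fin_cases i <;> simp <;> linarith
      · simp [Fin.sum_univ_four]; ring
      · intro i; fin_cases i <;> simp <;> ring
    · rcases le_total (p 1 - p 2 - (p 0 - p 1) - 2 * (1 - p 0 - p 2)) (2 * p 2) with h'' | h''
      · refine Or.inr (Or.inr (Or.inr (Or.inl (Simplex.mem_hull _
          ![3 * (1 - p 0 - p 2), 2 * (p 1 - p 2 - (p 0 - p 1) - 2 * (1 - p 0 - p 2)),
            2 * p 2 - (p 1 - p 2 - (p 0 - p 1) - 2 * (1 - p 0 - p 2)), 2 * (p 0 - p 1)] ?_ ?_ ?_))))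
        · intro i; fin_cases i <;> simp <;> linarith
        · simp [Fin.sum_univ_four]; ring
        · intro i; fin_cases i <;> simp <;> ring
      · refine Or.inr (Or.inr (Or.inr (Or.inr (Simplex.mem_hull _
          ![3 * (1 - p 0 - p 2), (p 1 - p 2 - (p 0 - p 1) - 2 * (1 - p 0 - p 2)) - 2 * p 2,
            4 * p 2, 2 * (p 0 - p 1)] ?_ ?_ ?_))))
        · intro i; fin_cases i <;> simp <;> linarith
        · simp [Fin.sum_univ_four]; ring
        · intro i; fin_cases i <;> simp <;> ring

theorem NB.mem_candidates {m : ℕ} (hm : IsMask m) {D : Simplex} (hD : D.Bdd)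
    (hDf : D.hull ⊆ full.hull) {p : E3} (hp : p ∈ D.hull)
    (hs : ∀ g, InM m g → g.act p = p → g = Op.one) {k : Op} (hk : InM m k)
    (h : NB (orb m p) p (k.act p)) : k ∈ candidates (tables D) m := by
  obtain ⟨x, h1, h2⟩ := h.exists_strict (locFin_orb m p)
  refine Cubic.mem_candidates hD hDf hm.zero hp hk.1 hk.2 h1 fun g hg hgm hg1 hgk => ?_
  have hgM : InM m g := ⟨hg, hgm⟩
  refine h2 _ ⟨g, hgM, rfl⟩ (fun e => hg1 (hs g hgM e)) fun e => hgk ?_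
  have h3 : (k.inv.mul g).act p = p := by rw [Op.mul_act, e, hk.1.1.inv_act]
  have h4 := hs _ (hm.mul_mem (hm.inv_mem hk) hgM) h3
  have h5 : k.mul (k.inv.mul g) = g := by rw [← Op.mul_assoc, hk.1.1.mul_inv, Op.one_mul]
  rw [← h5, h4, Op.mul_one]

theorem encard_NB_le_of_mem {m : ℕ} (hm : IsMask m) {D : Simplex} (hD : D.Bdd)
    (hDf : D.hull ⊆ full.hull) {p : E3} (hp : p ∈ D.hull)
    (hs : ∀ g, InM m g → g.act p = p → g = Op.one) {n : ℕ}
    (hn : (candidates (tables D) m).length ≤ n) : {q | NB (orb m p) p q}.encard ≤ n := by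
  have h := encard_le_length (Q := {q | NB (orb m p) p q})
    (L := (candidates (tables D) m).map fun k => k.act p) (by
      intro q hq
      obtain ⟨k, hk, rfl⟩ := hq.1
      exact List.mem_map.2 ⟨k, NB.mem_candidates hm hD hDf hp hs hk hq, rfl⟩)
  rw [List.length_map] at h
  exact h.trans (by exact_mod_cast hn)

/-- Perturbation stays inside the half `D`, so the candidates for `D` apply to the generic point
`p'`, while the factor `s` lies among the fixers of the face of `p`. -/
theorem encard_NB_le_of_face {m : ℕ} (hm : IsMask m) {D : Simplex} (hD : D.Bdd)
    (hDf : D.hull ⊆ full.hull) (hDi : (interior D.hull).Nonempty) {p : E3} (hp : p ∈ D.hull)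
    {Φ : List Pt} (hΦ : ∀ d ∈ Φ, d.Bdd) (hok : fixersOk Φ = true) (hpΦ : InFace Φ p)
    (him : imagesOk Φ (inMask m (fixers Φ)) (candidates (tables D) m) = true) :
    {q | NB (orb m p) p q}.encard ≤ 25 := by
  refine encard_images_le hΦ him hpΦ (fun h => h.2.1 rfl) fun q hq => ?_
  obtain ⟨p', hp', s, k, hs, hk, hsp, hqe, htriv, hnb⟩ :=
    NB.perturb hm (convex_convexHull ℝ _) hDi hp hq
  refine ⟨s, List.mem_filter.2 ⟨mem_fixers hΦ hok hs.1 hpΦ (full_bounds (hDf hp)) hsp, hs.2⟩, k,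
    NB.mem_candidates hm hD hDf hp' (fun g _ => htriv g) hk hnb, hqe⟩

/-- A base point in the fundamental simplex. -/
def InFund (p : E3) : Prop := 0 ≤ p 2 ∧ p 2 ≤ p 1 ∧ p 1 ≤ p 0 ∧ p 0 + p 2 ≤ 1

theorem boundsOk_iff {Φs : List (List Pt)} {D : Simplex} {b : ℕ × ℕ} :
    boundsOk (withFixers Φs) (tables D) b = true ↔ (candidates (tables D) b.1).length ≤ b.2 ∧
      ∀ Φ ∈ Φs, imagesOk Φ (inMask b.1 (fixers Φ)) (candidates (tables D) b.1) = true := by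
  generalize tables D = T
  rw [boundsOk, Bool.and_eq_true, Nat.ble_eq, List.all_eq_true, withFixers, List.forall_mem_map]

theorem encard_NB_le {b : ℕ × ℕ} (hb : b ∈ maskBounds) (hm : IsMask b.1) {p : E3} (hp : InFund p)
    (hs : ∀ g, InM b.1 g → g.act p = p → g = Op.one) : {q | NB (orb b.1 p) p q}.encard ≤ b.2 := by
  obtain ⟨h0, h1, h2, h3⟩ := hp
  rcases le_total (p 1 - p 2) (p 0 - p 1) with h | h
  · exact encard_NB_le_of_mem hm half1_bdd half1_subset (mem_half1 h0 h1 h h3) hs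
      (boundsOk_iff.1 (List.all_eq_true.1 bounds_ok1 b hb)).1
  · exact encard_NB_le_of_mem hm half2_bdd half2_subset (mem_half2 h0 h2 h h3) hs
      (boundsOk_iff.1 (List.all_eq_true.1 bounds_ok2 b hb)).1

theorem encard_NB_le_twentyfive {b : ℕ × ℕ} (hb : b ∈ maskBounds) (hm : IsMask b.1) {p : E3}
    (hp : InFund p) : {q | NB (orb b.1 p) p q}.encard ≤ 25 := by
  obtain ⟨h0, h1, h2, h3⟩ := hp
  rcases le_or_gt (p 1 - p 2) (p 0 - p 1) with h | h
  · obtain ⟨Φ, hΦ, hpΦ⟩ := exists_face1 h0 h1 h h3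
    exact encard_NB_le_of_face hm half1_bdd half1_subset half1_interior (mem_half1 h0 h1 h h3)
      (faces1_bdd Φ hΦ) (List.all_eq_true.1 fixers_ok1 Φ hΦ) hpΦ
      ((boundsOk_iff.1 (List.all_eq_true.1 bounds_ok1 b hb)).2 Φ hΦ)
  · obtain ⟨Φ, hΦ, hpΦ⟩ := exists_face2 h0 h2 h h3
    exact encard_NB_le_of_face hm half2_bdd half2_subset half2_interior (mem_half2 h0 h2 h.le h3)
      (faces2_bdd Φ hΦ) (List.all_eq_true.1 fixers_ok2 Φ hΦ) hpΦ
      ((boundsOk_iff.1 (List.all_eq_true.1 bounds_ok2 b hb)).2 Φ hΦ)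

theorem splitOk_iff {D : Simplex} : splitOk D = true ↔
    (candidates (tables D) 8193).length ≤ 17 ∧ (candidates (tables D) 32769).length ≤ 17 := by
  generalize hT : tables D = T
  rw [splitOk, Bool.and_eq_true, Nat.ble_eq, Nat.ble_eq, hT]

theorem encard_NB_le_seventeen {m : ℕ} (h : m = 8193 ∨ m = 32769) (hm : IsMask m) {p : E3}
    (hp : InFund p) (hs : ∀ g, InM m g → g.act p = p → g = Op.one) :
    {q | NB (orb m p) p q}.encard ≤ (17 : ℕ) := by
  obtain ⟨h0, h1, h2, h3⟩ := hp
  obtain ⟨D, hD, hpD⟩ := exists_splitPiece h0 h1 h2 h3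
  obtain ⟨c1, c2⟩ := splitOk_iff.1 (List.all_eq_true.1 split_ok D hD)
  refine encard_NB_le_of_mem hm (splitPieces_bdd D hD) (hull_subset_full (splitPieces_subset D hD))
    hpD hs ?_
  rcases h with rfl | rfl
  · exact c1
  · exact c2

end Cubic

namespace Cubic

/-! ### Groups that are given by a set of classes -/

/-- In the coordinates given by `φ` the group `G` consists of the valid operations with class in
`m`. -/
def HasMask (φ : E3 ≃ᵈ E3) (G : Subgroup Isom3) (m : ℕ) : Prop :=
  m < 65536 ∧ ∀ g : Isom3, g ∈ G ↔ ∃ o, InM m o ∧ ∀ x, g (φ x) = φ (o.act x)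

/-- The conjugate of an isometry by a similarity is again an isometry, since the ratio cancels. -/
noncomputable def conjIso (φ : E3 ≃ᵈ E3) (f f' : E3 → E3) (hf : ∀ x, f (f' x) = x)
    (hd : ∀ x y, dist (f x) (f y) = dist x y) : Isom3 :=
  (IsometryEquiv.mk' (fun x => φ (f (φ.symm x))) (fun x => φ (f' (φ.symm x)))
    (fun x => by rw [φ.symm_apply_apply, hf, φ.apply_symm_apply])
    (Isometry.of_dist_eq fun x y => by
      rw [Dilation.dist_eq, hd, ← Dilation.dist_eq φ, φ.apply_symm_apply,
        φ.apply_symm_apply])).toRealAffineIsometryEquiv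

theorem conjIso_apply (φ : E3 ≃ᵈ E3) (f f' : E3 → E3) (hf : ∀ x, f (f' x) = x)
    (hd : ∀ x y, dist (f x) (f y) = dist x y) (x : E3) :
    conjIso φ f f' hf hd (φ x) = φ (f x) := by
  change φ (f (φ.symm (φ x))) = _
  rw [φ.symm_apply_apply]

/-- The isometry that is given by `o` in the coordinates `φ`. -/
noncomputable def Op.isoVia (φ : E3 ≃ᵈ E3) (o : Op) (h : o.IsPerm) : Isom3 :=
  conjIso φ o.act o.inv.act h.act_inv (Op.dist_act h)

theorem Op.isoVia_apply (φ : E3 ≃ᵈ E3) {o : Op} (h : o.IsPerm) (x : E3) :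
    o.isoVia φ h (φ x) = φ (o.act x) :=
  conjIso_apply φ _ _ _ _ x

theorem isom_ext (φ : E3 ≃ᵈ E3) {g h : Isom3} (H : ∀ x, g (φ x) = h (φ x)) : g = h := by
  ext1 y
  rw [← φ.apply_symm_apply y]
  exact H _

theorem op_unique {φ : E3 ≃ᵈ E3} {g : Isom3} {o o' : Op} (h : ∀ x, g (φ x) = φ (o.act x))
    (h' : ∀ x, g (φ x) = φ (o'.act x)) : o = o' :=
  Op.ext_act fun x => φ.injective (by rw [← h, h'])

theorem HasMask.mem_iff {φ : E3 ≃ᵈ E3} {G : Subgroup Isom3} {m : ℕ} (h : HasMask φ G m) {g : Isom3}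
    {o : Op} (ho : ∀ x, g (φ x) = φ (o.act x)) : g ∈ G ↔ InM m o := by
  rw [h.2]
  constructor
  · rintro ⟨o', ho', h'⟩
    rwa [op_unique ho h']
  · exact fun h' => ⟨o, h', ho⟩

theorem isom_mul {φ : E3 ≃ᵈ E3} {g h : Isom3} {o o' : Op} (hg : ∀ x, g (φ x) = φ (o.act x))
    (hh : ∀ x, h (φ x) = φ (o'.act x)) (x : E3) : (g * h) (φ x) = φ ((o.mul o').act x) := by
  rw [AffineIsometryEquiv.coe_mul, Function.comp_apply, hh, hg, Op.mul_act]

theorem isom_inv {φ : E3 ≃ᵈ E3} {g : Isom3} {o : Op} (ho : o.IsPerm)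
    (hg : ∀ x, g (φ x) = φ (o.act x)) (x : E3) : g⁻¹ (φ x) = φ (o.inv.act x) := by
  apply g.injective
  rw [hg, ho.act_inv]
  exact g.apply_symm_apply (φ x)

theorem isom_one (φ : E3 ≃ᵈ E3) (x : E3) : (1 : Isom3) (φ x) = φ (Op.one.act x) := by
  rw [Op.one_act]; rfl

def repList : List Op :=
  [false, true].flatMap fun s => [((0 : Fin 3), (1 : Fin 3), (2 : Fin 3)), (1, 0, 2)].flatMap fun j =>
    [(0, 0, 0), (-1, 1, 1), (2, 0, 0), (1, 1, 1)].map fun t =>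
      ⟨⟨j.1, s, t.1⟩, ⟨j.2.1, false, t.2.1⟩, ⟨j.2.2, false, t.2.2⟩⟩

theorem exists_cls : ∀ i < 16, ∃ o : Op, o.Valid ∧ o.cls = i := by
  have h : ∀ i < 16, ∃ o ∈ repList, o.Valid ∧ o.cls = i := by decide
  intro i hi
  obtain ⟨o, -, ho⟩ := h i hi
  exact ⟨o, ho⟩

theorem HasMask.isMask {φ : E3 ≃ᵈ E3} {G : Subgroup Isom3} {m : ℕ} (h : HasMask φ G m) :
    IsMask m where
  zero := by
    have := ((h.mem_iff (isom_one φ)).1 G.one_mem).2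
    rwa [Op.cls_one] at this
  mul := by
    intro i hi j hj h1 h2
    obtain ⟨o, ho, rfl⟩ := exists_cls i hi
    obtain ⟨o', ho', rfl⟩ := exists_cls j hj
    have m1 := (h.mem_iff (Op.isoVia_apply φ ho.1)).2 ⟨ho, h1⟩
    have m2 := (h.mem_iff (Op.isoVia_apply φ ho'.1)).2 ⟨ho', h2⟩
    have m3 := (h.mem_iff (isom_mul (Op.isoVia_apply φ ho.1) (Op.isoVia_apply φ ho'.1))).1
      (G.mul_mem m1 m2)
    rw [← Op.cls_mul ho ho']
    exact m3.2
  inv := by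
    intro i hi h1
    obtain ⟨o, ho, rfl⟩ := exists_cls i hi
    have m1 := (h.mem_iff (Op.isoVia_apply φ ho.1)).2 ⟨ho, h1⟩
    have m3 := (h.mem_iff (isom_inv ho.1 (Op.isoVia_apply φ ho.1))).1 (G.inv_mem m1)
    rw [← Op.cls_inv ho]
    exact m3.2

/-! #### The possible sets of classes -/

/-- The set `s` of classes less than `i` is not the trace of a subgroup. -/
def badMask (i s : ℕ) : Bool :=
  !Nat.testBit s 0 && Nat.blt 0 i ||
  (List.range i).any fun a => Nat.testBit s a && (List.range i).any fun b => Nat.testBit s b &&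
    (Nat.blt (mulC a b) i && !Nat.testBit s (mulC a b))

/-- The sixteen bits are decided one after the other, and a branch is abandoned as soon as the bits
known so far contradict closure. Every leaf that remains has to be in the list. -/
def searchMasks : ℕ → ℕ → ℕ → Bool
  | 0, i, s => badMask i s || (maskBounds.map Prod.fst).any (Nat.beq s)
  | f + 1, i, s => badMask i s ||
      (searchMasks f (i + 1) s && searchMasks f (i + 1) (s + Nat.pow 2 i))

theorem not_badMask {m i : ℕ} (hm : IsMask m) (hi : i ≤ 16) : badMask i (m % 2 ^ i) = false := by
  rw [Bool.eq_false_iff]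
  intro h
  unfold badMask at h
  simp only [Bool.or_eq_true, Bool.and_eq_true, Bool.not_eq_true', List.any_eq_true,
    List.mem_range, Nat.testBit_mod_two_pow, decide_eq_true_eq, Nat.blt_eq] at h
  rcases h with ⟨h, hi0⟩ | ⟨a, ha, ⟨-, h1⟩, b, hb, ⟨-, h2⟩, h3, h4⟩
  · simp [hi0, hm.zero] at h
  · simp [h3, hm.mul a (by omega) b (by omega) h1 h2] at h4

theorem mod_two_pow_succ_eq (m i : ℕ) :
    m % 2 ^ (i + 1) = m % 2 ^ i ∨ m % 2 ^ (i + 1) = m % 2 ^ i + 2 ^ i := by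
  have h := Nat.mod_pow_succ (x := m) (b := 2) (k := i)
  rcases Nat.mod_two_eq_zero_or_one (m / 2 ^ i) with h' | h' <;> rw [h'] at h <;> omega

theorem searchMasks_sound {m : ℕ} (hm : IsMask m) : ∀ f i, i + f = 16 →
    searchMasks f i (m % 2 ^ i) = true → m % 2 ^ 16 ∈ maskBounds.map Prod.fst
  | 0, i, hi, h => by
    rw [searchMasks, not_badMask hm (by omega), Bool.false_or, List.any_eq_true] at h
    obtain ⟨x, hx, h⟩ := h
    rw [Nat.beq_eq] at h
    have : i = 16 := by omega
    rw [this] at h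
    rwa [h]
  | f + 1, i, hi, h => by
    rw [searchMasks, not_badMask hm (by omega), Bool.false_or, Bool.and_eq_true] at h
    refine searchMasks_sound hm f (i + 1) (by omega) ?_
    rcases mod_two_pow_succ_eq m i with h' | h'
    · rw [h']; exact h.1
    · rw [h']; exact h.2

theorem searchMasks_ok : searchMasks 16 0 0 = true := by decide +kernel

theorem HasMask.mem_maskBounds {φ : E3 ≃ᵈ E3} {G : Subgroup Isom3} {m : ℕ} (h : HasMask φ G m) :
    ∃ n, (m, n) ∈ maskBounds := by
  have h1 := searchMasks_sound h.isMask 16 0 rfl (by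
    rw [pow_zero, Nat.mod_one]; exact searchMasks_ok)
  rw [Nat.mod_eq_of_lt (by exact h.1)] at h1
  obtain ⟨⟨a, n⟩, hb, rfl⟩ := List.mem_map.1 h1
  exact ⟨n, hb⟩

/-! #### Change of coordinates -/

/-- The set of classes conjugate by `c` to the set `m`; this is the effect of a change of
coordinates by an operation of class `c`. -/
def conjMask (c m : ℕ) : ℕ :=
  Nat.ofBits fun i : Fin 16 => Nat.testBit m (mulC (invC c) (mulC i.1 c))

theorem testBit_conjMask (c m : ℕ) {i : ℕ} (hi : i < 16) :
    Nat.testBit (conjMask c m) i = Nat.testBit m (mulC (invC c) (mulC i c)) :=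
  Nat.testBit_ofBits_lt _ i hi

noncomputable def Op.dil (u : Op) (h : u.IsPerm) : E3 ≃ᵈ E3 :=
  (IsometryEquiv.mk' u.act u.inv.act h.act_inv (Isometry.of_dist_eq (Op.dist_act h))).toDilationEquiv

theorem Op.dil_symm_apply {u : Op} (h : u.IsPerm) (x : E3) : (u.dil h).symm x = u.inv.act x := rfl

theorem inM_conjMask {m : ℕ} {u o : Op} (hu : u.Valid) (ho : o.Valid) :
    InM (conjMask u.cls m) o ↔ InM m (u.inv.mul (o.mul u)) := by
  have h1 := ho.mul hu
  have h2 := hu.inv.mul h1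
  rw [InM, InM, testBit_conjMask _ _ o.cls_lt, Op.cls_mul hu.inv h1, Op.cls_mul ho hu,
    Op.cls_inv hu]
  simp only [ho, h2]

theorem HasMask.conj {φ : E3 ≃ᵈ E3} {G : Subgroup Isom3} {m : ℕ} (h : HasMask φ G m) {u : Op}
    (hu : u.Valid) : HasMask ((u.dil hu.1).symm.trans φ) G (conjMask u.cls m) := by
  have e : ∀ x, ((u.dil hu.1).symm.trans φ) x = φ (u.inv.act x) := fun x => rfl
  refine ⟨Nat.ofBits_lt_two_pow _, fun g => ?_⟩
  rw [h.2]
  constructor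
  · rintro ⟨o, ho, hg⟩
    have hv := hu.mul (ho.1.mul hu.inv)
    refine ⟨u.mul (o.mul u.inv), ?_, fun x => ?_⟩
    · rw [inM_conjMask hu hv]
      have : u.inv.mul ((u.mul (o.mul u.inv)).mul u) = o :=
        Op.ext_act fun x => by simp only [Op.mul_act, hu.1.inv_act]
      rwa [this]
    · rw [e, e, hg, Op.mul_act, Op.mul_act, hu.1.inv_act]
  · rintro ⟨o, ho, hg⟩
    refine ⟨u.inv.mul (o.mul u), (inM_conjMask hu ho.1).1 ho, fun x => ?_⟩
    have := hg (u.act x)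
    rw [e, e, hu.1.inv_act] at this
    rw [this, Op.mul_act, Op.mul_act]

theorem trans_dil_apply (φ ψ : E3 ≃ᵈ E3) (x : E3) : (φ.trans ψ) x = ψ (φ x) := rfl

theorem HasMask.trans {φ ψ : E3 ≃ᵈ E3} {G H : Subgroup Isom3} {m : ℕ} (h : HasMask φ G m)
    (hψ : ∀ g : Isom3, g ∈ H ↔ ∃ h ∈ G, ∀ x, g (ψ x) = ψ (h x)) : HasMask (φ.trans ψ) H m := by
  refine ⟨h.1, fun g => ?_⟩
  rw [hψ]
  constructor
  · rintro ⟨k, hk, hg⟩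
    obtain ⟨o, ho, hko⟩ := (h.2 k).1 hk
    exact ⟨o, ho, fun x => by
      rw [trans_dil_apply, hg, hko, trans_dil_apply]⟩
  · rintro ⟨o, ho, hg⟩
    refine ⟨o.isoVia φ ho.1.1, (h.mem_iff (Op.isoVia_apply φ ho.1.1)).2 ho, fun y => ?_⟩
    have := hg (φ.symm y)
    rw [trans_dil_apply, trans_dil_apply, φ.apply_symm_apply] at this
    rw [this, ← Op.isoVia_apply φ ho.1.1, φ.apply_symm_apply]

theorem HasMask.areSimilar {φ ψ : E3 ≃ᵈ E3} {G H : Subgroup Isom3} {m : ℕ} (hG : HasMask φ G m)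
    (hH : HasMask ψ H m) : AreSimilar G H := by
  refine ⟨φ.symm.trans ψ, fun g => ?_⟩
  have e : ∀ x, (φ.symm.trans ψ) (φ x) = ψ x := fun x => by
    rw [trans_dil_apply, φ.symm_apply_apply]
  rw [hH.2]
  constructor
  · rintro ⟨o, ho, hg⟩
    refine ⟨o.isoVia φ ho.1.1, (hG.mem_iff (Op.isoVia_apply φ ho.1.1)).2 ho, fun y => ?_⟩
    obtain ⟨x, rfl⟩ := φ.surjective y
    rw [e, hg, Op.isoVia_apply, e]
  · rintro ⟨k, hk, hg⟩
    obtain ⟨o, ho, hko⟩ := (hG.2 k).1 hk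
    refine ⟨o, ho, fun x => ?_⟩
    have := hg (φ x)
    rwa [e, hko, e] at this

/-! #### Facets of stereohedra -/

theorem NB.of_dilation (φ : E3 ≃ᵈ E3) {S : Set E3} {p q : E3} (h : NB (φ '' S) (φ p) q) :
    ∃ q', NB S p q' ∧ φ q' = q := by
  obtain ⟨⟨q', hq', rfl⟩, hne, y, hy, hlt⟩ := h
  obtain ⟨x, rfl⟩ := φ.surjective y
  have hr : (0 : ℝ) < Dilation.ratio φ := by exact_mod_cast Dilation.ratio_pos φ
  refine ⟨q', ⟨hq', fun e => hne (by rw [e]), x, ?_, fun r hr' h1 h2 => ?_⟩, rfl⟩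
  · rw [Dilation.dist_eq, Dilation.dist_eq] at hy
    exact mul_left_cancel₀ hr.ne' hy
  · have := hlt (φ r) ⟨r, hr', rfl⟩ (fun e => h1 (φ.injective e)) fun e => h2 (φ.injective e)
    rw [Dilation.dist_eq, Dilation.dist_eq] at this
    exact lt_of_mul_lt_mul_left this hr.le

theorem LocFin.dilation (φ : E3 ≃ᵈ E3) {S : Set E3} (h : LocFin S) : LocFin (φ '' S) := by
  intro y r
  obtain ⟨x, rfl⟩ := φ.surjective y
  have hr : (0 : ℝ) < Dilation.ratio φ := by exact_mod_cast Dilation.ratio_pos φ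
  refine ((h x (r / Dilation.ratio φ)).image φ).subset ?_
  rintro _ ⟨⟨s, hs, rfl⟩, hsr⟩
  refine ⟨s, ⟨hs, ?_⟩, rfl⟩
  rw [Metric.mem_closedBall, Dilation.dist_eq] at hsr
  rw [Metric.mem_closedBall, le_div_iff₀ hr]
  linarith

theorem HasMask.orbitOf_eq {φ : E3 ≃ᵈ E3} {G : Subgroup Isom3} {m : ℕ} (h : HasMask φ G m)
    (p : E3) : orbitOf G (φ p) = φ '' orb m p := by
  ext q
  constructor
  · rintro ⟨g, hg, rfl⟩
    obtain ⟨o, ho, hgo⟩ := (h.2 g).1 hg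
    exact ⟨o.act p, ⟨o, ho, rfl⟩, (hgo p).symm⟩
  · rintro ⟨_, ⟨o, ho, rfl⟩, rfl⟩
    exact ⟨o.isoVia φ ho.1.1, (h.mem_iff (Op.isoVia_apply φ ho.1.1)).2 ho, Op.isoVia_apply φ ho.1.1 p⟩

theorem HasMask.encard_facets_le {φ : E3 ≃ᵈ E3} {G : Subgroup Isom3} {m : ℕ} (h : HasMask φ G m)
    (p : E3) : (facets (voronoiCell (orbitOf G (φ p)) (φ p))).encard ≤
      {q | NB (orb m p) p q}.encard := by
  rw [h.orbitOf_eq]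
  refine (Cubic.encard_facets_le ((locFin_orb m p).dilation φ) ⟨p, h.isMask.self_mem p, rfl⟩).trans ?_
  rw [← φ.injective.encard_image {q | NB (orb m p) p q}]
  refine Set.encard_le_encard fun q hq => ?_
  obtain ⟨q', hq', rfl⟩ := NB.of_dilation φ hq
  exact ⟨q', hq', rfl⟩

/-- The coordinates can be chosen such that a given point is in the fundamental simplex. -/
theorem HasMask.exists_inFund {φ : E3 ≃ᵈ E3} {G : Subgroup Isom3} {m : ℕ} (h : HasMask φ G m)
    (y : E3) : ∃ c < 16, ∃ ψ : E3 ≃ᵈ E3, HasMask ψ G (conjMask c m) ∧ ∃ p, InFund p ∧ ψ p = y := by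
  obtain ⟨x, rfl⟩ := φ.surjective y
  obtain ⟨u, hu, hx⟩ := exists_valid_mem x
  refine ⟨u.cls, u.cls_lt, _, h.conj hu, u.act x, hx, ?_⟩
  rw [trans_dil_apply, Op.dil_symm_apply, hu.1.inv_act]

theorem HasMask.encard_facets_le_twentyfive {φ : E3 ≃ᵈ E3} {G : Subgroup Isom3} {m : ℕ}
    (h : HasMask φ G m) (p : E3) : (facets (voronoiCell (orbitOf G p) p)).encard ≤ 25 := by
  obtain ⟨c, -, ψ, hψ, p, hp, rfl⟩ := h.exists_inFund p
  obtain ⟨n, hn⟩ := hψ.mem_maskBounds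
  exact (hψ.encard_facets_le p).trans (encard_NB_le_twentyfive hn hψ.isMask hp)

theorem HasMask.eq_one_of_fixed {φ : E3 ≃ᵈ E3} {G : Subgroup Isom3} {m : ℕ} (h : HasMask φ G m)
    {p : E3} (hp : HasTrivialStabilizer G (φ p)) {g : Op} (hg : InM m g) (hgp : g.act p = p) :
    g = Op.one := by
  have h1 := hp _ ((h.mem_iff (Op.isoVia_apply φ hg.1.1)).2 hg) (by rw [Op.isoVia_apply, hgp])
  refine op_unique (Op.isoVia_apply φ hg.1.1) fun x => ?_
  rw [h1, isom_one]

/-- Moving the base point into the fundamental simplex replaces the mask by a conjugate, and it is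
not known by which class; the bound is therefore required for all conjugates. -/
theorem HasMask.encard_facets_le_of_bound {φ : E3 ≃ᵈ E3} {G : Subgroup Isom3} {m : ℕ}
    (h : HasMask φ G m) {n : ℕ}
    (hn : ∀ c < 16, (conjMask c m, n) ∈ maskBounds ∨
      n = 17 ∧ (conjMask c m = 8193 ∨ conjMask c m = 32769)) {p : E3}
    (hp : HasTrivialStabilizer G p) : (facets (voronoiCell (orbitOf G p) p)).encard ≤ (n : ℕ∞) := by
  obtain ⟨c, hc, ψ, hψ, p, hpf, rfl⟩ := h.exists_inFund p
  refine (hψ.encard_facets_le p).trans ?_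
  rcases hn c hc with hb | ⟨rfl, hb⟩
  · exact encard_NB_le hb hψ.isMask hpf fun g => hψ.eq_one_of_fixed hp
  · exact encard_NB_le_seventeen hb hψ.isMask hpf fun g => hψ.eq_one_of_fixed hp

end Cubic

namespace Cubic

/-! ### Groups that contain the operations of class zero -/

/-- In the coordinates `φ` the valid operation `o` is in the group `H`. -/
def OpIn (φ : E3 ≃ᵈ E3) (H : Subgroup Isom3) (o : Op) : Prop :=
  o.Valid ∧ ∃ g ∈ H, ∀ x, g (φ x) = φ (o.act x)

theorem OpIn.mem {φ : E3 ≃ᵈ E3} {H : Subgroup Isom3} {o : Op} (h : OpIn φ H o) {g : Isom3}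
    (hg : ∀ x, g (φ x) = φ (o.act x)) : g ∈ H := by
  obtain ⟨-, k, hk, hko⟩ := h
  rwa [isom_ext φ (g := g) (h := k) fun x => by rw [hg, hko]]

theorem opIn_one (φ : E3 ≃ᵈ E3) (H : Subgroup Isom3) : OpIn φ H Op.one :=
  ⟨Op.one_valid, 1, H.one_mem, isom_one φ⟩

theorem OpIn.mul {φ : E3 ≃ᵈ E3} {H : Subgroup Isom3} {o o' : Op} (h : OpIn φ H o)
    (h' : OpIn φ H o') : OpIn φ H (o.mul o') := by
  obtain ⟨hv, g, hg, hgo⟩ := h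
  obtain ⟨hv', g', hg', hgo'⟩ := h'
  exact ⟨hv.mul hv', g * g', H.mul_mem hg hg', isom_mul hgo hgo'⟩

theorem OpIn.inv {φ : E3 ≃ᵈ E3} {H : Subgroup Isom3} {o : Op} (h : OpIn φ H o) :
    OpIn φ H o.inv := by
  obtain ⟨hv, g, hg, hgo⟩ := h
  exact ⟨hv.inv, g⁻¹, H.inv_mem hg, isom_inv hv.1 hgo⟩

def diag (a b c : Bool) : Op := ⟨⟨0, a, 0⟩, ⟨1, b, 0⟩, ⟨2, c, 0⟩⟩

def cyc : Op := ⟨⟨2, false, 0⟩, ⟨0, false, 0⟩, ⟨1, false, 0⟩⟩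

theorem translation_mul (a b c a' b' c' : ℤ) : (translation a b c).mul (translation a' b' c') =
    translation (a + a') (b + b') (c + c') := by
  refine Op.ext_act fun x => ?_
  rw [Op.mul_act]
  ext i
  fin_cases i <;> simp [translation, Row.eval] <;> ring

/-- The vectors whose translations are in `H`. -/
def translationVectors (φ : E3 ≃ᵈ E3) (H : Subgroup Isom3) : AddSubgroup (ℤ × ℤ × ℤ) where
  carrier := {v | OpIn φ H (translation v.1 v.2.1 v.2.2)}
  zero_mem' := opIn_one φ H
  add_mem' := by
    intro v w hv hw
    have := OpIn.mul hv hw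
    rwa [translation_mul] at this
  neg_mem' := by
    intro v hv
    exact OpIn.inv hv

/-- An operation of class zero is a cyclic permutation, followed by an even number of sign changes,
followed by a translation by an even vector with sum divisible by 4. The three factors are generated
separately. -/
theorem opIn_of_generators {φ : E3 ≃ᵈ E3} {H : Subgroup Isom3} (h1 : OpIn φ H (translation 2 2 0))
    (h2 : OpIn φ H (translation 2 0 2)) (h3 : OpIn φ H (translation 0 2 2))
    (hd1 : OpIn φ H (diag true true false)) (hd2 : OpIn φ H (diag true false true))
    (hc : OpIn φ H cyc) {o : Op} (ho : o.Valid) (hcls : o.cls = 0) : OpIn φ H o := by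
  have hT : ∀ a b c : ℤ, (a + b + c) % 2 = 0 → OpIn φ H (translation (2 * a) (2 * b) (2 * c)) := by
    intro a b c h
    obtain ⟨k, hk⟩ : (2 : ℤ) ∣ a + b + c := Int.dvd_of_emod_eq_zero h
    have m1 : ((2, 2, 0) : ℤ × ℤ × ℤ) ∈ translationVectors φ H := h1
    have m2 : ((2, 0, 2) : ℤ × ℤ × ℤ) ∈ translationVectors φ H := h2
    have m3 : ((0, 2, 2) : ℤ × ℤ × ℤ) ∈ translationVectors φ H := h3
    -- Here `2 k = a + b + c`, so the coefficients of the three lattice generators are integers.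
    have h := add_mem (add_mem (zsmul_mem m1 (k - c)) (zsmul_mem m2 (k - b))) (zsmul_mem m3 (k - a))
    have e : (k - c) • ((2, 2, 0) : ℤ × ℤ × ℤ) + (k - b) • ((2, 0, 2) : ℤ × ℤ × ℤ) +
        (k - a) • ((0, 2, 2) : ℤ × ℤ × ℤ) = (2 * a, 2 * b, 2 * c) := by
      simp only [Prod.smul_mk, Prod.mk_add_mk, smul_eq_mul, Prod.mk.injEq]
      refine ⟨?_, ?_, ?_⟩ <;> linarith
    rw [e] at h
    exact h
  have hD : ∀ a b c : Bool, xor a (xor b c) = false → OpIn φ H (diag a b c) := by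
    have hd3 : OpIn φ H (diag false true true) := hd1.mul hd2
    intro a b c h
    cases a <;> cases b <;> cases c <;> simp at h
    · exact opIn_one φ H
    · exact hd3
    · exact hd2
    · exact hd1
  have hC : OpIn φ H (cyc.mul cyc) := hc.mul hc
  obtain ⟨hperm, hp1, hp2⟩ := ho
  rw [Op.cls_eq] at hcls
  have c1 : o.sgn = false := by
    cases h : o.sgn
    · rfl
    · rw [h] at hcls; simp at hcls
  have c2 : o.even = true := by
    cases h : o.even
    · rw [h] at hcls; simp at hcls
    · rfl
  have c3 : o.tsum % 4 = 0 := by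
    rw [c1, c2] at hcls
    simp only [cond_false, cond_true] at hcls
    omega
  rw [Op.tsum] at c3
  obtain ⟨a, ha⟩ : (2 : ℤ) ∣ o.r0.t := by omega
  obtain ⟨b, hb⟩ : (2 : ℤ) ∣ o.r1.t := by omega
  obtain ⟨c, hc'⟩ : (2 : ℤ) ∣ o.r2.t := by omega
  have hTo := hT a b c (by omega)
  have hDo := hD o.r0.neg o.r1.neg o.r2.neg c1
  have hone := opIn_one φ H
  rw [Op.even_eq, decide_eq_true_eq] at c2
  have hj := hperm.cases
  obtain ⟨⟨j, n, t⟩, ⟨j', n', t'⟩, ⟨j'', n'', t''⟩⟩ := o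
  simp only at ha hb hc' hDo c2 hj
  subst ha hb hc'
  have hfin : ∀ C : Op, OpIn φ H C →
      ((translation (2 * a) (2 * b) (2 * c)).mul ((diag n n' n'').mul C)) =
        ⟨⟨j, n, 2 * a⟩, ⟨j', n', 2 * b⟩, ⟨j'', n'', 2 * c⟩⟩ →
      OpIn φ H ⟨⟨j, n, 2 * a⟩, ⟨j', n', 2 * b⟩, ⟨j'', n'', 2 * c⟩⟩ := by
    intro C hC e
    rw [← e]
    exact hTo.mul (hDo.mul hC)
  simp only [List.mem_cons, Prod.mk.injEq, List.not_mem_nil, or_false] at hj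
  rcases hj with ⟨rfl, rfl, rfl⟩ | ⟨rfl, rfl, rfl⟩ | ⟨rfl, rfl, rfl⟩ | ⟨rfl, rfl, rfl⟩ |
    ⟨rfl, rfl, rfl⟩ | ⟨rfl, rfl, rfl⟩
  · refine hfin _ hone (Op.ext_act fun x => ?_)
    rw [Op.mul_act, Op.mul_act]
    ext i
    fin_cases i <;> simp [translation, diag, Op.one, Row.eval]
  · exact absurd c2 (by decide)
  · exact absurd c2 (by decide)
  · refine hfin _ hC (Op.ext_act fun x => ?_)
    rw [Op.mul_act, Op.mul_act, Op.mul_act]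
    ext i
    fin_cases i <;> simp [translation, diag, cyc, Row.eval]
  · refine hfin _ hc (Op.ext_act fun x => ?_)
    rw [Op.mul_act, Op.mul_act]
    ext i
    fin_cases i <;> simp [translation, diag, cyc, Row.eval]
  · exact absurd c2 (by decide)

/-- A group of valid operations that contains all operations of class zero is given by a set of
classes. -/
theorem exists_hasMask {φ : E3 ≃ᵈ E3} {H : Subgroup Isom3}
    (hv : ∀ g ∈ H, ∃ o : Op, o.Valid ∧ ∀ x, g (φ x) = φ (o.act x))
    (h0 : ∀ o : Op, o.Valid → o.cls = 0 → OpIn φ H o) : ∃ m, HasMask φ H m := by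
  classical
  let f : Fin 16 → Bool := fun i => decide (∃ o, OpIn φ H o ∧ o.cls = i.1)
  have hf : ∀ o : Op, Nat.testBit (Nat.ofBits f) o.cls = true ↔ ∃ o', OpIn φ H o' ∧ o'.cls = o.cls := by
    intro o
    rw [Nat.testBit_ofBits_lt _ _ o.cls_lt]
    exact decide_eq_true_iff
  refine ⟨Nat.ofBits f, Nat.ofBits_lt_two_pow _, fun g => ?_⟩
  constructor
  · intro hg
    obtain ⟨o, ho, hgo⟩ := hv g hg
    exact ⟨o, ⟨ho, (hf o).2 ⟨o, ⟨ho, g, hg, hgo⟩, rfl⟩⟩, hgo⟩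
  · rintro ⟨o, ⟨ho, hm⟩, hgo⟩
    obtain ⟨o', ho', hcls⟩ := (hf o).1 hm
    have h1 := h0 (o'.inv.mul o) (ho'.1.inv.mul ho) (by
      rw [Op.cls_mul ho'.1.inv ho, Op.cls_inv ho'.1, hcls, invC_mulC _ o.cls_lt])
    have h2 := ho'.mul h1
    rw [← Op.mul_assoc, ho'.1.1.mul_inv, Op.one_mul] at h2
    exact h2.mem hgo

/-- The generated group contains class zero and therefore has a mask, which is a subgroup in the
list contained in `m` and containing the classes of the operations in `C`. If `m` is the only such
subgroup in the list, the group is determined. -/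
theorem hasMask_closure {φ : E3 ≃ᵈ E3} {S : Set Isom3} {m : ℕ} (hm : IsMask m)
    (hS : ∀ g ∈ S, ∃ o, InM m o ∧ ∀ x, g (φ x) = φ (o.act x))
    (h1 : OpIn φ (Subgroup.closure S) (translation 2 2 0))
    (h2 : OpIn φ (Subgroup.closure S) (translation 2 0 2))
    (h3 : OpIn φ (Subgroup.closure S) (translation 0 2 2))
    (hd1 : OpIn φ (Subgroup.closure S) (diag true true false))
    (hd2 : OpIn φ (Subgroup.closure S) (diag true false true))
    (hc : OpIn φ (Subgroup.closure S) cyc) {C : List Op}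
    (hC : ∀ o ∈ C, OpIn φ (Subgroup.closure S) o)
    (hCm : ∀ b ∈ maskBounds, (∀ o ∈ C, Nat.testBit b.1 o.cls = true) →
      (∀ i < 16, Nat.testBit b.1 i = true → Nat.testBit m i = true) → b.1 = m) :
    HasMask φ (Subgroup.closure S) m := by
  have hmem : ∀ g ∈ Subgroup.closure S, ∃ o, InM m o ∧ ∀ x, g (φ x) = φ (o.act x) := by
    intro g hg
    induction hg using Subgroup.closure_induction with
    | mem g hg => exact hS g hg
    | one => exact ⟨Op.one, hm.one_mem, isom_one φ⟩
    | mul g h _ _ ihg ihh =>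
      obtain ⟨o, ho, hgo⟩ := ihg
      obtain ⟨o', ho', hgo'⟩ := ihh
      exact ⟨_, hm.mul_mem ho ho', isom_mul hgo hgo'⟩
    | inv g _ ih =>
      obtain ⟨o, ho, hgo⟩ := ih
      exact ⟨_, hm.inv_mem ho, isom_inv ho.1.1 hgo⟩
  obtain ⟨m', hm'⟩ := exists_hasMask (H := Subgroup.closure S) (fun g hg => by
      obtain ⟨o, ho, hgo⟩ := hmem g hg
      exact ⟨o, ho.1, hgo⟩) fun o => opIn_of_generators h1 h2 h3 hd1 hd2 hc
  obtain ⟨n, hn⟩ := hm'.mem_maskBounds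
  have : m' = m := hCm _ hn (fun o ho => by
      obtain ⟨hv, g, hg, hgo⟩ := hC o ho
      exact ((hm'.mem_iff hgo).1 hg).2) (fun i hi hb => by
      obtain ⟨o, ho, rfl⟩ := exists_cls i hi
      obtain ⟨o', ho', h'⟩ := hmem _ ((hm'.mem_iff (Op.isoVia_apply φ ho.1)).2 ⟨ho, hb⟩)
      rw [op_unique (Op.isoVia_apply φ ho.1) h']
      exact ho'.2)
  rwa [← this]

end Cubic

namespace Cubic

/-! ### Similarities and rotations of order three -/

theorem exists_linear (φ : E3 ≃ᵈ E3) :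
    ∃ (r : ℝ) (U : E3 ≃ₗᵢ[ℝ] E3), 0 < r ∧ ∀ x v, φ (x + v) = φ x + r • U v := by
  have hr : (0 : ℝ) < Dilation.ratio φ := by exact_mod_cast Dilation.ratio_pos φ
  obtain ⟨r, hrdef⟩ : ∃ r : ℝ, r = ((Dilation.ratio φ : NNReal) : ℝ) := ⟨_, rfl⟩
  rw [← hrdef] at hr
  let A : Isom3 := (IsometryEquiv.mk' (fun x => r⁻¹ • φ x) (fun y => φ.symm (r • y))
    (fun y => by rw [φ.apply_symm_apply, smul_smul, inv_mul_cancel₀ hr.ne', one_smul])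
    (Isometry.of_dist_eq fun x y => by
      rw [dist_smul₀, Dilation.dist_eq, ← hrdef, Real.norm_of_nonneg (inv_nonneg.2 hr.le),
        ← mul_assoc, inv_mul_cancel₀ hr.ne', one_mul])).toRealAffineIsometryEquiv
  have hA : ∀ x, φ x = r • A x := fun x => by
    change φ x = r • (r⁻¹ • φ x)
    rw [smul_smul, mul_inv_cancel₀ hr.ne', one_smul]
  refine ⟨r, A.linearIsometryEquiv, hr, fun x v => ?_⟩
  have h := A.map_vadd x v
  rw [vadd_eq_add, vadd_eq_add] at h
  rw [hA, hA x, add_comm x v, h, smul_add, add_comm]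

theorem isom_add (g : Isom3) (x v : E3) : g (x + v) = g x + g.linearIsometryEquiv v := by
  have h := g.map_vadd x v
  rw [vadd_eq_add, vadd_eq_add] at h
  rw [add_comm x v, h, add_comm]

/-- If the fixed space had dimension two, its complement would be at most a line on which `L` acts
by a real cube root of unity, that is, trivially; then `L` would be the identity. -/
theorem fixed_mem_span {L : E3 ≃ₗᵢ[ℝ] E3} (h3 : ∀ v, L (L (L v)) = v) (h1 : ∃ v, L v ≠ v) {d v : E3}
    (hd0 : d ≠ 0) (hd : L d = d) (hv : L v = v) : ∃ c : ℝ, v = c • d := by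
  by_contra hcon
  push Not at hcon
  let F : Submodule ℝ E3 := LinearMap.ker (L.toLinearEquiv.toLinearMap - LinearMap.id)
  have hF : ∀ w, w ∈ F ↔ L w = w := by
    intro w
    simp only [F, LinearMap.mem_ker, LinearMap.sub_apply, LinearMap.id_apply, sub_eq_zero]
    rfl
  have hind : LinearIndependent ℝ ![d, v] := by
    rw [LinearIndependent.pair_iff' hd0]
    intro a ha
    exact hcon a ha.symm
  have hsp : Module.finrank ℝ (Submodule.span ℝ (Set.range ![d, v])) = 2 := by
    rw [finrank_span_eq_card hind]; rfl
  have hle : Submodule.span ℝ (Set.range ![d, v]) ≤ F := by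
    rw [Submodule.span_le]
    rintro _ ⟨i, rfl⟩
    fin_cases i
    · exact (hF _).2 hd
    · exact (hF _).2 hv
  have e1 := Submodule.finrank_mono hle
  have e2 := Submodule.finrank_add_finrank_orthogonal F
  have e3 : Module.finrank ℝ E3 = 3 := by simp
  have e4 : Module.finrank ℝ Fᗮ ≤ 1 := by omega
  obtain ⟨⟨w, hw⟩, hgen⟩ := finrank_le_one_iff.1 e4
  have hLw : L w ∈ Fᗮ := by
    rw [Submodule.mem_orthogonal]
    intro f hf
    rw [← (hF f).1 hf, L.inner_map_map]
    exact (Submodule.mem_orthogonal _ _).1 hw f hf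
  obtain ⟨c, hc⟩ := hgen ⟨L w, hLw⟩
  have hc' : L w = c • w := (congrArg Subtype.val hc).symm
  have hw0 : w = 0 := by
    by_contra hne
    have h4 := h3 w
    rw [hc', map_smul, map_smul, hc', map_smul, hc', smul_smul, smul_smul] at h4
    have h5 : (c * c * c - 1) • w = 0 := by rw [sub_smul, one_smul, h4, sub_self]
    have h6 := (smul_eq_zero.1 h5).resolve_right hne
    have h7 : c = 1 := by nlinarith [sq_nonneg (c + 1), sq_nonneg c, sq_nonneg (c - 1)]
    rw [h7, one_smul] at hc'
    have h8 := (Submodule.mem_orthogonal _ _).1 hw w ((hF w).2 hc')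
    exact hne (inner_self_eq_zero.1 h8)
  obtain ⟨u, hu⟩ := h1
  refine hu ((hF u).1 ?_)
  have hbot : Fᗮ = ⊥ := by
    rw [eq_bot_iff]
    intro y hy
    obtain ⟨a, ha⟩ := hgen ⟨y, hy⟩
    have : y = a • w := (congrArg Subtype.val ha).symm
    rw [this, hw0, smul_zero]
    exact Submodule.zero_mem _
  rw [Submodule.orthogonal_eq_bot_iff.1 hbot]
  trivial

theorem sum_three (f : Fin 3 → ℝ) : ∑ i, f i = f 0 + f 1 + f 2 := Fin.sum_univ_three f

theorem inner_eq_sum (v w : E3) : inner ℝ v w = v 0 * w 0 + v 1 * w 1 + v 2 * w 2 := by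
  rw [PiLp.inner_apply, sum_three]
  simp [mul_comm]

theorem linear_apply (L : E3 ≃ₗᵢ[ℝ] E3) (v : E3) (i : Fin 3) :
    L v i = L (EuclideanSpace.single 0 1) i * v 0 + L (EuclideanSpace.single 1 1) i * v 1 +
      L (EuclideanSpace.single 2 1) i * v 2 := by
  have : v = v 0 • EuclideanSpace.single 0 (1 : ℝ) + v 1 • EuclideanSpace.single 1 (1 : ℝ) +
      v 2 • EuclideanSpace.single 2 (1 : ℝ) := by
    ext j
    fin_cases j <;> simp
  conv_lhs => rw [this]
  rw [map_add, map_add, map_smul, map_smul, map_smul]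
  simp [mul_comm]

/-- A rotation of order three about a diagonal of the cube permutes the coordinate axes. -/
theorem threefold_linear {L : E3 ≃ₗᵢ[ℝ] E3} (h3 : ∀ v, L (L (L v)) = v) (h1 : ∃ v, L v ≠ v) {d : E3}
    (hs : ∀ i, d i * d i = 1) (hd : L d = d) :
    (∀ v i, L v i = d i * d (i + 2) * v (i + 2)) ∨ (∀ v i, L v i = d i * d (i + 1) * v (i + 1)) := by
  have s0 := hs 0
  have s1 := hs 1
  have s2 := hs 2
  have hd0 : d ≠ 0 := by
    rintro rfl
    simp at s0
  -- The sum over an orbit of `L` is fixed and hence a multiple of `d`; the factor follows from the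
  -- inner product with `d`, whose square is 3.
  have key : ∀ v, v + L v + L (L v) = (inner ℝ v d : ℝ) • d := by
    intro v
    obtain ⟨c, hc⟩ := fixed_mem_span h3 h1 hd0 hd (v := v + L v + L (L v)) (by
      rw [map_add, map_add, h3]; abel)
    have e1 : inner ℝ (L v) d = inner ℝ v d := by
      conv_lhs => rw [← hd]
      exact L.inner_map_map _ _
    have e2 : inner ℝ (L (L v)) d = inner ℝ v d := by
      conv_lhs => rw [← hd]
      rw [L.inner_map_map, e1]
    have e3 : (inner ℝ d d : ℝ) = 3 := by rw [inner_eq_sum, s0, s1, s2]; norm_num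
    have e4 := congrArg (fun y => (inner ℝ y d : ℝ)) hc
    simp only [inner_add_left, e1, e2, inner_smul_left, e3] at e4
    rw [hc]
    congr 1
    have : c * 3 = 3 * inner ℝ v d := by
      simp only [conj_trivial] at e4
      linarith
    linarith
  let e : Fin 3 → E3 := fun j => EuclideanSpace.single j 1
  let A : Fin 3 → Fin 3 → ℝ := fun i j => L (e j) i
  -- Since `L` is orthogonal of order three, its square is its transpose. The identity above becomes
  -- a matrix equation: the identity, `A` and the transpose of `A` add up to the matrix with entries
  -- `d j * d i`.
  have hLL : ∀ i j, L (L (e j)) i = A j i := by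
    intro i j
    have e1 : L (L (e j)) i = inner ℝ (e i) (L (L (e j))) := by
      simp [e, EuclideanSpace.inner_single_left]
    rw [e1, ← L.inner_map_map, h3]
    simp [e, A, EuclideanSpace.inner_single_right]
  have hsym : ∀ i j, e j i + A i j + A j i = d j * d i := by
    intro i j
    have := congrArg (fun y : E3 => y i) (key (e j))
    simp only [PiLp.add_apply, PiLp.smul_apply, smul_eq_mul, hLL] at this
    rw [this]
    simp [e, EuclideanSpace.inner_single_left]
  have hrow : ∀ i, A i 0 * d 0 + A i 1 * d 1 + A i 2 * d 2 = d i := by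
    intro i
    have := linear_apply L d i
    rw [hd] at this
    exact this.symm
  have hcol : A 0 0 * A 0 0 + A 1 0 * A 1 0 + A 2 0 * A 2 0 = 1 := by
    have h := L.inner_map_map (e 0) (e 0)
    rw [inner_eq_sum, inner_eq_sum] at h
    simpa [e, A] using h
  have h00 := hsym 0 0
  have h11 := hsym 1 1
  have h22 := hsym 2 2
  have h01 := hsym 0 1
  have h02 := hsym 0 2
  have h12 := hsym 1 2
  simp [e] at h00 h11 h22 h01 h02 h12
  have a00 : A 0 0 = 0 := by linarith
  have a11 : A 1 1 = 0 := by linarith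
  have a22 : A 2 2 = 0 := by linarith
  have r0 := hrow 0
  have r1 := hrow 1
  have r2 := hrow 2
  rw [a00] at r0 hcol
  rw [a11] at r1
  rw [a22] at r2
  -- The matrix equation together with `A d = d` leaves one free parameter `a`; all off-diagonal
  -- entries are `a` or `1 - a` up to the signs given by `d`.
  obtain ⟨a, ha⟩ : ∃ a, a = A 0 1 * d 0 * d 1 := ⟨_, rfl⟩
  have b01 : A 0 1 = a * d 0 * d 1 := by
    rw [ha]; linear_combination (-A 0 1 * d 1 * d 1) * s0 - A 0 1 * s1
  have b02 : A 0 2 = (1 - a) * d 0 * d 2 := by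
    have : A 0 2 * d 2 * d 2 = (d 0 - A 0 1 * d 1) * d 2 := by rw [← r0]; ring
    rw [mul_assoc, s2, b01] at this
    linear_combination this - a * d 0 * d 2 * s1
  have b10 : A 1 0 = (1 - a) * d 0 * d 1 := by linear_combination h01 - b01
  have b20 : A 2 0 = a * d 0 * d 2 := by linear_combination h02 - b02
  have b12 : A 1 2 = a * d 1 * d 2 := by
    have : A 1 2 * d 2 * d 2 = (d 1 - A 1 0 * d 0) * d 2 := by rw [← r1]; ring
    rw [mul_assoc, s2, b10] at this
    linear_combination this - (1 - a) * d 1 * d 2 * s0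
  have b21 : A 2 1 = (1 - a) * d 1 * d 2 := by linear_combination h12 - b12
  -- The first column has length one, so the squares of `a` and `1 - a` add up to 1. The two
  -- solutions are the two rotations about `d`.
  have hq : a * (a - 1) = 0 := by
    rw [b10, b20] at hcol
    have e1 : (1 - a) * d 0 * d 1 * ((1 - a) * d 0 * d 1) + a * d 0 * d 2 * (a * d 0 * d 2) =
        (1 - a) ^ 2 * (d 0 * d 0) * (d 1 * d 1) + a ^ 2 * (d 0 * d 0) * (d 2 * d 2) := by ring
    rw [s0, s1, s2] at e1
    linarith
  have hfin : ∀ v i, L v i = A i 0 * v 0 + A i 1 * v 1 + A i 2 * v 2 := linear_apply L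
  rcases mul_eq_zero.1 hq with h | h
  · left
    intro v i
    rw [hfin]
    fin_cases i
    · change A 0 0 * _ + A 0 1 * _ + A 0 2 * _ = d 0 * d 2 * v 2
      rw [a00, b01, b02, h]; ring
    · change A 1 0 * _ + A 1 1 * _ + A 1 2 * _ = d 1 * d 0 * v 0
      rw [a11, b10, b12, h]; ring
    · change A 2 0 * _ + A 2 1 * _ + A 2 2 * _ = d 2 * d 1 * v 1
      rw [a22, b20, b21, h]; ring
  · right
    have h' : a = 1 := by linarith
    intro v i
    rw [hfin]
    fin_cases i
    · change A 0 0 * _ + A 0 1 * _ + A 0 2 * _ = d 0 * d 1 * v 1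
      rw [a00, b01, b02, h']; ring
    · change A 1 0 * _ + A 1 1 * _ + A 1 2 * _ = d 1 * d 2 * v 2
      rw [a11, b10, b12, h']; ring
    · change A 2 0 * _ + A 2 1 * _ + A 2 2 * _ = d 2 * d 0 * v 0
      rw [a22, b20, b21, h']; ring

end Cubic

namespace Cubic

/-! ### The group `R1` and odd subgroups -/

noncomputable def scaleDil (a : ℝ) (ha : a ≠ 0) (c : E3) : E3 ≃ᵈ E3 where
  toFun x := a • x + c
  invFun y := a⁻¹ • (y - c)
  left_inv x := by
    simp only [add_sub_cancel_right, smul_smul, inv_mul_cancel₀ ha, one_smul]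
  right_inv y := by
    simp only [smul_smul, mul_inv_cancel₀ ha, one_smul, sub_add_cancel]
  edist_eq' := ⟨‖a‖₊, nnnorm_ne_zero_iff.2 ha, fun x y => by
    simp only [edist_add_right, edist_smul₀, ENNReal.smul_def, smul_eq_mul]⟩

theorem scaleDil_apply (a : ℝ) (ha : a ≠ 0) (c x : E3) : scaleDil a ha c x = a • x + c := rfl

def rotRow (z : Fin 3 → ℤ) (e : Fin 3 → Bool) (i j : Fin 3) : Row :=
  ⟨j, xor (e i) (e j), 2 * z i - (bif xor (e i) (e j) then -(2 * z j) else 2 * z j)⟩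

/-- The rotation of order three about the line through `2 z` with the direction of signs `e`. -/
def rot (z : Fin 3 → ℤ) (e : Fin 3 → Bool) : Op :=
  ⟨rotRow z e 0 2, rotRow z e 1 0, rotRow z e 2 1⟩

noncomputable def sgnVec (e : Fin 3 → Bool) : E3 := WithLp.toLp 2 fun i => bif e i then -1 else 1

noncomputable def intVec (z : Fin 3 → ℤ) : E3 := WithLp.toLp 2 fun i => (z i : ℝ)

theorem sgnVec_apply (e : Fin 3 → Bool) (i : Fin 3) : sgnVec e i = bif e i then -1 else 1 := rfl

theorem intVec_apply (z : Fin 3 → ℤ) (i : Fin 3) : intVec z i = z i := rfl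

theorem sgnVec_mul_self (e : Fin 3 → Bool) (i : Fin 3) : sgnVec e i * sgnVec e i = 1 := by
  rw [sgnVec_apply]
  cases e i <;> simp

theorem rot_act (z : Fin 3 → ℤ) (e : Fin 3 → Bool) (x : E3) (i : Fin 3) : (rot z e).act x i =
    2 * z i + sgnVec e i * sgnVec e (i + 2) * (x (i + 2) - 2 * z (i + 2)) := by
  have key : ∀ i j : Fin 3, (rotRow z e i j).eval x =
      2 * z i + sgnVec e i * sgnVec e j * (x j - 2 * z j) := by
    intro i j
    simp only [rotRow, Row.eval, sgnVec_apply]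
    cases e i <;> cases e j <;> simp <;> ring
  rw [Op.act_apply]
  fin_cases i
  · exact key 0 2
  · exact key 1 0
  · exact key 2 1

theorem rot_valid (z : Fin 3 → ℤ) (e : Fin 3 → Bool) : (rot z e).Valid ∧ (rot z e).cls = 0 := by
  have h : ∀ i j, (rotRow z e i j).t % 2 = 0 := by
    intro i j
    simp only [rotRow]
    cases e i <;> cases e j <;> simp
  refine ⟨⟨by simp [rot, rotRow, Op.IsPerm], ?_, ?_⟩, ?_⟩
  · exact (h 0 2).trans (h 1 0).symm
  · exact (h 0 2).trans (h 2 1).symm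
  · have h1 : (rot z e).tsum % 4 = 0 := by
      simp only [Op.tsum, rot, rotRow]
      cases e 0 <;> cases e 1 <;> cases e 2 <;> simp <;> omega
    have h2 : (rot z e).sgn = false := by
      simp only [Op.sgn, rot, rotRow]
      cases e 0 <;> cases e 1 <;> cases e 2 <;> rfl
    have h3 : (rot z e).even = true := by rw [Op.even_eq]; rfl
    rw [Op.cls_eq, h1, h2, h3]
    rfl

theorem rot_cube (z : Fin 3 → ℤ) (e : Fin 3 → Bool) :
    (rot z e).mul ((rot z e).mul (rot z e)) = Op.one := by
  refine Op.ext_act fun x => ?_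
  rw [Op.mul_act, Op.mul_act, Op.one_act]
  ext i
  have h : i + 2 + 2 + 2 = i := by revert i; decide
  have s1 := sgnVec_mul_self e i
  have s2 := sgnVec_mul_self e (i + 2)
  have s3 := sgnVec_mul_self e (i + 2 + 2)
  rw [rot_act, rot_act, rot_act, h]
  generalize sgnVec e i = a at s1 ⊢
  generalize sgnVec e (i + 2) = b at s2 ⊢
  generalize sgnVec e (i + 2 + 2) = c at s3 ⊢
  linear_combination (b * b * c * c * (x i - 2 * z i)) * s1 + (c * c * (x i - 2 * z i)) * s2 +
    (x i - 2 * z i) * s3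

theorem rot_ne_one (z : Fin 3 → ℤ) (e : Fin 3 → Bool) : rot z e ≠ Op.one := fun h => by
  have h1 : (2 : Fin 3) = 0 := congrArg (fun o : Op => o.r0.j) h
  exact absurd h1 (by decide)

theorem rot_fixes (z : Fin 3 → ℤ) (e : Fin 3 → Bool) (s : ℝ) :
    (rot z e).act ((2 : ℝ) • intVec z + s • sgnVec e) = (2 : ℝ) • intVec z + s • sgnVec e := by
  ext i
  have s2 := sgnVec_mul_self e (i + 2)
  rw [rot_act]
  simp only [PiLp.add_apply, PiLp.smul_apply, smul_eq_mul, intVec_apply]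
  linear_combination s * sgnVec e i * s2

theorem order_three {φ : E3 ≃ᵈ E3} {g : Isom3} {o : Op} (hg : ∀ x, g (φ x) = φ (o.act x))
    (h3 : o.mul (o.mul o) = Op.one) (h1 : o ≠ Op.one) : orderOf g = 3 := by
  refine orderOf_eq_prime ?_ fun h => h1 (op_unique hg fun x => by rw [h, isom_one])
  rw [pow_succ, pow_two, mul_assoc]
  refine isom_ext φ fun x => ?_
  rw [isom_mul hg (isom_mul hg hg), h3, isom_one]

theorem cube_of_order_three {φ : E3 ≃ᵈ E3} {g : Isom3} {o : Op} (hg : ∀ x, g (φ x) = φ (o.act x))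
    (h3 : orderOf g = 3) : o.mul (o.mul o) = Op.one := by
  have h := pow_orderOf_eq_one g
  rw [h3, pow_succ, pow_two, mul_assoc] at h
  refine op_unique (isom_mul hg (isom_mul hg hg)) fun x => ?_
  rw [h, isom_one]

theorem isMask_one : IsMask 1 := by
  refine ⟨by decide, ?_, ?_⟩ <;> decide

/-- The threefold rotations generate all of class zero: quotients of rotations about parallel axes
are translations, and quotients of rotations about different diagonals through the origin are
half-turns about the axes. -/
theorem hasMask_one {φ : E3 ≃ᵈ E3} {S : Set Isom3}
    (hS : ∀ g ∈ S, ∃ o, InM 1 o ∧ ∀ x, g (φ x) = φ (o.act x))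
    (hrot : ∀ z e, OpIn φ (Subgroup.closure S) (rot z e)) : HasMask φ (Subgroup.closure S) 1 := by
  have hdiag : ∀ e, OpIn φ (Subgroup.closure S) ((rot 0 e).mul (rot 0 fun _ => false).inv) :=
    fun e => (hrot 0 e).mul (hrot 0 _).inv
  have htr : ∀ z e, OpIn φ (Subgroup.closure S) ((rot z e).mul (rot 0 e).inv) :=
    fun z e => (hrot z e).mul (hrot 0 e).inv
  -- For the linear part `A` of the rotation the quotient is the translation by `2 z - 2 A z`; the
  -- chosen `z` and signs yield the three generators of the face centered lattice.
  refine hasMask_closure isMask_one hS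
    (htr ![1, 0, 0] ![true, false, false]) (htr ![0, 0, 1] ![true, false, false])
    (htr ![0, 1, 0] ![false, true, false])
    (hdiag ![true, false, false]) (hdiag ![false, false, true])
    (hrot 0 fun _ => false) (C := []) (by simp) (by decide)

theorem linear_cube {g : Isom3} {p : E3} (hp : g p = p) (h3 : orderOf g = 3) :
    (∀ v, g.linearIsometryEquiv (g.linearIsometryEquiv (g.linearIsometryEquiv v)) = v) ∧
      ∃ v, g.linearIsometryEquiv v ≠ v := by
  have hl : ∀ v, g.linearIsometryEquiv v = g (p + v) - p := fun v => by
    rw [isom_add, hp, add_sub_cancel_left]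
  have h := pow_orderOf_eq_one g
  rw [h3, pow_succ, pow_two, mul_assoc] at h
  have hg : ∀ y, g (g (g y)) = y := fun y => congrArg (fun k : Isom3 => k y) h
  constructor
  · intro v
    rw [hl v, hl (g (p + v) - p), add_sub_cancel, hl, add_sub_cancel, hg, add_sub_cancel_left]
  · by_contra hcon
    push Not at hcon
    have : g = 1 := by
      ext1 y
      have := isom_add g p (y - p)
      rw [hcon, hp, add_sub_cancel] at this
      exact this
    rw [this, orderOf_one] at h3
    omega

theorem half_ne_zero : (1 / 2 : ℝ) ≠ 0 := by norm_num

/-- A rotation of order three about a diagonal has only two possible linear parts by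
`threefold_linear`, so each generator of `R1` is `rot z e` or its inverse. The factor 1/2 doubles
the coordinates. -/
theorem hasMask_R1 : HasMask (scaleDil (1 / 2) half_ne_zero 0) R1 1 := by
  set φ := scaleDil (1 / 2) half_ne_zero 0 with hφ
  have hφa : ∀ x i, φ x i = x i / 2 := fun x i => by
    rw [hφ, scaleDil_apply]
    simp
    ring
  have hφa' : ∀ x : E3, φ ((2 : ℝ) • x) = x := fun x => by
    ext i
    rw [hφa]
    simp
  refine hasMask_one ?_ ?_
  · rintro g ⟨z, ε, h3, hfix⟩
    obtain ⟨e, he⟩ : ∃ e : Fin 3 → Bool, (WithLp.toLp 2 fun i => ((ε i : ℤ) : ℝ)) = sgnVec e := by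
      refine ⟨fun i => decide (ε i = -1), ?_⟩
      ext i
      rcases Int.units_eq_one_or (ε i) with h | h <;> simp [sgnVec_apply, h]
    rw [he] at hfix
    change ∀ s : ℝ, g (intVec z + s • sgnVec e) = intVec z + s • sgnVec e at hfix
    have hz : g (intVec z) = intVec z := by simpa using hfix 0
    have hL : ∀ v, g (intVec z + v) = intVec z + g.linearIsometryEquiv v := fun v => by
      rw [isom_add, hz]
    have hd : g.linearIsometryEquiv (sgnVec e) = sgnVec e := by
      have h1 := hfix 1
      rw [one_smul, hL] at h1
      exact add_left_cancel h1
    obtain ⟨c1, c2⟩ := linear_cube hz h3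
    have hv := rot_valid z e
    rcases threefold_linear c1 c2 (sgnVec_mul_self e) hd with hf | hf
    · refine ⟨rot z e, ⟨hv.1, by rw [hv.2]; rfl⟩, fun x => ?_⟩
      have h1 : φ x = intVec z + (φ x - intVec z) := by abel
      rw [h1, hL]
      ext i
      rw [PiLp.add_apply, hf, hφa, rot_act, PiLp.sub_apply, hφa, intVec_apply, intVec_apply]
      ring
    · refine ⟨(rot z e).inv, ⟨hv.1.inv, by rw [Op.cls_inv hv.1, hv.2]; rfl⟩, fun x => ?_⟩
      obtain ⟨y, rfl⟩ : ∃ y, x = (rot z e).act y := ⟨_, (hv.1.1.act_inv x).symm⟩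
      rw [hv.1.1.inv_act]
      have h1 : φ ((rot z e).act y) = intVec z + (φ ((rot z e).act y) - intVec z) := by abel
      rw [h1, hL]
      ext i
      have hi : i + 1 + 2 = i := by revert i; decide
      have s1 := sgnVec_mul_self e i
      have s2 := sgnVec_mul_self e (i + 1)
      rw [PiLp.add_apply, hf, hφa, PiLp.sub_apply, hφa, rot_act, intVec_apply, intVec_apply, hi]
      linear_combination (sgnVec e (i + 1) * sgnVec e (i + 1) * (y i - 2 * z i) / 2) * s1 +
        (y i - 2 * z i) / 2 * s2
  · intro z e
    have hv := rot_valid z e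
    have hg := Op.isoVia_apply φ hv.1.1
    refine ⟨hv.1, _, Subgroup.subset_closure ⟨z, fun i => bif e i then -1 else 1,
      order_three hg (rot_cube z e) (rot_ne_one z e), fun s => ?_⟩, hg⟩
    have he : (WithLp.toLp 2 fun i => (((bif e i then -1 else 1 : ℤˣ) : ℤ) : ℝ)) = sgnVec e := by
      ext i
      rw [sgnVec_apply]
      cases h : e i <;> simp [h]
    rw [he]
    change (rot z e).isoVia φ _ (intVec z + s • sgnVec e) = intVec z + s • sgnVec e
    rw [← hφa' (intVec z + s • sgnVec e), hg, smul_add, smul_smul, rot_fixes]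

theorem cls_zero_of_cube : ∀ c < 16, mulC c (mulC c c) = 0 → c = 0 := by decide

/-- The class of an element of order three has trivial cube in a group of order 16 and is zero;
conversely all rotations `rot z e` have class zero and hence belong to `G`. -/
theorem HasMask.oddSubgroup {φ : E3 ≃ᵈ E3} {G : Subgroup Isom3} {m : ℕ} (h : HasMask φ G m) :
    HasMask φ (oddSubgroup G) 1 := by
  refine hasMask_one ?_ ?_
  · rintro g ⟨hg, x, d, -, h3, -⟩
    obtain ⟨o, ho, hgo⟩ := (h.2 g).1 hg
    refine ⟨o, ⟨ho.1, ?_⟩, hgo⟩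
    have h1 := congrArg Op.cls (cube_of_order_three hgo h3)
    rw [Op.cls_mul ho.1 (ho.1.mul ho.1), Op.cls_mul ho.1 ho.1, Op.cls_one] at h1
    rw [cls_zero_of_cube _ o.cls_lt h1]
    rfl
  · intro z e
    have hv := rot_valid z e
    have hg := Op.isoVia_apply φ hv.1.1
    obtain ⟨r, U, hr, hU⟩ := exists_linear φ
    refine ⟨hv.1, _, Subgroup.subset_closure ⟨(h.mem_iff hg).2 ⟨hv.1, by
      rw [hv.2]; exact h.isMask.zero⟩, φ ((2 : ℝ) • intVec z), U (sgnVec e), ?_,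
      order_three hg (rot_cube z e) (rot_ne_one z e), fun s => ?_⟩, hg⟩
    · intro h0
      have h1 : sgnVec e = 0 := by
        rw [← U.map_zero] at h0
        exact U.injective h0
      have h2 := sgnVec_mul_self e 0
      rw [h1] at h2
      simp at h2
    · have h1 : φ ((2 : ℝ) • intVec z) + s • U (sgnVec e) =
          φ ((2 : ℝ) • intVec z + (s / r) • sgnVec e) := by
        rw [hU, U.map_smul, smul_smul, mul_div_cancel₀ _ hr.ne']
      rw [h1, hg, rot_fixes]

end Cubic

namespace Cubic

/-! ### Full cubic groups are given by sets of classes -/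

theorem oddSubgroup_conj {G : Subgroup Isom3} {g n : Isom3} (hg : g ∈ G) (hn : n ∈ oddSubgroup G) :
    g * n * g⁻¹ ∈ oddSubgroup G := by
  unfold oddSubgroup at hn
  induction hn using Subgroup.closure_induction with
  | mem n hn =>
    obtain ⟨hnG, x, d, hd, h3, hfix⟩ := hn
    refine Subgroup.subset_closure ⟨G.mul_mem (G.mul_mem hg hnG) (G.inv_mem hg), g x,
      g.linearIsometryEquiv d, ?_, ?_, fun s => ?_⟩
    · intro h0
      rw [← g.linearIsometryEquiv.map_zero] at h0
      exact hd (g.linearIsometryEquiv.injective h0)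
    · exact (orderOf_injective (MulAut.conj g).toMonoidHom (MulAut.conj g).injective n).trans h3
    · have h1 : g x + s • g.linearIsometryEquiv d = g (x + s • d) := by
        rw [isom_add, map_smul]
      rw [h1]
      have h2 : g⁻¹ (g (x + s • d)) = x + s • d := g.symm_apply_apply _
      rw [AffineIsometryEquiv.coe_mul, AffineIsometryEquiv.coe_mul, Function.comp_apply,
        Function.comp_apply, h2, hfix]
  | one => rw [mul_one, mul_inv_cancel]; exact Subgroup.one_mem _
  | mul a b _ _ iha ihb =>
    have : g * (a * b) * g⁻¹ = (g * a * g⁻¹) * (g * b * g⁻¹) := by group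
    rw [this]
    exact Subgroup.mul_mem _ iha ihb
  | inv a _ ih =>
    have : g * a⁻¹ * g⁻¹ = (g * a * g⁻¹)⁻¹ := by group
    rw [this]
    exact Subgroup.inv_mem _ ih

/-- The isometry `h` normalizes the group of operations of class zero. -/
def Normalizes (h : Isom3) : Prop := ∀ n, InM 1 n → ∃ n', InM 1 n' ∧ ∀ x, h (n.act x) = n'.act (h x)

theorem exists_normalizes {φ : E3 ≃ᵈ E3} {G : Subgroup Isom3} (hφ : HasMask φ (oddSubgroup G) 1)
    {g : Isom3} (hg : g ∈ G) : ∃ h : Isom3, (∀ x, g (φ x) = φ (h x)) ∧ Normalizes h := by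
  have hh := conjIso_apply φ.symm g g.symm g.apply_symm_apply (fun x y => g.dist_map x y)
  set h := conjIso φ.symm g g.symm g.apply_symm_apply (fun x y => g.dist_map x y)
  have hgh : ∀ x, g (φ x) = φ (h x) := fun x => by
    have := hh (φ x)
    rw [φ.symm_apply_apply] at this
    rw [this, φ.apply_symm_apply]
  refine ⟨h, hgh, fun n hn => ?_⟩
  have hnm := (hφ.mem_iff (Op.isoVia_apply φ hn.1.1)).2 hn
  obtain ⟨n', hn', hact⟩ := (hφ.2 _).1 (oddSubgroup_conj hg hnm)
  refine ⟨n', hn', fun x => φ.injective ?_⟩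
  rw [← hact, ← hgh, ← hgh, ← Op.isoVia_apply φ hn.1.1]
  have h2 : g⁻¹ (g (φ x)) = φ x := g.symm_apply_apply _
  rw [AffineIsometryEquiv.coe_mul, AffineIsometryEquiv.coe_mul, Function.comp_apply,
        Function.comp_apply, h2]

theorem inM_one_iff {n : Op} (h : InM 1 n) : n.r0.t % 2 = 0 ∧ n.r1.t % 2 = 0 ∧ n.r2.t % 2 = 0 ∧
    (n.r0.t + n.r1.t + n.r2.t) % 4 = 0 := by
  obtain ⟨⟨-, h1, h2⟩, h3⟩ := h
  have h4 : ∀ c < 16, Nat.testBit 1 c = true → c = 0 := by decide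
  have h5 := h4 _ n.cls_lt h3
  rw [Op.cls_eq] at h5
  have h6 : (n.tsum % 4).toNat = 0 := by omega
  rw [Op.tsum] at h6
  omega

theorem act_zero (n : Op) (i : Fin 3) : n.act 0 i = (n.row i).t := by
  rw [Op.act_apply, Row.eval_eq_mul]
  simp

theorem int_sq_sum_four {a b c : ℤ} (h : a * a + b * b + c * c = 4) :
    (a * a = 4 ∧ b = 0 ∧ c = 0) ∨ (a = 0 ∧ b * b = 4 ∧ c = 0) ∨ (a = 0 ∧ b = 0 ∧ c * c = 4) := by
  have ha : -2 ≤ a ∧ a ≤ 2 := by constructor <;> nlinarith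
  have hb : -2 ≤ b ∧ b ≤ 2 := by constructor <;> nlinarith
  have hc : -2 ≤ c ∧ c ≤ 2 := by constructor <;> nlinarith
  obtain ⟨a1, a2⟩ := ha
  obtain ⟨b1, b2⟩ := hb
  obtain ⟨c1, c2⟩ := hc
  interval_cases a <;> interval_cases b <;> interval_cases c <;> simp_all

theorem exists_single_of_sq {y : E3} {j : Fin 3} (h0 : ∀ k, k ≠ j → y k = 0) (h1 : y j * y j = 1) :
    ∃ b : Bool, y = (bif b then (-1 : ℝ) else 1) • EuclideanSpace.single j (1 : ℝ) := by
  have : y j = 1 ∨ y j = -1 := mul_self_eq_one_iff.1 h1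
  rcases this with h | h
  · refine ⟨false, ?_⟩
    ext k
    by_cases hk : k = j
    · subst hk; simp [h]
    · simp [h0 k hk, hk]
  · refine ⟨true, ?_⟩
    ext k
    by_cases hk : k = j
    · subst hk; simp [h]
    · simp [h0 k hk, hk]

/-- The linear part of `h` permutes the coordinate axes. -/
theorem Normalizes.linear_single {h : Isom3} (hh : Normalizes h) (i : Fin 3) : ∃ (j : Fin 3) (b : Bool),
    h.linearIsometryEquiv (EuclideanSpace.single i 1) =
      (bif b then (-1 : ℝ) else 1) • EuclideanSpace.single j (1 : ℝ) := by
  -- The translation by 4 along an axis is conjugated by `h` into a translation of class zero, along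
  -- the image of the axis.
  obtain ⟨n, hn, hact⟩ : ∃ n, InM 1 n ∧ ∀ x, n.act x = x + (4 : ℝ) • EuclideanSpace.single i (1 : ℝ) := by
    fin_cases i
    · refine ⟨translation 4 0 0, by exact ⟨by decide, by decide⟩, fun x => ?_⟩
      ext k
      fin_cases k <;> simp [translation, Row.eval]
    · refine ⟨translation 0 4 0, by exact ⟨by decide, by decide⟩, fun x => ?_⟩
      ext k
      fin_cases k <;> simp [translation, Row.eval]
    · refine ⟨translation 0 0 4, by exact ⟨by decide, by decide⟩, fun x => ?_⟩
      ext k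
      fin_cases k <;> simp [translation, Row.eval]
  obtain ⟨n', hn', hact'⟩ := hh n hn
  set y := h.linearIsometryEquiv (EuclideanSpace.single i 1) with hy
  have h1 : ∀ z, n'.act z = z + (4 : ℝ) • y := by
    intro z
    have h2 := hact' (h.symm z)
    rw [hact, isom_add, h.apply_symm_apply, map_smul] at h2
    exact h2.symm
  have h2 : ∀ k, ((n'.row k).t : ℝ) = 4 * y k := by
    intro k
    rw [← act_zero, h1]
    simp
  have hnorm : y 0 * y 0 + y 1 * y 1 + y 2 * y 2 = 1 := by
    rw [← inner_eq_sum, hy, LinearIsometryEquiv.inner_map_map]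
    simp
  obtain ⟨e0, e1, e2, -⟩ := inM_one_iff hn'
  obtain ⟨a, ha⟩ := Int.dvd_of_emod_eq_zero e0
  obtain ⟨b, hb⟩ := Int.dvd_of_emod_eq_zero e1
  obtain ⟨c, hc⟩ := Int.dvd_of_emod_eq_zero e2
  have k0 : (a : ℝ) = 2 * y 0 := by
    have := h2 0
    rw [Op.row_zero, ha] at this
    push_cast at this
    linarith
  have k1 : (b : ℝ) = 2 * y 1 := by
    have := h2 1
    rw [Op.row_one, hb] at this
    push_cast at this
    linarith
  have k2 : (c : ℝ) = 2 * y 2 := by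
    have := h2 2
    rw [Op.row_two, hc] at this
    push_cast at this
    linarith
  -- The components of the conjugate translation are even with squares adding up to 16. Their halves
  -- are integers with squares adding up to 4, so just one of them is nonzero.
  have hsum : a * a + b * b + c * c = 4 := by
    have : (a : ℝ) * a + b * b + c * c = 4 := by rw [k0, k1, k2]; linarith
    exact_mod_cast this
  rcases int_sq_sum_four hsum with ⟨-, p, q⟩ | ⟨p, -, q⟩ | ⟨p, q, -⟩
  · rw [p, Int.cast_zero] at k1
    rw [q, Int.cast_zero] at k2
    have z1 : y 1 = 0 := by linarith
    have z2 : y 2 = 0 := by linarith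
    refine ⟨0, exists_single_of_sq (fun k hk => ?_) (by rw [z1, z2] at hnorm; linarith)⟩
    fin_cases k
    · exact absurd rfl hk
    · exact z1
    · exact z2
  · rw [p, Int.cast_zero] at k0
    rw [q, Int.cast_zero] at k2
    have z1 : y 0 = 0 := by linarith
    have z2 : y 2 = 0 := by linarith
    refine ⟨1, exists_single_of_sq (fun k hk => ?_) (by rw [z1, z2] at hnorm; linarith)⟩
    fin_cases k
    · exact z1
    · exact absurd rfl hk
    · exact z2
  · rw [p, Int.cast_zero] at k0
    rw [q, Int.cast_zero] at k1
    have z1 : y 0 = 0 := by linarith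
    have z2 : y 1 = 0 := by linarith
    refine ⟨2, exists_single_of_sq (fun k hk => ?_) (by rw [z1, z2] at hnorm; linarith)⟩
    fin_cases k
    · exact z1
    · exact z2
    · exact absurd rfl hk

theorem diag_act (a b c : Bool) (x : E3) (i : Fin 3) :
    (diag a b c).act x i = (bif ![a, b, c] i then -1 else 1) * x i := by
  fin_cases i
  · cases a <;> simp [diag, Row.eval]
  · cases b <;> simp [diag, Row.eval]
  · cases c <;> simp [diag, Row.eval]

theorem exists_diag (k : Fin 3) :
    ∃ n, InM 1 n ∧ ∀ x i, n.act x i = (if i = k then (1 : ℝ) else -1) * x i := by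
  fin_cases k
  · refine ⟨diag false true true, by exact ⟨by decide, by decide⟩, fun x i => ?_⟩
    rw [diag_act]
    fin_cases i <;> simp
  · refine ⟨diag true false true, by exact ⟨by decide, by decide⟩, fun x i => ?_⟩
    rw [diag_act]
    fin_cases i <;> simp
  · refine ⟨diag true true false, by exact ⟨by decide, by decide⟩, fun x i => ?_⟩
    rw [diag_act]
    fin_cases i <;> simp

/-- An isometry that normalizes the group of operations of class zero is a valid operation. -/
theorem Normalizes.exists_op {h h' : Isom3} (hh : Normalizes h) (hh' : Normalizes h')
    (hinv : ∀ x, h (h' x) = x) : ∃ o : Op, o.Valid ∧ ∀ x, h x = o.act x := by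
  choose j b hjb using hh'.linear_single
  let s : Fin 3 → ℝ := fun i => bif b i then (-1 : ℝ) else 1
  have hs : ∀ i, s i * s i = 1 := fun i => by
    simp only [s]
    cases b i <;> simp
  have hlin : ∀ v, h.linearIsometryEquiv (h'.linearIsometryEquiv v) = v := by
    intro v
    have h1 := hinv (0 + v)
    rw [isom_add, isom_add, hinv] at h1
    exact add_left_cancel h1
  have hA : ∀ x i, h.linearIsometryEquiv x i = s i * x (j i) := by
    intro x i
    have h1 : h.linearIsometryEquiv x i =
        inner ℝ (EuclideanSpace.single i (1 : ℝ)) (h.linearIsometryEquiv x) := by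
      simp [EuclideanSpace.inner_single_left]
    rw [h1, ← hlin (EuclideanSpace.single i (1 : ℝ)), LinearIsometryEquiv.inner_map_map, hjb,
      inner_smul_left]
    simp [EuclideanSpace.inner_single_left, s]
  have hinj : ∀ i k, i ≠ k → j i ≠ j k := by
    intro i k hik hjk
    have h1 := h'.linearIsometryEquiv.inner_map_map (EuclideanSpace.single i (1 : ℝ))
      (EuclideanSpace.single k (1 : ℝ))
    rw [hjb, hjb, hjk, inner_smul_left, inner_smul_right] at h1
    simp only [EuclideanSpace.inner_single_left, PiLp.single_apply, hik] at h1
    cases hb : b i <;> cases hb' : b k <;> simp [hb, hb'] at h1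
  set t : E3 := h 0 with ht
  have hx : ∀ x i, h x i = s i * x (j i) + t i := by
    intro x i
    have h1 := isom_add h 0 x
    rw [zero_add] at h1
    rw [h1, PiLp.add_apply, hA, add_comm]
  -- Conjugating the half-turn about axis `k` produces the translation part `2 t i` in the two
  -- coordinates that do not read axis `k`, and 0 in the third. Being of class zero, it has even
  -- entries with sum divisible by 4.
  have key : ∀ k, ∃ T : Fin 3 → ℤ, (∀ i, T i % 2 = 0) ∧ (T 0 + T 1 + T 2) % 4 = 0 ∧
      ∀ i, (T i : ℝ) = if j i = k then 0 else 2 * t i := by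
    intro k
    obtain ⟨n, hn, hna⟩ := exists_diag k
    obtain ⟨n', hn', hact⟩ := hh n hn
    obtain ⟨e0, e1, e2, e3⟩ := inM_one_iff hn'
    refine ⟨fun i => (n'.row i).t, ?_, e3, fun i => ?_⟩
    · intro i
      fin_cases i
      · exact e0
      · exact e1
      · exact e2
    · have hy : h (h' 0) = 0 := hinv 0
      have h1 := congrArg (fun y : E3 => y i) (hact (h' 0))
      have h2 := hx (h' 0) i
      simp only [hy, act_zero, hx, hna] at h1 h2
      rw [← h1]
      simp only [PiLp.zero_apply] at h2
      by_cases hk : j i = k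
      · simp only [hk, if_true] at h2 ⊢
        linarith
      · simp only [hk, if_false]
        linarith
  -- Two half-turns suffice: the first makes `t 0` and `t 1` integers with even sum, the second does
  -- the same for `t 0` and `t 2`. All three therefore have equal parity.
  obtain ⟨T, hT1, hT2, hT⟩ := key (j 2)
  obtain ⟨T', hT1', hT2', hT'⟩ := key (j 1)
  obtain ⟨a, ha⟩ := Int.dvd_of_emod_eq_zero (hT1 0)
  obtain ⟨c, hc⟩ := Int.dvd_of_emod_eq_zero (hT1 1)
  obtain ⟨d, hd⟩ := Int.dvd_of_emod_eq_zero (hT1' 2)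
  have t0 := hT 0
  have t1 := hT 1
  have t2 := hT 2
  have t0' := hT' 0
  have t1' := hT' 1
  have t2' := hT' 2
  rw [if_neg (hinj 0 2 (by decide)), ha] at t0
  rw [if_neg (hinj 1 2 (by decide)), hc] at t1
  rw [if_pos rfl] at t2
  rw [if_neg (hinj 0 1 (by decide))] at t0'
  rw [if_pos rfl] at t1'
  rw [if_neg (hinj 2 1 (by decide)), hd] at t2'
  have z2 : T 2 = 0 := by exact_mod_cast t2
  have z1' : T' 1 = 0 := by exact_mod_cast t1'
  push_cast at t0 t1 t2'
  have z0' : T' 0 = 2 * a := by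
    have : (T' 0 : ℝ) = 2 * a := by linarith
    exact_mod_cast this
  refine ⟨⟨⟨j 0, b 0, a⟩, ⟨j 1, b 1, c⟩, ⟨j 2, b 2, d⟩⟩,
    ⟨⟨hinj 0 1 (by decide), hinj 0 2 (by decide), hinj 1 2 (by decide)⟩, ?_, ?_⟩, fun x => ?_⟩
  · simp only
    omega
  · simp only
    omega
  · ext i
    rw [hx, Op.act_apply, Row.eval_eq_mul]
    fin_cases i
    · simp only [s, Fin.zero_eta, Op.row_zero]
      linarith
    · simp only [s, Fin.mk_one, Op.row_one]
      linarith
    · change s 2 * x (j 2) + t 2 = s 2 * x (j 2) + d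
      linarith

/-- Every element of `G` normalizes the odd subgroup, which is `R1` in suitable coordinates, and so
is a valid operation; all of class zero is contained in the odd subgroup and hence in `G`. -/
theorem IsFullCubic.exists_hasMask {G : Subgroup Isom3} (hG : IsFullCubic G) :
    ∃ φ m, HasMask φ G m := by
  obtain ⟨ψ, hψ⟩ := hG.2
  have hφ := hasMask_R1.trans hψ
  set φ := (scaleDil (1 / 2) half_ne_zero 0).trans ψ
  refine ⟨φ, Cubic.exists_hasMask (fun g hg => ?_) fun o ho hcls => ?_⟩
  · obtain ⟨h, hgh, hn⟩ := exists_normalizes hφ hg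
    obtain ⟨h', hgh', hn'⟩ := exists_normalizes hφ (G.inv_mem hg)
    obtain ⟨o, ho, hact⟩ := hn.exists_op hn' fun x => φ.injective (by
      rw [← hgh, ← hgh']
      exact g.apply_symm_apply _)
    exact ⟨o, ho, fun x => by rw [hgh, hact]⟩
  · have h1 : InM 1 o := ⟨ho, by rw [hcls]; rfl⟩
    have h2 := (hφ.mem_iff (Op.isoVia_apply φ ho.1)).2 h1
    refine ⟨ho, _, ?_, Op.isoVia_apply φ ho.1⟩
    have hle : oddSubgroup G ≤ G := by
      unfold oddSubgroup
      rw [Subgroup.closure_le]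
      exact fun g hg => hg.1
    exact hle h2

end Cubic

namespace Cubic

/-! ### Groups that are given by sets of classes are full cubic -/

theorem constVAdd_apply (v x : E3) : AffineIsometryEquiv.constVAdd ℝ E3 v x = x + v := by
  change v + x = x + v
  rw [add_comm]

/-- The vectors of the translations in `G`. -/
def latticeOf (G : Subgroup Isom3) : AddSubgroup E3 where
  carrier := {v | ∀ g : Isom3, (∀ x, g x = x + v) → g ∈ G}
  zero_mem' := fun g hg => by
    have : g = 1 := by
      ext1 x
      rw [hg, add_zero]
      rfl
    rw [this]
    exact G.one_mem
  add_mem' := by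
    intro v w hv hw g hg
    have h1 := hv _ (constVAdd_apply v)
    have h2 := hw _ (constVAdd_apply w)
    have : g = AffineIsometryEquiv.constVAdd ℝ E3 w * AffineIsometryEquiv.constVAdd ℝ E3 v := by
      ext1 x
      rw [hg, AffineIsometryEquiv.coe_mul, Function.comp_apply, constVAdd_apply, constVAdd_apply,
        add_assoc]
    rw [this]
    exact G.mul_mem h2 h1
  neg_mem' := by
    intro v hv g hg
    rw [← G.inv_mem_iff]
    refine hv _ fun x => g.injective ?_
    rw [hg (x + v), add_neg_cancel_right]
    exact g.apply_symm_apply x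

theorem HasMask.isCrystallographic {φ : E3 ≃ᵈ E3} {G : Subgroup Isom3} {m : ℕ} (h : HasMask φ G m) :
    IsCrystallographic G := by
  obtain ⟨r, U, hr, hU⟩ := exists_linear φ
  have hr4 : 4 * r ≠ 0 := by positivity
  let b : Module.Basis (Fin 3) ℝ E3 := (EuclideanSpace.basisFun (Fin 3) ℝ).toBasis.map
    (U.toLinearEquiv.trans (LinearEquiv.smulOfNeZero ℝ E3 (4 * r) hr4))
  have hb : ∀ i, b i = (4 * r) • U (EuclideanSpace.single i 1) := by
    intro i
    have : b i = (4 * r) • U (EuclideanSpace.basisFun (Fin 3) ℝ i) := by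
      rw [Module.Basis.map_apply, OrthonormalBasis.coe_toBasis]
      rfl
    rw [this, EuclideanSpace.basisFun_apply]
  have hstep : ∀ (k : Fin 3 → ℤ) (x : E3),
      φ (x + (4 : ℝ) • intVec k) = φ x + (k 0 • b 0 + k 1 • b 1 + k 2 • b 2) := by
    intro k x
    have e : intVec k = (k 0 : ℝ) • EuclideanSpace.single 0 (1 : ℝ) +
        (k 1 : ℝ) • EuclideanSpace.single 1 (1 : ℝ) +
        (k 2 : ℝ) • EuclideanSpace.single 2 (1 : ℝ) := by
      ext i
      rw [intVec_apply]
      fin_cases i <;> simp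
    rw [hU, e, map_smul, map_add, map_add, map_smul, map_smul, map_smul, hb, hb, hb]
    congr 1
    simp only [← Int.cast_smul_eq_zsmul ℝ, smul_add, smul_smul]
    congr 1
    · congr 1 <;> congr 1 <;> ring
    · congr 1
      ring
  refine ⟨Submodule.span ℤ (Set.range b), inferInstance, inferInstance, ?_, ?_⟩
  · have hle : Submodule.span ℤ (Set.range b) ≤ AddSubgroup.toIntSubmodule (latticeOf G) := by
      rw [Submodule.span_le]
      rintro _ ⟨i, rfl⟩ g hg
      have hact : ∀ x, (translation (4 * if i = 0 then 1 else 0) (4 * if i = 1 then 1 else 0)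
          (4 * if i = 2 then 1 else 0)).act x =
            x + (4 : ℝ) • intVec fun j => if i = j then 1 else 0 := by
        intro x
        ext j
        fin_cases j <;> simp [translation, Row.eval, intVec_apply]
      refine (h.mem_iff (o := translation (4 * if i = 0 then 1 else 0) (4 * if i = 1 then 1 else 0)
        (4 * if i = 2 then 1 else 0)) fun x => ?_).2 ⟨translation_valid (by omega) (by omega) (by omega), by
          rw [translation_cls (by omega)]; exact h.isMask.zero⟩
      rw [hg, hact, hstep]
      congr 1
      fin_cases i <;> simp
    rintro g ⟨v, hv, hg⟩
    exact hle hv g hg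
  · have : Inhabited Op := ⟨Op.one⟩
    choose! o ho hgo using fun g => (h.2 g).1
    -- Operations that agree modulo 4 differ by a translation by a vector with components divisible
    -- by 4, so finitely many residues separate the cosets. Inverses are used because the
    -- translation has to stand on the left of `g'⁻¹`.
    let F : G → (Fin 3 × Bool × ZMod 4) × (Fin 3 × Bool × ZMod 4) × (Fin 3 × Bool × ZMod 4) :=
      fun g => ((((o (g : Isom3)⁻¹).r0.j, (o (g : Isom3)⁻¹).r0.neg, (o (g : Isom3)⁻¹).r0.t)),
        (((o (g : Isom3)⁻¹).r1.j, (o (g : Isom3)⁻¹).r1.neg, (o (g : Isom3)⁻¹).r1.t)),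
        (((o (g : Isom3)⁻¹).r2.j, (o (g : Isom3)⁻¹).r2.neg, (o (g : Isom3)⁻¹).r2.t)))
    have hF : ∀ g g' : G, F g = F g' →
        g⁻¹ * g' ∈ (translationsBy (Submodule.span ℤ (Set.range b))).subgroupOf G := by
      rintro ⟨g, hg⟩ ⟨g', hg'⟩ hgg
      have o1 := hgo _ (G.inv_mem hg)
      have o2 := hgo _ (G.inv_mem hg')
      simp only [F, Prod.mk.injEq] at hgg
      generalize o g⁻¹ = p at o1 hgg
      generalize o g'⁻¹ = q at o2 hgg
      obtain ⟨⟨j0, n0, t0⟩, ⟨j1, n1, t1⟩, ⟨j2, n2, t2⟩⟩ := hgg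
      rw [eq_comm, ZMod.intCast_eq_intCast_iff_dvd_sub] at t0 t1 t2
      obtain ⟨k0, hk0⟩ := t0
      obtain ⟨k1, hk1⟩ := t1
      obtain ⟨k2, hk2⟩ := t2
      have hpq : ∀ x, p.act x = q.act x + (4 : ℝ) • intVec ![k0, k1, k2] := by
        intro x
        have c0 : (p.r0.t : ℝ) - q.r0.t = 4 * k0 := by exact_mod_cast hk0
        have c1 : (p.r1.t : ℝ) - q.r1.t = 4 * k1 := by exact_mod_cast hk1
        have c2 : (p.r2.t : ℝ) - q.r2.t = 4 * k2 := by exact_mod_cast hk2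
        ext i
        rw [PiLp.add_apply, PiLp.smul_apply, intVec_apply, Op.act_apply, Op.act_apply, smul_eq_mul,
          Row.eval_eq_mul, Row.eval_eq_mul]
        fin_cases i
        · simp only [Fin.zero_eta, Op.row_zero, j0, n0, Matrix.cons_val_zero]
          linarith
        · simp only [Fin.mk_one, Op.row_one, j1, n1, Matrix.cons_val]
          linarith
        · simp only [Fin.reduceFinMk, Op.row_two, j2, n2, Matrix.cons_val]
          linarith
      refine ⟨k0 • b 0 + k1 • b 1 + k2 • b 2, ?_, fun y => ?_⟩
      · have hm : ∀ i, b i ∈ Submodule.span ℤ (Set.range b) := fun i => Submodule.subset_span ⟨i, rfl⟩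
        exact Submodule.add_mem _ (Submodule.add_mem _ (Submodule.smul_mem _ _ (hm 0))
          (Submodule.smul_mem _ _ (hm 1))) (Submodule.smul_mem _ _ (hm 2))
      · change g⁻¹ (g' y) = _
        obtain ⟨x, hx⟩ := φ.surjective (g' y)
        have h1 : g'⁻¹ (g' y) = y := g'.symm_apply_apply y
        rw [← hx, o2] at h1
        rw [← hx, o1, hpq, hstep, h1]
        rfl
    have hfin : Finite (G ⧸ (translationsBy (Submodule.span ℤ (Set.range b))).subgroupOf G) := by
      refine Finite.of_injective (fun q => F q.out) fun q q' hqq => ?_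
      have h1 := hF _ _ hqq
      rw [← QuotientGroup.eq, QuotientGroup.out_eq', QuotientGroup.out_eq'] at h1
      exact h1
    exact Subgroup.index_ne_zero_of_finite

theorem HasMask.isCubic {φ : E3 ≃ᵈ E3} {G : Subgroup Isom3} {m : ℕ} (h : HasMask φ G m) :
    IsCubic G := by
  obtain ⟨r, U, hr, hU⟩ := exists_linear φ
  refine ⟨h.isCrystallographic, (EuclideanSpace.basisFun (Fin 3) ℝ).map U, fun ε => ?_⟩
  let e : Fin 3 → Bool := fun i => decide (ε i = -1)
  have hv := rot_valid 0 e
  have hg := Op.isoVia_apply φ hv.1.1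
  set g := (rot 0 e).isoVia φ hv.1.1
  have hsum : ∑ i, ((ε i : ℤ) : ℝ) • ((EuclideanSpace.basisFun (Fin 3) ℝ).map U) i = U (sgnVec e) := by
    have e1 : sgnVec e = ∑ i, ((ε i : ℤ) : ℝ) • EuclideanSpace.single i (1 : ℝ) := by
      ext j
      rw [Fin.sum_univ_three, sgnVec_apply]
      rcases Int.units_eq_one_or (ε j) with hj | hj <;> fin_cases j <;> simp_all [e]
    rw [e1, map_sum]
    refine Finset.sum_congr rfl fun i _ => ?_
    rw [map_smul]
    simp
  have h3 := order_three hg (rot_cube 0 e) (rot_ne_one 0 e)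
  have hf : ∀ s : ℝ, g (φ (0 + s • sgnVec e)) = φ (0 + s • sgnVec e) := by
    intro s
    rw [hg]
    have := rot_fixes 0 e s
    have h0 : (2 : ℝ) • intVec 0 = 0 := by ext i; simp [intVec_apply]
    rw [h0] at this
    rw [this]
  have hf0 : g (φ 0) = φ 0 := by
    have := hf 0
    rwa [zero_smul, add_zero] at this
  obtain ⟨c1, v, hv1⟩ := linear_cube hf0 h3
  refine ⟨g, (h.mem_iff hg).2 ⟨hv.1, by rw [hv.2]; exact h.isMask.zero⟩, ?_, ?_⟩
  · refine orderOf_eq_prime ?_ fun h1 => hv1 (by rw [h1]; rfl)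
    ext1 w
    rw [pow_succ, pow_two, mul_assoc]
    exact c1 w
  · rw [hsum]
    have h1 := hf r⁻¹
    rw [hU, U.map_smul, smul_smul, mul_inv_cancel₀ hr.ne', one_smul, isom_add, hf0] at h1
    exact add_left_cancel h1

theorem HasMask.isFullCubic {φ : E3 ≃ᵈ E3} {G : Subgroup Isom3} {m : ℕ} (h : HasMask φ G m) :
    IsFullCubic G :=
  ⟨h.isCubic, hasMask_R1.areSimilar h.oddSubgroup⟩

end Cubic

namespace Cubic

/-! ### Reflections -/

theorem isPlaneReflection_of_op {φ : E3 ≃ᵈ E3} {g : Isom3} {o : Op}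
    (hg : ∀ x, g (φ x) = φ (o.act x)) {n c : E3} (hn : n ≠ 0)
    (h : ∀ x, o.act x = x ↔ inner ℝ n (x - c) = 0) : IsPlaneReflection g := by
  obtain ⟨r, U, hr, hU⟩ := exists_linear φ
  have : Fact (Module.finrank ℝ E3 = 2 + 1) := ⟨by simp⟩
  refine ⟨AffineSubspace.mk' (φ c) (ℝ ∙ U n)ᗮ, ?_, fun y => ?_⟩
  · rw [AffineSubspace.direction_mk']
    refine Submodule.finrank_orthogonal_span_singleton fun h0 => hn ?_
    rw [← U.map_zero] at h0
    exact U.injective h0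
  · obtain ⟨x, rfl⟩ := φ.surjective y
    have h1 : φ x = φ c + r • U (x - c) := by rw [← hU, add_sub_cancel]
    rw [AffineSubspace.mem_mk', vsub_eq_sub, Submodule.mem_orthogonal_singleton_iff_inner_right, hg,
      φ.injective.eq_iff, h, h1, add_sub_cancel_left, inner_smul_right, U.inner_map_map]
    constructor
    · intro h2; rw [h2, mul_zero]
    · intro h2; exact (mul_eq_zero.1 h2).resolve_left hr.ne'

theorem single_ne_zero : EuclideanSpace.single (0 : Fin 3) (1 : ℝ) ≠ 0 := fun h => by
  have := congrArg (fun y : E3 => y 0) h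
  simp at this

/-- Each of the three classes contains a reflection: in the planes `x = 0`, `x = 1` and `x = y`, in
this order. -/
theorem HasMask.not_reflectionFree {φ : E3 ≃ᵈ E3} {G : Subgroup Isom3} {m : ℕ} (h : HasMask φ G m)
    (hm : Nat.testBit m 4 = true ∨ Nat.testBit m 6 = true ∨ Nat.testBit m 8 = true) :
    ¬ IsReflectionFree G := by
  intro hfree
  have key : ∀ (o : Op) (ho : o.Valid) (n c : E3), n ≠ 0 →
      (∀ x, o.act x = x ↔ inner ℝ n (x - c) = 0) → Nat.testBit m o.cls = true → False :=
    fun o ho n c hn hx hc => hfree _ ((h.mem_iff (Op.isoVia_apply φ ho.1)).2 ⟨ho, hc⟩)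
      (isPlaneReflection_of_op (Op.isoVia_apply φ ho.1) hn hx)
  rcases hm with hm | hm | hm
  · refine key (diag true false false) (by decide) (EuclideanSpace.single 0 1) 0 single_ne_zero
      (fun x => ?_) hm
    rw [EuclideanSpace.inner_single_left]
    constructor
    · intro hx
      have h0 := congrArg (fun y : E3 => y 0) hx
      simp [diag, Row.eval] at h0
      simp
      linarith
    · intro hx
      simp at hx
      ext i
      fin_cases i <;> simp [diag, Row.eval, hx]
  · refine key ⟨⟨0, true, 2⟩, ⟨1, false, 0⟩, ⟨2, false, 0⟩⟩ (by decide) (EuclideanSpace.single 0 1)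
      (EuclideanSpace.single 0 1) single_ne_zero (fun x => ?_) hm
    rw [EuclideanSpace.inner_single_left]
    constructor
    · intro hx
      have h0 := congrArg (fun y : E3 => y 0) hx
      simp [Row.eval] at h0
      simp
      linarith
    · intro hx
      simp at hx
      ext i
      fin_cases i
      · simp [Row.eval]
        linarith
      · simp [Row.eval]
      · simp [Row.eval]
  · refine key ⟨⟨1, false, 0⟩, ⟨0, false, 0⟩, ⟨2, false, 0⟩⟩ (by decide)
      (EuclideanSpace.single 0 1 - EuclideanSpace.single 1 1) 0 (fun h => ?_) (fun x => ?_) hm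
    · have := congrArg (fun y : E3 => y 0) h
      simp at this
    · rw [inner_sub_left, EuclideanSpace.inner_single_left, EuclideanSpace.inner_single_left]
      constructor
      · intro hx
        have h0 := congrArg (fun y : E3 => y 0) hx
        simp [Row.eval] at h0
        simp
        linarith
      · intro hx
        simp at hx
        have hx' : x 0 = x 1 := by linarith
        ext i
        fin_cases i <;> simp [Row.eval, hx']

theorem minors_ne_zero {u v : E3} (hu : u ≠ 0) (huv : ∀ c : ℝ, c • u ≠ v) :
    ¬ (u 0 * v 1 = u 1 * v 0 ∧ u 0 * v 2 = u 2 * v 0 ∧ u 1 * v 2 = u 2 * v 1) := by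
  rintro ⟨h01, h02, h12⟩
  obtain ⟨k, hk⟩ : ∃ k, u k ≠ 0 := by
    by_contra hcon
    push Not at hcon
    exact hu (by ext i; exact hcon i)
  refine huv (v k / u k) ?_
  have key : ∀ i, u k * v i = u i * v k := by
    intro i
    fin_cases k <;> fin_cases i <;> simp only [Fin.zero_eta, Fin.mk_one, Fin.reduceFinMk] <;> linarith
  ext i
  rw [PiLp.smul_apply, smul_eq_mul, div_mul_eq_mul_div, div_eq_iff hk]
  linarith [key i]

theorem int_zero {t : ℤ} (h : (t : ℝ) = 0) : t = 0 := by exact_mod_cast h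

theorem int_eq {s t : ℤ} (h : (s : ℝ) = t) : s = t := by exact_mod_cast h

/-- The rows exchange two coordinates and keep the third up to sign. If the third sign is negative,
or the first two signs differ, too many coordinates of the two directions in the plane vanish and
they are dependent. In the remaining case the translations are `t`, `± t` and 0; then `t` is even
and the sum, 0 or `2 t`, is divisible by 4. -/
theorem transposition {x y z x' y' z' a b c : ℝ} {n n' n'' : Bool} {t t' t'' : ℤ}
    (hx : x = (bif n then -1 else 1) * y) (hy : y = (bif n' then -1 else 1) * x)
    (hz : z = (bif n'' then -1 else 1) * z) (hx' : x' = (bif n then -1 else 1) * y')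
    (hy' : y' = (bif n' then -1 else 1) * x') (hz' : z' = (bif n'' then -1 else 1) * z')
    (ha : a = (bif n then -1 else 1) * b + t) (hb : b = (bif n' then -1 else 1) * a + t')
    (hc : c = (bif n'' then -1 else 1) * c + t'') (hmin : ¬ (x * z' = z * x' ∧ y * z' = z * y'))
    (h1 : t % 2 = t' % 2) (h2 : t % 2 = t'' % 2) :
    (t + t' + t'') % 4 = 0 ∧ xor n (xor n' n'') = false := by
  cases n''
  · have h3 : t'' = 0 := int_zero (by simp only [cond_false] at hc; linarith)
    have hne : ∀ s : ℝ, x = s * y → x' = s * y' → y = -s * x → y' = -s * x' → s * s = 1 → False := by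
      intro s e1 e2 e3 e4 e5
      have f1 : x = 0 := by
        have : x = -(s * s) * x := by linear_combination e1 + s * e3
        rw [e5] at this
        linarith
      have f2 : x' = 0 := by
        have : x' = -(s * s) * x' := by linear_combination e2 + s * e4
        rw [e5] at this
        linarith
      rw [f1, mul_zero] at e3
      rw [f2, mul_zero] at e4
      exact hmin (by simp [f1, f2, e3, e4])
    cases n <;> cases n' <;> simp only [cond_true, cond_false] at hx hy hx' hy' ha hb
    · have h4 : t' = -t := int_eq (by push_cast; linarith)
      exact ⟨by omega, rfl⟩
    · exact (hne 1 hx hx' hy hy' (by norm_num)).elim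
    · exact (hne (-1) hx hx' (by rw [neg_neg]; exact hy) (by rw [neg_neg]; exact hy')
        (by norm_num)).elim
    · have h4 : t' = t := int_eq (by linarith)
      exact ⟨by omega, rfl⟩
  · simp only [cond_true] at hz hz'
    have f1 : z = 0 := by linarith
    have f2 : z' = 0 := by linarith
    exact absurd (by simp [f1, f2]) hmin

/-- An operation other than the identity with a plane of fixed points either changes one sign, with
an even translation in that coordinate, or exchanges two axes. A cyclic permutation of the axes
fixes no two independent directions. -/
theorem cls_of_plane {o : Op} (ho : o.Valid) (h1 : o ≠ Op.one) {a u v : E3} (ha : o.act a = a)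
    (hu : o.act (a + u) = a + u) (hv : o.act (a + v) = a + v) (hu0 : u ≠ 0)
    (huv : ∀ c : ℝ, c • u ≠ v) : o.cls = 4 ∨ o.cls = 6 ∨ o.cls = 8 := by
  have hmin := minors_ne_zero hu0 huv
  have hlin : ∀ w : E3, o.act (a + w) = a + w → ∀ i,
      w i = (bif (o.row i).neg then -1 else 1) * w (o.row i).j := by
    intro w hw i
    have e1 := congrArg (fun y : E3 => y i) hw
    have e2 := congrArg (fun y : E3 => y i) ha
    simp only [Op.act_apply, Row.eval_eq_mul, PiLp.add_apply] at e1 e2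
    linarith
  have hu' := hlin u hu
  have hv' := hlin v hv
  have ha' : ∀ i, a i = (bif (o.row i).neg then -1 else 1) * a (o.row i).j + (o.row i).t := by
    intro i
    have e2 := congrArg (fun y : E3 => y i) ha
    simp only [Op.act_apply, Row.eval_eq_mul] at e2
    exact e2.symm
  obtain ⟨hperm, hp1, hp2⟩ := ho
  rw [Op.cls_eq, Op.even_eq, Op.tsum, Op.sgn]
  have hu0 := hu' 0
  have hu1 := hu' 1
  have hu2 := hu' 2
  have hv0 := hv' 0
  have hv1 := hv' 1
  have hv2 := hv' 2
  have ha0 := ha' 0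
  have ha1 := ha' 1
  have ha2 := ha' 2
  have hj := hperm.cases
  clear hlin hu' hv' ha' ha hu hv huv hperm
  obtain ⟨⟨j, n, t⟩, ⟨j', n', t'⟩, ⟨j'', n'', t''⟩⟩ := o
  simp only [Op.row_zero, Op.row_one, Op.row_two] at *
  simp only [List.mem_cons, Prod.mk.injEq, List.not_mem_nil, or_false] at hj
  rcases hj with ⟨rfl, rfl, rfl⟩ | ⟨rfl, rfl, rfl⟩ | ⟨rfl, rfl, rfl⟩ | ⟨rfl, rfl, rfl⟩ |
    ⟨rfl, rfl, rfl⟩ | ⟨rfl, rfl, rfl⟩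
  · have hz : ∀ {n : Bool} {x : ℝ}, x = (bif n then -1 else 1) * x → n = true → x = 0 := by
      rintro n x hx rfl
      simp only [cond_true] at hx
      linarith
    have ht : ∀ {n : Bool} {x : ℝ} {t : ℤ}, x = (bif n then -1 else 1) * x + t → n = false →
        t = 0 := by
      rintro n x t hx rfl
      simp only [cond_false] at hx
      exact int_zero (by linarith)
    cases n
    · obtain rfl := ht ha0 rfl
      cases n'
      · obtain rfl := ht ha1 rfl
        cases n''
        · obtain rfl := ht ha2 rfl
          exact absurd rfl h1
        · simp
          omega
      · cases n''
        · obtain rfl := ht ha2 rfl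
          simp
          omega
        · exact absurd (by simp [hz hu1 rfl, hz hv1 rfl, hz hu2 rfl, hz hv2 rfl]) hmin
    · cases n'
      · cases n''
        · obtain rfl := ht ha1 rfl
          obtain rfl := ht ha2 rfl
          simp
          omega
        · exact absurd (by simp [hz hu0 rfl, hz hv0 rfl, hz hu2 rfl, hz hv2 rfl]) hmin
      · exact absurd (by simp [hz hu0 rfl, hz hv0 rfl, hz hu1 rfl, hz hv1 rfl]) hmin
  · obtain ⟨e1, e2⟩ := transposition hu1 hu2 hu0 hv1 hv2 hv0 ha1 ha2 ha0
      (fun h => hmin ⟨by linarith [h.1], by linarith [h.2], by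
        linear_combination v 2 * hu1 - u 2 * hv1⟩) (by omega) (by omega)
    have e3 : xor n (xor n' n'') = false := by rw [← e2]; cases n <;> cases n' <;> cases n'' <;> rfl
    have e4 : (t + t' + t'') % 4 = 0 := by omega
    rw [e3, e4]
    simp
  · obtain ⟨e1, e2⟩ := transposition hu0 hu1 hu2 hv0 hv1 hv2 ha0 ha1 ha2
      (fun h => hmin ⟨by linear_combination v 1 * hu0 - u 1 * hv0, by linarith [h.1], by
        linarith [h.2]⟩) (by omega) (by omega)
    rw [e2, e1]
    simp
  · exact absurd ⟨by linear_combination v 1 * hu0 - u 1 * hv0,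
      by linear_combination u 0 * hv2 - v 0 * hu2, by linear_combination v 2 * hu1 - u 2 * hv1⟩ hmin
  · exact absurd ⟨by linear_combination u 0 * hv1 - v 0 * hu1,
      by linear_combination v 2 * hu0 - u 2 * hv0, by linear_combination u 1 * hv2 - v 1 * hu2⟩ hmin
  · obtain ⟨e1, e2⟩ := transposition hu0 hu2 hu1 hv0 hv2 hv1 ha0 ha2 ha1
      (fun h => hmin ⟨by linarith [h.1], by linear_combination v 2 * hu0 - u 2 * hv0, by
        linarith [h.2]⟩) (by omega) (by omega)
    have e3 : xor n (xor n' n'') = false := by rw [← e2]; cases n <;> cases n' <;> cases n'' <;> rfl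
    have e4 : (t + t' + t'') % 4 = 0 := by omega
    rw [e3, e4]
    simp

theorem cls_of_reflection {φ : E3 ≃ᵈ E3} {g : Isom3} {o : Op} (ho : o.Valid)
    (hg : ∀ x, g (φ x) = φ (o.act x)) (hr : IsPlaneReflection g) :
    o.cls = 4 ∨ o.cls = 6 ∨ o.cls = 8 := by
  obtain ⟨H, hdim, hH⟩ := hr
  obtain ⟨r, U, hr, hU⟩ := exists_linear φ
  have hne : (H : Set E3).Nonempty := by
    by_contra hemp
    rw [Set.not_nonempty_iff_eq_empty, AffineSubspace.coe_eq_bot_iff] at hemp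
    rw [hemp, AffineSubspace.direction_bot, finrank_bot] at hdim
    omega
  obtain ⟨y, hy⟩ := hne
  obtain ⟨a, rfl⟩ := φ.surjective y
  let b := Module.finBasisOfFinrankEq ℝ H.direction hdim
  obtain ⟨hb1, hb2⟩ := linearIndependent_fin2.1 b.linearIndependent
  have hfix : ∀ w : H.direction, o.act (a + r⁻¹ • U.symm w) = a + r⁻¹ • U.symm w := by
    intro w
    apply φ.injective
    have h1 : φ (a + r⁻¹ • U.symm w) = w +ᵥ φ a := by
      rw [hU, U.map_smul, smul_smul, mul_inv_cancel₀ hr.ne', one_smul, U.apply_symm_apply, add_comm]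
      rfl
    rw [← hg, hH, h1]
    exact AffineSubspace.vadd_mem_of_mem_direction w.2 hy
  have hlin : ∀ w w' : E3, r⁻¹ • U.symm w = r⁻¹ • U.symm w' → w = w' := fun w w' h =>
    U.symm.injective (smul_right_injective E3 (inv_ne_zero hr.ne') h)
  refine cls_of_plane ho ?_ (by rw [← φ.injective.eq_iff, ← hg, hH]; exact hy) (hfix (b 1))
    (hfix (b 0)) ?_ ?_
  · rintro rfl
    have htop : H = ⊤ := by
      rw [← top_le_iff]
      intro y _
      rw [← hH]
      obtain ⟨x, rfl⟩ := φ.surjective y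
      rw [hg, Op.one_act]
    rw [htop, AffineSubspace.direction_top, finrank_top] at hdim
    simp at hdim
  · intro h0
    apply hb1
    apply Subtype.ext
    refine hlin _ _ ?_
    rw [h0]
    simp
  · intro c hc
    apply hb2 c
    apply Subtype.ext
    refine hlin _ _ ?_
    rw [← hc]
    simp only [Submodule.coe_smul, map_smul]
    rw [smul_comm]

theorem HasMask.reflectionFree_iff {φ : E3 ≃ᵈ E3} {G : Subgroup Isom3} {m : ℕ} (h : HasMask φ G m) :
    IsReflectionFree G ↔
      Nat.testBit m 4 = false ∧ Nat.testBit m 6 = false ∧ Nat.testBit m 8 = false := by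
  constructor
  · intro hf
    have := mt h.not_reflectionFree (not_not.2 hf)
    simpa using this
  · rintro ⟨h4, h6, h8⟩ g hg hr
    obtain ⟨o, ho, hgo⟩ := (h.2 g).1 hg
    have h5 := ho.2
    rcases cls_of_reflection ho.1 hgo hr with hc | hc | hc <;> rw [hc] at h5 <;> simp_all

end Cubic

namespace Cubic

/-! ### The groups of the table -/

/-- In the coordinates `φ` the triplet `f` is the operation `o`. -/
def Rep (φ : E3 ≃ᵈ E3) (f : Triplet) (o : Op) : Prop :=
  ∀ x, WithLp.toLp 2 (f (φ x 0) (φ x 1) (φ x 2)) = φ (o.act x)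

/-- Reduces the determination of a group of the International Tables to translating its triplets
into operations; everything else is a computation with classes. It is applied once for each group.
-/
theorem hasMask_generatedBy {φ : E3 ≃ᵈ E3} {l : List Triplet} {os : List Op} {m : ℕ}
    (hrep : List.Forall₂ (Rep φ) l os)
    (hm : Nat.testBit m 0 = true ∧ (∀ i < 16, ∀ j < 16, Nat.testBit m i = true →
      Nat.testBit m j = true → Nat.testBit m (mulC i j) = true) ∧
      ∀ i < 16, Nat.testBit m i = true → Nat.testBit m (invC i) = true)
    (hos : ∀ o ∈ os, o.Valid ∧ Nat.testBit m o.cls = true)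
    (hgen : ∀ H, (∀ o ∈ os, OpIn φ H o) → OpIn φ H (translation 2 2 0) ∧
      OpIn φ H (translation 2 0 2) ∧ OpIn φ H (translation 0 2 2) ∧
      OpIn φ H (diag true true false) ∧ OpIn φ H (diag true false true) ∧ OpIn φ H cyc)
    (hCm : ∀ b ∈ maskBounds, (∀ o ∈ os, Nat.testBit b.1 o.cls = true) →
      (∀ i < 16, Nat.testBit b.1 i = true → Nat.testBit m i = true) → b.1 = m) :
    HasMask φ (generatedBy l) m := by
  have hos' : ∀ o ∈ os, OpIn φ (generatedBy l) o := by
    intro o ho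
    obtain ⟨i, hi, rfl⟩ := List.getElem_of_mem ho
    have hi' : i < l.length := by rw [hrep.length_eq]; exact hi
    have hr : Rep φ l[i] os[i] := hrep.get hi' hi
    have hv := (hos _ ho).1
    have hg := Op.isoVia_apply φ hv.1
    refine ⟨hv, _, Subgroup.subset_closure ⟨l[i], List.getElem_mem _, fun p => ?_⟩, hg⟩
    obtain ⟨x, rfl⟩ := φ.surjective p
    rw [hg]
    exact (hr x).symm
  obtain ⟨h1, h2, h3, h4, h5, h6⟩ := hgen _ hos'
  refine hasMask_closure ⟨hm.1, hm.2.1, hm.2.2⟩ ?_ h1 h2 h3 h4 h5 h6 hos' hCm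
  rintro g ⟨f, hf, hg⟩
  obtain ⟨i, hi, rfl⟩ := List.getElem_of_mem hf
  have hi' : i < os.length := by rw [← hrep.length_eq]; exact hi
  have hr : Rep φ l[i] os[i] := hrep.get hi hi'
  exact ⟨os[i], hos _ (List.getElem_mem _), fun x => by rw [hg]; exact hr x⟩

theorem quarter_ne_zero : (1 / 4 : ℝ) ≠ 0 := by norm_num

/-- Coordinates for the face centered groups. -/
noncomputable def coordsF : E3 ≃ᵈ E3 := scaleDil (1 / 4) quarter_ne_zero 0

/-- Coordinates for the primitive and body centered groups. -/
noncomputable def coordsP : E3 ≃ᵈ E3 := scaleDil (1 / 2) half_ne_zero 0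

/-- Coordinates with a shifted origin. -/
noncomputable def coordsS : E3 ≃ᵈ E3 :=
  scaleDil (1 / 2) half_ne_zero (WithLp.toLp 2 fun _ => 1 / 4)

@[simp] theorem coordsF_apply (x : E3) (i : Fin 3) : coordsF x i = x i / 4 := by
  rw [coordsF, scaleDil_apply]; simp; ring

@[simp] theorem coordsP_apply (x : E3) (i : Fin 3) : coordsP x i = x i / 2 := by
  rw [coordsP, scaleDil_apply]; simp; ring

@[simp] theorem coordsS_apply (x : E3) (i : Fin 3) : coordsS x i = x i / 2 + 1 / 4 := by
  rw [coordsS, scaleDil_apply]; simp; ring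

theorem rep_iff {φ : E3 ≃ᵈ E3} {f : Triplet} {o : Op} : Rep φ f o ↔ ∀ x,
    f (φ x 0) (φ x 1) (φ x 2) 0 = φ (o.act x) 0 ∧ f (φ x 0) (φ x 1) (φ x 2) 1 = φ (o.act x) 1 ∧
      f (φ x 0) (φ x 1) (φ x 2) 2 = φ (o.act x) 2 := by
  refine forall_congr' fun x => ⟨fun h => ?_, fun h => ?_⟩
  · rw [← h]; exact ⟨rfl, rfl, rfl⟩
  · ext i
    fin_cases i
    · exact h.1
    · exact h.2.1
    · exact h.2.2

def opsLatticeP : List Op := [translation 2 0 0, translation 0 2 0, translation 0 0 2]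

def opsLatticeF : List Op :=
  [translation 4 0 0, translation 0 4 0, translation 0 0 4, translation 0 2 2, translation 2 0 2]

def ops23 : List Op := [diag true true false, diag true false true, cyc]

/-- The operation `(x, y, z) ↦ (y + a, x + b, ± z + c)`. -/
def swapOp (n : Bool) (a b c : ℤ) : Op := ⟨⟨1, false, a⟩, ⟨0, false, b⟩, ⟨2, n, c⟩⟩

def inversion (a : ℤ) : Op := ⟨⟨0, true, a⟩, ⟨1, true, a⟩, ⟨2, true, a⟩⟩

def opsF4132 : List Op :=
  [⟨⟨0, true, 0⟩, ⟨1, true, 2⟩, ⟨2, false, 2⟩⟩, ⟨⟨0, true, 2⟩, ⟨1, false, 2⟩, ⟨2, true, 0⟩⟩, cyc,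
    swapOp true 3 1 3]

theorem rep_latticeP : List.Forall₂ (Rep coordsP) latticeP opsLatticeP := by
  simp only [latticeP, opsLatticeP, List.forall₂_cons, rep_iff, List.Forall₂.nil, and_true]
  refine ⟨?_, ?_, ?_⟩ <;> intro x <;> simp [translation, Row.eval] <;> ring

theorem rep_latticeP_S : List.Forall₂ (Rep coordsS) latticeP opsLatticeP := by
  simp only [latticeP, opsLatticeP, List.forall₂_cons, rep_iff, List.Forall₂.nil, and_true]
  refine ⟨?_, ?_, ?_⟩ <;> intro x <;> simp [translation, Row.eval] <;> ring

theorem rep_latticeI :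
    List.Forall₂ (Rep coordsP) latticeI (opsLatticeP ++ [translation 1 1 1]) := by
  refine List.rel_append rep_latticeP ?_
  simp only [List.forall₂_cons, rep_iff, List.Forall₂.nil, and_true]
  intro x
  simp [translation, Row.eval]
  refine ⟨?_, ?_, ?_⟩ <;> ring

theorem rep_latticeF : List.Forall₂ (Rep coordsF) latticeF opsLatticeF := by
  simp only [latticeF, latticeP, opsLatticeF, List.cons_append, List.nil_append, List.forall₂_cons,
    rep_iff, List.Forall₂.nil, and_true]
  refine ⟨?_, ?_, ?_, ?_, ?_⟩ <;> intro x <;> simp [translation, Row.eval] <;>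
    (try constructor) <;> ring

theorem rep_gens23_P : List.Forall₂ (Rep coordsP) gens23 ops23 := by
  simp only [gens23, ops23, List.forall₂_cons, rep_iff, List.Forall₂.nil, and_true]
  refine ⟨?_, ?_, ?_⟩ <;> intro x <;> simp [diag, cyc, Row.eval] <;> (try constructor) <;> ring

theorem rep_gens23_F : List.Forall₂ (Rep coordsF) gens23 ops23 := by
  simp only [gens23, ops23, List.forall₂_cons, rep_iff, List.Forall₂.nil, and_true]
  refine ⟨?_, ?_, ?_⟩ <;> intro x <;> simp [diag, cyc, Row.eval] <;> (try constructor) <;> ring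

end Cubic

namespace Cubic

/-! ### The masks of the fourteen groups -/

theorem rep_append {φ : E3 ≃ᵈ E3} {l l' : List Triplet} {os os' : List Op}
    (h : List.Forall₂ (Rep φ) l os) (h' : List.Forall₂ (Rep φ) l' os') :
    List.Forall₂ (Rep φ) (l ++ l') (os ++ os') := List.rel_append h h'

theorem rep_F4132 : List.Forall₂ (Rep coordsF) gensF4132 opsF4132 := by
  simp only [gensF4132, opsF4132, List.forall₂_cons, rep_iff, List.Forall₂.nil, and_true]
  refine ⟨?_, ?_, ?_, ?_⟩ <;> intro x <;> simp [swapOp, cyc, Row.eval] <;>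
    refine ⟨?_, ?_, ?_⟩ <;> ring

theorem rep_swap_F (n : Bool) (a b c : ℤ) : Rep coordsF
    (fun x y z => ![y + a / 4, x + b / 4, (bif n then -z else z) + c / 4]) (swapOp n a b c) := by
  rw [rep_iff]
  intro x
  cases n <;> simp [swapOp, Row.eval] <;> refine ⟨?_, ?_, ?_⟩ <;> ring

theorem rep_swap_P (n : Bool) (a b c : ℤ) : Rep coordsP
    (fun x y z => ![y + a / 2, x + b / 2, (bif n then -z else z) + c / 2]) (swapOp n a b c) := by
  rw [rep_iff]
  intro x
  cases n <;> simp [swapOp, Row.eval] <;> refine ⟨?_, ?_, ?_⟩ <;> ring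

theorem rep_inversion_F (a : ℤ) : Rep coordsF
    (fun x y z => ![-x + a / 4, -y + a / 4, -z + a / 4]) (inversion a) := by
  rw [rep_iff]
  intro x
  simp [inversion, Row.eval]
  refine ⟨?_, ?_, ?_⟩ <;> ring

theorem rep_inversion_P (a : ℤ) : Rep coordsP
    (fun x y z => ![-x + a / 2, -y + a / 2, -z + a / 2]) (inversion a) := by
  rw [rep_iff]
  intro x
  simp [inversion, Row.eval]
  refine ⟨?_, ?_, ?_⟩ <;> ring

theorem generators_of_F {φ : E3 ≃ᵈ E3} {H : Subgroup Isom3} (h : ∀ o ∈ opsLatticeF, OpIn φ H o) :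
    OpIn φ H (translation 2 2 0) ∧ OpIn φ H (translation 2 0 2) ∧ OpIn φ H (translation 0 2 2) := by
  have h1 : OpIn φ H (translation 0 2 2) := h _ (by simp [opsLatticeF])
  have h2 : OpIn φ H (translation 2 0 2) := h _ (by simp [opsLatticeF])
  have h3 : OpIn φ H (translation 0 0 4) := h _ (by simp [opsLatticeF])
  exact ⟨(h1.mul h2).mul h3.inv, h2, h1⟩

theorem generators_of_P {φ : E3 ≃ᵈ E3} {H : Subgroup Isom3} (h : ∀ o ∈ opsLatticeP, OpIn φ H o) :
    OpIn φ H (translation 2 2 0) ∧ OpIn φ H (translation 2 0 2) ∧ OpIn φ H (translation 0 2 2) := by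
  have h1 : OpIn φ H (translation 2 0 0) := h _ (by simp [opsLatticeP])
  have h2 : OpIn φ H (translation 0 2 0) := h _ (by simp [opsLatticeP])
  have h3 : OpIn φ H (translation 0 0 2) := h _ (by simp [opsLatticeP])
  exact ⟨h1.mul h2, h1.mul h3, h2.mul h3⟩

theorem generators_of_23 {φ : E3 ≃ᵈ E3} {H : Subgroup Isom3} (h : ∀ o ∈ ops23, OpIn φ H o) :
    OpIn φ H (diag true true false) ∧ OpIn φ H (diag true false true) ∧ OpIn φ H cyc :=
  ⟨h _ (by simp [ops23]), h _ (by simp [ops23]), h _ (by simp [ops23])⟩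

/-- The screw rotations become half-turns about the axes after removing translations of the face
centered lattice. -/
theorem generators_of_F4132 {φ : E3 ≃ᵈ E3} {H : Subgroup Isom3} (h1 : OpIn φ H (translation 2 2 0))
    (h2 : OpIn φ H (translation 0 2 2)) (h : ∀ o ∈ opsF4132, OpIn φ H o) :
    OpIn φ H (diag true true false) ∧ OpIn φ H (diag true false true) ∧ OpIn φ H cyc :=
  ⟨h2.inv.mul (h ⟨⟨0, true, 0⟩, ⟨1, true, 2⟩, ⟨2, false, 2⟩⟩ (by simp [opsF4132])),
    h1.inv.mul (h ⟨⟨0, true, 2⟩, ⟨1, false, 2⟩, ⟨2, true, 0⟩⟩ (by simp [opsF4132])),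
    h _ (by simp [opsF4132])⟩

theorem generators_append_right {P : Op → Prop} {l l' : List Op} (h : ∀ o ∈ l ++ l', P o) :
    ∀ o ∈ l', P o := fun o ho => h o (List.mem_append_right _ ho)

theorem generators_append_left {P : Op → Prop} {l l' : List Op} (h : ∀ o ∈ l ++ l', P o) :
    ∀ o ∈ l, P o := fun o ho => h o (List.mem_append_left _ ho)

theorem generators_F23 {φ : E3 ≃ᵈ E3} {l : List Op} (H : Subgroup Isom3)
    (h : ∀ o ∈ opsLatticeF ++ ops23 ++ l, OpIn φ H o) : OpIn φ H (translation 2 2 0) ∧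
      OpIn φ H (translation 2 0 2) ∧ OpIn φ H (translation 0 2 2) ∧
      OpIn φ H (diag true true false) ∧ OpIn φ H (diag true false true) ∧ OpIn φ H cyc := by
  have h' := generators_append_left h
  obtain ⟨h1, h2, h3⟩ := generators_of_F (generators_append_left h')
  exact ⟨h1, h2, h3, generators_of_23 (generators_append_right h')⟩

theorem generators_P23 {φ : E3 ≃ᵈ E3} {l : List Op} (H : Subgroup Isom3)
    (h : ∀ o ∈ opsLatticeP ++ ops23 ++ l, OpIn φ H o) : OpIn φ H (translation 2 2 0) ∧
      OpIn φ H (translation 2 0 2) ∧ OpIn φ H (translation 0 2 2) ∧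
      OpIn φ H (diag true true false) ∧ OpIn φ H (diag true false true) ∧ OpIn φ H cyc := by
  have h' := generators_append_left h
  obtain ⟨h1, h2, h3⟩ := generators_of_P (generators_append_left h')
  exact ⟨h1, h2, h3, generators_of_23 (generators_append_right h')⟩

theorem generators_I23 {φ : E3 ≃ᵈ E3} {l : List Op} (H : Subgroup Isom3)
    (h : ∀ o ∈ opsLatticeP ++ [translation 1 1 1] ++ ops23 ++ l, OpIn φ H o) :
    OpIn φ H (translation 2 2 0) ∧
      OpIn φ H (translation 2 0 2) ∧ OpIn φ H (translation 0 2 2) ∧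
      OpIn φ H (diag true true false) ∧ OpIn φ H (diag true false true) ∧ OpIn φ H cyc := by
  have h' := generators_append_left h
  obtain ⟨h1, h2, h3⟩ := generators_of_P (generators_append_left (generators_append_left h'))
  exact ⟨h1, h2, h3, generators_of_23 (generators_append_right h')⟩

theorem generators_F41 {φ : E3 ≃ᵈ E3} {l : List Op} (H : Subgroup Isom3)
    (h : ∀ o ∈ opsLatticeF ++ opsF4132 ++ l, OpIn φ H o) : OpIn φ H (translation 2 2 0) ∧
      OpIn φ H (translation 2 0 2) ∧ OpIn φ H (translation 0 2 2) ∧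
      OpIn φ H (diag true true false) ∧ OpIn φ H (diag true false true) ∧ OpIn φ H cyc := by
  have h' := generators_append_left h
  obtain ⟨h1, h2, h3⟩ := generators_of_F (generators_append_left h')
  exact ⟨h1, h2, h3, generators_of_F4132 h1 h3 (generators_append_right h')⟩

theorem forall₂_singleton {φ : E3 ≃ᵈ E3} {f : Triplet} {o : Op} (h : Rep φ f o) :
    List.Forall₂ (Rep φ) [f] [o] := .cons h .nil

theorem triplet_congr {φ : E3 ≃ᵈ E3} {f f' : Triplet} {o : Op} (h : Rep φ f o)
    (hf : ∀ x y z, f' x y z = f x y z) : Rep φ f' o := fun x => by rw [hf]; exact h x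

theorem hasMask_F23 : HasMask coordsF TableGroup.F23.group 1 := by
  have h := hasMask_generatedBy (m := 1) (rep_append (rep_append rep_latticeF rep_gens23_F)
    List.Forall₂.nil) (by decide +kernel) (by decide +kernel) generators_F23 (by decide +kernel)
  rwa [List.append_nil] at h

theorem hasMask_F432 : HasMask coordsF TableGroup.F432.group 4097 :=
  hasMask_generatedBy (rep_append (rep_append rep_latticeF rep_gens23_F)
    (forall₂_singleton (triplet_congr (rep_swap_F true 0 0 0) (by simp))))
    (by decide +kernel) (by decide +kernel) generators_F23 (by decide +kernel)

theorem hasMask_Fm43c : HasMask coordsF TableGroup.Fm43c.group 1025 :=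
  hasMask_generatedBy (rep_append (rep_append rep_latticeF rep_gens23_F)
    (forall₂_singleton (triplet_congr (rep_swap_F false 2 2 2) (by norm_num))))
    (by decide +kernel) (by decide +kernel) generators_F23 (by decide +kernel)

theorem hasMask_F2dm3 : HasMask coordsF TableGroup.F2dm3.group 129 :=
  hasMask_generatedBy (rep_append (rep_append rep_latticeF rep_gens23_F)
    (forall₂_singleton (triplet_congr (rep_inversion_F 1) (by simp))))
    (by decide +kernel) (by decide +kernel) generators_F23 (by decide +kernel)

theorem hasMask_F4132 : HasMask coordsF TableGroup.F4132.group 32769 := by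
  have h := hasMask_generatedBy (m := 32769) (rep_append (rep_append rep_latticeF rep_F4132)
    List.Forall₂.nil) (by decide +kernel) (by decide +kernel) generators_F41 (by decide +kernel)
  rwa [List.append_nil] at h

theorem hasMask_F41dm32n : HasMask coordsF TableGroup.F41dm32n.group 33825 :=
  hasMask_generatedBy (rep_append (rep_append rep_latticeF rep_F4132)
    (forall₂_singleton (triplet_congr (rep_inversion_F 3) (by simp))))
    (by decide +kernel) (by decide +kernel) generators_F41 (by decide +kernel)

theorem hasMask_P23 : HasMask coordsP TableGroup.P23.group 5 := by
  have h := hasMask_generatedBy (m := 5) (rep_append (rep_append rep_latticeP rep_gens23_P)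
    List.Forall₂.nil) (by decide +kernel) (by decide +kernel) generators_P23 (by decide +kernel)
  rwa [List.append_nil] at h

theorem hasMask_P432 : HasMask coordsP TableGroup.P432.group 20485 :=
  hasMask_generatedBy (rep_append (rep_append rep_latticeP rep_gens23_P)
    (forall₂_singleton (triplet_congr (rep_swap_P true 0 0 0) (by simp))))
    (by decide +kernel) (by decide +kernel) generators_P23 (by decide +kernel)

theorem hasMask_Pm43n : HasMask coordsP TableGroup.Pm43n.group 2565 :=
  hasMask_generatedBy (rep_append (rep_append rep_latticeP rep_gens23_P)
    (forall₂_singleton (triplet_congr (rep_swap_P false 1 1 1) (by simp))))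
    (by decide +kernel) (by decide +kernel) generators_P23 (by decide +kernel)

theorem hasMask_P4232 : HasMask coordsP TableGroup.P4232.group 40965 :=
  hasMask_generatedBy (rep_append (rep_append rep_latticeP rep_gens23_P)
    (forall₂_singleton (triplet_congr (rep_swap_P true 1 1 1) (by simp))))
    (by decide +kernel) (by decide +kernel) generators_P23 (by decide +kernel)

theorem hasMask_P4nm32n : HasMask coordsP TableGroup.P4nm32n.group 23205 :=
  hasMask_generatedBy (rep_append (rep_append rep_latticeP rep_gens23_P)
    (.cons (triplet_congr (rep_swap_P true 0 0 0) (by simp))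
      (forall₂_singleton (triplet_congr (rep_inversion_P 1) (by simp)))))
    (by decide +kernel) (by decide +kernel) generators_P23 (by decide +kernel)

theorem hasMask_I23 : HasMask coordsP TableGroup.I23.group 15 := by
  have h := hasMask_generatedBy (m := 15) (rep_append (rep_append rep_latticeI rep_gens23_P)
    List.Forall₂.nil) (by decide +kernel) (by decide +kernel) generators_I23 (by decide +kernel)
  rwa [List.append_nil] at h

theorem hasMask_I432 : HasMask coordsP TableGroup.I432.group 61455 :=
  hasMask_generatedBy (rep_append (rep_append rep_latticeI rep_gens23_P)
    (forall₂_singleton (triplet_congr (rep_swap_P true 0 0 0) (by simp))))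
    (by decide +kernel) (by decide +kernel) generators_I23 (by decide +kernel)

/-- In this setting the origin is a centre of inversion. Shifting it by 1/4 in each coordinate moves
the twofold axes onto the coordinate axes and turns the inversion into `x ↦ -x - 1`. -/
theorem hasMask_P2nm3 : HasMask coordsS TableGroup.P2nm3.group 165 := by
  refine hasMask_generatedBy (os := opsLatticeP ++ (ops23 ++ [inversion (-1)]))
    (rep_append rep_latticeP_S ?_)
    (by decide +kernel) (by decide +kernel) (fun H h => ?_) (by decide +kernel)
  · simp only [ops23, List.cons_append, List.nil_append, List.forall₂_cons, rep_iff,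
      List.Forall₂.nil, and_true]
    refine ⟨?_, ?_, ?_, ?_⟩ <;> intro x <;> simp [diag, cyc, inversion, Row.eval] <;>
      (try refine ⟨?_, ?_, ?_⟩) <;> (try constructor) <;> ring
  · rw [← List.append_assoc] at h
    exact generators_P23 H h

/-! ### The theorem -/

def tableMask : TableGroup → ℕ
  | .F23 => 1
  | .F432 => 4097
  | .Fm43c => 1025
  | .F2dm3 => 129
  | .P23 => 5
  | .F4132 => 32769
  | .P432 => 20485
  | .I23 => 15
  | .P2nm3 => 165
  | .F41dm32n => 33825
  | .Pm43n => 2565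
  | .P4232 => 40965
  | .P4nm32n => 23205
  | .I432 => 61455

theorem exists_hasMask_group (t : TableGroup) : ∃ φ, HasMask φ t.group (tableMask t) := by
  cases t
  · exact ⟨_, hasMask_F23⟩
  · exact ⟨_, hasMask_F432⟩
  · exact ⟨_, hasMask_Fm43c⟩
  · exact ⟨_, hasMask_F2dm3⟩
  · exact ⟨_, hasMask_P23⟩
  · exact ⟨_, hasMask_F4132⟩
  · exact ⟨_, hasMask_P432⟩
  · exact ⟨_, hasMask_I23⟩
  · exact ⟨_, hasMask_P2nm3⟩
  · exact ⟨_, hasMask_F41dm32n⟩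
  · exact ⟨_, hasMask_Pm43n⟩
  · exact ⟨_, hasMask_P4232⟩
  · exact ⟨_, hasMask_P4nm32n⟩
  · exact ⟨_, hasMask_I432⟩

def tableGroups : List TableGroup :=
  [.F23, .F432, .Fm43c, .F2dm3, .P23, .F4132, .P432, .I23, .P2nm3, .F41dm32n, .Pm43n, .P4232,
    .P4nm32n, .I432]

theorem tableMask_bound (t : TableGroup) : ∀ c < 16,
    (conjMask c (tableMask t), t.bound) ∈ maskBounds ∨
      t.bound = 17 ∧ (conjMask c (tableMask t) = 8193 ∨ conjMask c (tableMask t) = 32769) := by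
  cases t <;> decide +kernel

theorem tableMask_reflectionFree (t : TableGroup) : Nat.testBit (tableMask t) 4 = false ∧
    Nat.testBit (tableMask t) 6 = false ∧ Nat.testBit (tableMask t) 8 = false := by
  cases t <;> decide +kernel

/-- Class 1 is a pure translation; conjugation by it shifts by 2 the translation part of the classes
with negative product of signs. This is the only identification between masks that is needed. -/
theorem reflectionFree_masks : ∀ b ∈ maskBounds, Nat.testBit b.1 4 = false →
    Nat.testBit b.1 6 = false → Nat.testBit b.1 8 = false →
    ∃ t ∈ tableGroups, b.1 = tableMask t ∨ conjMask 1 b.1 = tableMask t := by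
  decide +kernel

end Cubic

theorem theorem1p3 :
    -- every Dirichlet stereohedron for a full cubic group has at most 25 facets
    (∀ G : Subgroup Isom3, IsFullCubic G → ∀ P : Set E3, IsDirichletStereohedron G P →
      (facets P).encard ≤ 25) ∧
    -- the full cubic groups without reflections are, up to similarity, the groups of the table
    (∀ G : Subgroup Isom3, (IsFullCubic G ∧ IsReflectionFree G) ↔
      ∃ t : TableGroup, AreSimilar t.group G) ∧
    -- the bound of the table for each of them, for base points with trivial stabilizer
    (∀ (t : TableGroup) (G : Subgroup Isom3), AreSimilar t.group G →
      ∀ p : E3, HasTrivialStabilizer G p →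
        (facets (voronoiCell (orbitOf G p) p)).encard ≤ (t.bound : ℕ∞)) ∧
    -- the largest bound of the table is 25, and it occurs exactly twice
    (∀ t : TableGroup, t.bound ≤ 25 ∧
      (t.bound = 25 ↔ t = TableGroup.F41dm32n ∨ t = TableGroup.P4232)) := by
  have htable : ∀ (t : TableGroup) (G : Subgroup Isom3), AreSimilar t.group G →
      ∃ φ, Cubic.HasMask φ G (Cubic.tableMask t) := by
    rintro t G ⟨ψ, hψ⟩
    obtain ⟨φ, hφ⟩ := Cubic.exists_hasMask_group t
    exact ⟨_, hφ.trans hψ⟩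
  refine ⟨?_, fun G => ⟨?_, ?_⟩, ?_, ?_⟩
  · rintro G hG P ⟨p, rfl⟩
    obtain ⟨φ, m, h⟩ := Cubic.IsFullCubic.exists_hasMask hG
    exact h.encard_facets_le_twentyfive p
  · rintro ⟨hG, hfree⟩
    obtain ⟨φ, m, h⟩ := Cubic.IsFullCubic.exists_hasMask hG
    obtain ⟨h4, h6, h8⟩ := h.reflectionFree_iff.1 hfree
    obtain ⟨n, hn⟩ := h.mem_maskBounds
    obtain ⟨t, -, ht⟩ := Cubic.reflectionFree_masks _ hn h4 h6 h8
    obtain ⟨ψ, hψ⟩ := Cubic.exists_hasMask_group t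
    refine ⟨t, ?_⟩
    rcases ht with ht | ht
    · rw [← ht] at hψ
      exact hψ.areSimilar h
    -- The coordinates are changed by an operation of class 1, after which `G` has the mask of the
    -- table.
    · obtain ⟨u, hu, huc⟩ := Cubic.exists_cls 1 (by norm_num)
      have h' := h.conj hu
      rw [huc, ht] at h'
      exact hψ.areSimilar h'
  · rintro ⟨t, ht⟩
    obtain ⟨φ, h⟩ := htable t G ht
    exact ⟨h.isFullCubic, h.reflectionFree_iff.2 (Cubic.tableMask_reflectionFree t)⟩
  · intro t G ht p hp
    obtain ⟨φ, h⟩ := htable t G ht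
    exact h.encard_facets_le_of_bound (Cubic.tableMask_bound t) hp
  · intro t
    cases t <;> simp [TableGroup.bound]
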